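/- **Setting.** A tensor network is a finite hypergraph whose vertices are tensors and whose hyperedges are dimensions, each of a positive integer size; a hyperedge is uncontracted if it has a dangling end. For a set $A$ of vertices let $E(A)$ be the set of hyperedges adjacent to $A$ that are uncontracted or adjacent to a vertex outside $A$. A contraction tree is a rooted binary tree whose leaves are the vertices, each once; contracting (the outputs of) disjoint $A,B$ costs $\prod_{e\in E(A)\cup E(B)}\mathrm{size}(e)$, and the cost of a tree is the sum over its contractions. The data is a tensor network $G_D$ with a nonempty set $\bar E$ of $N$ uncontracted dimensions to be sketched, each adjacent to exactly one tensor, with at most one of them on each tensor, and with a contraction tree $T_0$. An embedding for the data is a tensor network $G_E$ joined to $G_D$ exactly through the edges in $\bar E$, each adjacent to one tensor of $G_E$, and such that each output (uncontracted) edge of $G_E$ is adjacent to one tensor and every other edge to two. A contraction tree $T_B$ of $(G_D,G_E)$ is constrained on $T_0$ if for each contraction $(A,B)$ of $T_0$ there is a contraction $(\hat A,\hat B)$ of $T_B$ whose sets of data vertices are $A$ and $B$. Let $\epsilon>0$, $0<\delta<1$, and let $c_1,c_2>0$ be the constants hidden in $\Omega$ and $\Theta$. Let $\mathcal G^{(\epsilon,\delta)}$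 be the set of embeddings, with $N_E$ denoting the number of tensors, such that (i) for some ordering of the tensors of $G_E$, each tensor has row size at least $c_1N_E\log(1/\delta)/\epsilon^2$, the row size being the product of the sizes of its output edges and of its edges to later tensors; (ii) there is exactly one output edge, and its size $m_E$ (the sketch size) satisfies $c_1N_E\log(1/\delta)/\epsilon^2\le m_E\le c_2N_E\log(1/\delta)/\epsilon^2$. Let $c_{\mathrm{opt}}$ be the minimum of the cost of $T_B$ over all $G_E\in\mathcal G^{(\epsilon,\delta)}$ whose sketch size also satisfies $m_E\ge c_1N\log(1/\delta)/\epsilon^2$ and all contraction trees $T_B$ of $(G_D,G_E)$ constrained on $T_0$. **Algorithm.** Let $m$ be an integer with $c_1N\log(1/\delta)/\epsilon^2\le m\le c_2N\log(1/\delta)/\epsilon^2$, and let every dimension in $\bar E$ have size greater than $m$. The algorithm follows $T_0$. * For each $e\in\bar E$ a matrix of sketch size $m$ is contracted with one of the tensors formed in $T_0$ whose only dimension in $\bar E$ is $e$; the tensor is chosen so that the contractions of $T_0$ whose output has $e$ as its only dimension in $\bar E$, together with this sketching step, are cheapest (carrying $e$ below that tensor and a dimension of size $m$ above it). * For each contraction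 $(U,V)$ of $T_0$ such that both $U$ and $V$ are adjacent to $\bar E$, name $U,V$ so that the product of the sizes of the dimensions of $U$ that are neither dimensions of $V$ nor in $\bar E$ is at most the same product with $U,V$ exchanged. A network of two tensors $v_1,v_2$, joined by an edge of size $m$, is used: the sketch dimension of $\hat U$ (size $m$) goes to $v_1$, that of $\hat V$ goes to $v_1$ by an edge of size $p$ and to $v_2$ by an edge of size $q=\lceil m/p\rceil$, and $v_2$ carries the outgoing sketch dimension; the order is $(((\hat U,v_1),\hat V),v_2)$. Here $\hat U,\hat V$ are the sketched versions of $U,V$, and $p\in\{1,\dots,m\}$ minimizes the cost of these three contractions, counted with incoming dimension $m$ for $\hat U$, incoming dimensions $p,q$ for $\hat V$ and outgoing dimension $m$. * All other contractions are performed as in $T_0$. The output edge of the embedding has size $m$. Let $c$ be the cost of the resulting contraction tree of the data and the constructed embedding. **Theorem.** For all $c_1,c_2>0$ there is a constant $C>0$ depending only on $c_1,c_2$ such that, for all data, $T_0$, $\epsilon$, $\delta$ and $m$ as above, $$c\le C\,\sqrt m\;c_{\mathrm{opt}},$$ and, if moreover $G_D$ is a graph (every contracted edge is adjacent to at most two tensors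 and every uncontracted edge to at most one), then $$c\le C\,m^{0.375}\,c_{\mathrm{opt}}.$$ -/

import Mathlib

/-! ### Tensor networks, contraction trees and their cost -/

/-- A tensor network with vertex (tensor) names in `V` and hyperedge (dimension) names in `E`:
the finite set of its vertices, the hyperedges adjacent to each vertex, the set of hyperedges that
have a dangling end (the uncontracted ones), and the dimension size `exp (w e)` of each hyperedge.
A hyperedge may be adjacent to any number of vertices. -/
structure TensorNetwork (V E : Type*) where
  verts : Finset V
  inc : V → Finset E
  dangling : Finset E
  size : E → ℕ

/-- A rooted binary tree whose leaves carry vertices; an internal vertex is the contraction of the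
tensors formed by its two children. -/
inductive ContractionTree (V : Type*) where
  | leaf (v : V) : ContractionTree V
  | node (l r : ContractionTree V) : ContractionTree V

namespace ContractionTree

variable {V W : Type*}

def leaves : ContractionTree V → List V
  | leaf v => [v]
  | node l r => l.leaves ++ r.leaves

def map (f : V → W) : ContractionTree V → ContractionTree W
  | leaf v => leaf (f v)
  | node l r => node (l.map f) (r.map f)

/-- The set of vertices whose contraction is formed at the root of the tree. -/
def verts [DecidableEq V] (T : ContractionTree V) : Finset V := T.leaves.toFinset

/-- `T` contracts exactly the vertices in `S`, each of them once. -/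
def IsTreeOn [DecidableEq V] (T : ContractionTree V) (S : Finset V) : Prop :=
  T.leaves.Nodup ∧ T.verts = S

/-- The tensors formed in the tree (leaves included), each given by its set of vertices. -/
def tensors [DecidableEq V] : ContractionTree V → List (Finset V)
  | leaf v => [{v}]
  | node l r => (l.verts ∪ r.verts) :: (l.tensors ++ r.tensors)

/-- The contractions `(A, B)` performed in the tree. -/
def contractions [DecidableEq V] : ContractionTree V → List (Finset V × Finset V)
  | leaf _ => []
  | node l r => (l.verts, r.verts) :: (l.contractions ++ r.contractions)

/-- The contraction tree `T` of data and embedding is constrained on the contraction tree `T₀` of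
the data: for each contraction `(A, B)` of `T₀` there is a contraction `(A', B')` of `T` whose data
vertices are `A' ∩ V_D = A` and `B' ∩ V_D = B`. Contractions are unordered pairs. -/
def ConstrainedOn [DecidableEq V] [DecidableEq W]
    (T : ContractionTree (V ⊕ W)) (T₀ : ContractionTree V) : Prop :=
  ∀ p ∈ T₀.contractions, ∃ q ∈ T.contractions,
    (q.1.toLeft = p.1 ∧ q.2.toLeft = p.2) ∨ (q.1.toLeft = p.2 ∧ q.2.toLeft = p.1)

end ContractionTree

namespace TensorNetwork

variable {V E : Type*} [DecidableEq V] [DecidableEq E]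

/-- `E(A) = E(A, V ∖ A) ∪ E(A, *)`: the hyperedges adjacent to `A` that have a dangling end or are
adjacent to a vertex outside `A`, that is, the dimensions of the contraction output of `A`. -/
def boundary (G : TensorNetwork V E) (A : Finset V) : Finset E :=
  (A.biUnion G.inc).filter fun e => e ∈ G.dangling ∨ ∃ v ∈ G.verts \ A, e ∈ G.inc v

/-- The number of vertices adjacent to the hyperedge `e`. -/
def degree (G : TensorNetwork V E) (e : E) : ℕ := (G.verts.filter fun v => e ∈ G.inc v).card

/-- The cost `exp (cut A + cut B - cut (A, B))` of contracting (the outputs of) the disjoint sets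
`A` and `B` by dense matrix multiplication. The hyperedges connecting `A` and `B` are those in
`E(A) ∩ E(B)`, so this is the product of the sizes of the hyperedges in `E(A) ∪ E(B)`. -/
def contractionCost (G : TensorNetwork V E) (A B : Finset V) : ℕ :=
  ∏ e ∈ G.boundary A ∪ G.boundary B, G.size e

/-- The cost of a contraction tree: the sum of the costs of its contractions. -/
def treeCost (G : TensorNetwork V E) (T : ContractionTree V) : ℕ :=
  (T.contractions.map fun p => G.contractionCost p.1 p.2).sum

end TensorNetwork

/-! ### Data tensor networks -/

/-- A data tensor network together with the set `sketch` of the dimensions to be sketched. -/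
structure DataNetwork (VD ED : Type*) extends TensorNetwork VD ED where
  sketch : Finset ED

namespace DataNetwork

variable {VD ED : Type*} [DecidableEq VD] [DecidableEq ED]

/-- The standing assumptions on the data: dimension sizes are positive; there is a dimension to
sketch; the dimensions to be sketched are uncontracted and each is a dimension of only one tensor;
each tensor has at most one of them. -/
structure IsValid (D : DataNetwork VD ED) : Prop where
  size_pos : ∀ e, 0 < D.size e
  sketch_nonempty : D.sketch.Nonempty
  sketch_dangling : D.sketch ⊆ D.dangling
  sketch_degree : ∀ e ∈ D.sketch, D.degree e = 1
  sketch_unique : ∀ v ∈ D.verts, (D.sketch ∩ D.inc v).card ≤ 1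

/-- The data network is a graph: a contracted edge joins two vertices and an uncontracted edge is
adjacent to one vertex. -/
def IsGraph (D : DataNetwork VD ED) : Prop :=
  ∀ e, (e ∈ D.dangling → D.degree e ≤ 1) ∧ (e ∉ D.dangling → D.degree e ≤ 2)

/-- The dimensions to be sketched that are adjacent to the set of vertices `A`. -/
def sketchOf (D : DataNetwork VD ED) (A : Finset VD) : Finset ED :=
  A.biUnion D.inc ∩ D.sketch

/-- The dimensions of the contraction output of `A` that are not to be sketched. -/
def plainBoundary (D : DataNetwork VD ED) (A : Finset VD) : Finset ED :=
  D.boundary A \ D.sketch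

end DataNetwork

/-! ### Embeddings -/

/-- A tensor network embedding for data with dimension names in `ED`. A tensor `x` of the embedding
is adjacent to data dimensions `Sum.inl e` and to embedding edges `Sum.inr f`; `outs` is the set
of the output (uncontracted) edges, which index the rows of the embedding matrix. -/
structure Embedding (ED VE FE : Type*) where
  verts : Finset VE
  inc : VE → Finset (ED ⊕ FE)
  outs : Finset FE
  size : FE → ℕ

namespace Embedding

variable {VD ED VE FE : Type*} [DecidableEq VD] [DecidableEq ED] [DecidableEq VE] [DecidableEq FE]

/-- The number of tensors of the embedding that are adjacent to an edge. -/
def degree (S : Embedding ED VE FE) (e : ED ⊕ FE) : ℕ :=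
  (S.verts.filter fun x => e ∈ S.inc x).card

/-- `S` is a graph embedding for the data `D`: it is connected to the data exactly through the
dimensions to be sketched, each of which is adjacent to one tensor of `S`; each output edge is
adjacent to one tensor of `S` and every other edge to two. -/
structure IsGraphEmbedding (S : Embedding ED VE FE) (D : DataNetwork VD ED) : Prop where
  size_pos : ∀ f, 0 < S.size f
  data_mem : ∀ x ∈ S.verts, ∀ e, Sum.inl e ∈ S.inc x → e ∈ D.sketch
  data_degree : ∀ e ∈ D.sketch, S.degree (Sum.inl e) = 1
  out_degree : ∀ f ∈ S.outs, S.degree (Sum.inr f) = 1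
  inner_degree : ∀ x ∈ S.verts, ∀ f, f ∉ S.outs → Sum.inr f ∈ S.inc x → S.degree (Sum.inr f) = 2

/-- The output sketch size: the number of rows of the embedding matrix. -/
def sketchSize (S : Embedding ED VE FE) : ℕ := ∏ f ∈ S.outs, S.size f

/-- The row size of the matricization of the tensor at `x` in the linearization in which the tensors
are ordered by `ord`: its rows combine the output edges at `x` and the edges from `x` to later
tensors. -/
def rowSize (S : Embedding ED VE FE) (ord : VE → ℕ) (x : VE) : ℕ :=
  ∏ f ∈ (S.inc x).toRight.filter
    (fun f => f ∈ S.outs ∨ ∃ y ∈ S.verts, ord x < ord y ∧ Sum.inr f ∈ S.inc y), S.size f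

/-- There is a linearization in which every tensor of `S` has row size at least `r`. -/
def HasRowSizes (S : Embedding ED VE FE) (r : ℝ) : Prop :=
  ∃ ord : VE → ℕ, Set.InjOn ord S.verts ∧ ∀ x ∈ S.verts, r ≤ (S.rowSize ord x : ℝ)

/-- The overall tensor network formed by the data and the embedding. -/
def total (D : DataNetwork VD ED) (S : Embedding ED VE FE) : TensorNetwork (VD ⊕ VE) (ED ⊕ FE) where
  verts := D.verts.disjSum S.verts
  inc := Sum.elim (fun v => (D.inc v).map Function.Embedding.inl) S.inc
  dangling := (D.dangling \ D.sketch).disjSum S.outs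
  size := Sum.elim D.size S.size

end Embedding

/-- The sketch size `log (1 / δ) / ε ^ 2` required per tensor. -/
noncomputable def sketchUnit (ε δ : ℝ) : ℝ := Real.log (1 / δ) / ε ^ 2

/-- The class of graph embeddings for `D`, with `c₁, c₂` the constants hidden in `Ω` and `Θ`:
with `n` the number of tensors of the embedding, there is a linearization in which each tensor has
row size at least `c₁ n log (1 / δ) / ε ^ 2` (the sufficient condition for accuracy), and there is a
single output dimension, of size between `c₁ n log (1 / δ) / ε ^ 2` and
`c₂ n log (1 / δ) / ε ^ 2`. -/
structure IsAdmissible {VD ED VE FE : Type*} [DecidableEq VD] [DecidableEq ED] [DecidableEq VE]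
    [DecidableEq FE] (D : DataNetwork VD ED) (c₁ c₂ ε δ : ℝ) (S : Embedding ED VE FE) :
    Prop where
  graph : S.IsGraphEmbedding D
  accurate : S.HasRowSizes (c₁ * S.verts.card * sketchUnit ε δ)
  one_output : S.outs.card = 1
  sketchSize_ge : c₁ * S.verts.card * sketchUnit ε δ ≤ S.sketchSize
  sketchSize_le : (S.sketchSize : ℝ) ≤ c₂ * S.verts.card * sketchUnit ε δ

/-- The costs over which the optimization problem minimizes: those of the contraction trees,
constrained on `T₀`, of `D` with an admissible embedding whose sketch size is at least
`c₁ N log (1 / δ) / ε ^ 2`, where `N` is the number of dimensions to be sketched. (The names of the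
tensors and edges of the finite embedding are taken in `ℕ`, without loss of generality.) -/
def feasibleCosts {VD ED : Type*} [DecidableEq VD] [DecidableEq ED] (D : DataNetwork VD ED)
    (T₀ : ContractionTree VD) (c₁ c₂ ε δ : ℝ) : Set ℕ :=
  {c | ∃ (S : Embedding ED ℕ ℕ) (T : ContractionTree (VD ⊕ ℕ)),
    IsAdmissible D c₁ c₂ ε δ S ∧
    c₁ * D.sketch.card * sketchUnit ε δ ≤ S.sketchSize ∧
    T.IsTreeOn (Embedding.total D S).verts ∧
    T.ConstrainedOn T₀ ∧
    c = (Embedding.total D S).treeCost T}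

/-! ### The sketching algorithm

Given the data, its contraction tree and the sketch size `m`, the algorithm builds an embedding and
a contraction tree. For each `e` to be sketched, one Gaussian matrix (with about `m` rows) is applied
to one of the tensors of `T₀` whose only dimension to be sketched is `e`, at the cheapest place.
For each contraction `(U, V)` of `T₀` such that both `U` and `V` have dimensions to be sketched, a
network of two tensors is applied to their sketched versions. All other contractions are
performed as in `T₀`. -/

/-- The tensors of the embedding, named after tensors `W` of the data contraction tree: the matrix
applied to the data tensor `W`, and the first and second tensor of the small network used in
the contraction with output `W`. -/
inductive AlgVertex (VD : Type*) where
  | kron (W : Finset VD) : AlgVertex VD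
  | fst (W : Finset VD) : AlgVertex VD
  | snd (W : Finset VD) : AlgVertex VD
  deriving DecidableEq

/-- The edges of the embedding. The small network of a contraction of `U` and `V` with output
`W`, say with `U` contracted first, receives the sketch dimension of `U` through `whole W` (into its
first tensor), and that of `V` through the two edges `splitFst W` (into its first tensor) and
`splitSnd W` (into its second tensor); `mid W` joins its two tensors. `out` is the output. -/
inductive AlgEdge (VD : Type*) where
  | whole (W : Finset VD) : AlgEdge VD
  | splitFst (W : Finset VD) : AlgEdge VD
  | splitSnd (W : Finset VD) : AlgEdge VD
  | mid (W : Finset VD) : AlgEdge VD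
  | out : AlgEdge VD
  deriving DecidableEq

/-- The choices made by the algorithm: the tensor of the data contraction tree to which the matrix
for `e` is applied, and the size of the edge `splitFst W` of each small network. -/
structure AlgChoices (VD ED : Type*) where
  place : ED → Finset VD
  split : Finset VD → ℕ

/-- The size of `splitSnd` for a given size `p` of `splitFst`: the least `q` with `m ≤ p * q`. -/
def splitRest (m p : ℕ) : ℕ := (m + p - 1) / p

section Algorithm

variable {VD ED : Type*} [DecidableEq VD] [DecidableEq ED]

/-- Both tensors have dimensions to be sketched. -/
def BothSketched (D : DataNetwork VD ED) (U V : Finset VD) : Prop :=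
  (D.sketchOf U).Nonempty ∧ (D.sketchOf V).Nonempty

instance (D : DataNetwork VD ED) (U V : Finset VD) : Decidable (BothSketched D U V) :=
  inferInstanceAs (Decidable (_ ∧ _))

/-- `U` is contracted first: the size of the dimensions that only `U` has is at most the size of
those that only `V` has (dimensions to be sketched left aside). -/
def GoesFirst (D : DataNetwork VD ED) (U V : Finset VD) : Prop :=
  ∏ e ∈ D.plainBoundary U \ D.plainBoundary V, D.size e ≤
    ∏ e ∈ D.plainBoundary V \ D.plainBoundary U, D.size e

instance (D : DataNetwork VD ED) (U V : Finset VD) : Decidable (GoesFirst D U V) :=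
  inferInstanceAs (Decidable (_ ≤ _))

/-- The cost of sketching the part of `T₀` in which `e` is the only dimension to be sketched, when
a matrix with `m` rows is applied to its tensor `W`: contractions inside `W` still carry `e`, those
above `W` carry the sketch dimension instead. -/
def placeCost (D : DataNetwork VD ED) (T₀ : ContractionTree VD) (m : ℕ) (e : ED)
    (W : Finset VD) : ℕ :=
  ((T₀.contractions.filter fun p => D.sketchOf (p.1 ∪ p.2) = {e}).map fun p =>
      (∏ i ∈ D.plainBoundary p.1 ∪ D.plainBoundary p.2, D.size i) *
        (if p.1 ∪ p.2 ⊆ W then D.size e else m)).sum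
    + (∏ i ∈ D.plainBoundary W, D.size i) * D.size e * m

/-- The cost of sketching the contraction of `U` and `V`, both carrying a sketch dimension (of size
`m`, for `V` split into `p` and `splitRest m p`): contract `U` with the first tensor of the
small network, then with `V`, then with the second tensor. -/
def splitCost (D : DataNetwork VD ED) (m : ℕ) (U V : Finset VD) (p : ℕ) : ℕ :=
  (∏ i ∈ D.plainBoundary U, D.size i) * m * p * m
    + (∏ i ∈ D.plainBoundary U ∪ D.plainBoundary V, D.size i) * m * p * splitRest m p
    + (∏ i ∈ D.plainBoundary (U ∪ V), D.size i) * m * splitRest m p * m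

/-- The choices are cheapest possible. -/
structure AlgChoices.IsOptimal (ch : AlgChoices VD ED) (D : DataNetwork VD ED)
    (T₀ : ContractionTree VD) (m : ℕ) : Prop where
  place_mem : ∀ e ∈ D.sketch, ch.place e ∈ T₀.tensors ∧ D.sketchOf (ch.place e) = {e}
  place_min : ∀ e ∈ D.sketch, ∀ W ∈ T₀.tensors, D.sketchOf W = {e} →
    placeCost D T₀ m e (ch.place e) ≤ placeCost D T₀ m e W
  split_mem : ∀ p ∈ T₀.contractions, BothSketched D p.1 p.2 →
    ch.split (p.1 ∪ p.2) ∈ Finset.Icc 1 m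
  split_min : ∀ p ∈ T₀.contractions, BothSketched D p.1 p.2 → ∀ k ∈ Finset.Icc 1 m,
    if GoesFirst D p.1 p.2 then
      splitCost D m p.1 p.2 (ch.split (p.1 ∪ p.2)) ≤ splitCost D m p.1 p.2 k
    else
      splitCost D m p.2 p.1 (ch.split (p.1 ∪ p.2)) ≤ splitCost D m p.2 p.1 k

open ContractionTree in
/-- The contraction tree of data and embedding built by the algorithm. -/
def algTree (D : DataNetwork VD ED) (ch : AlgChoices VD ED) :
    ContractionTree VD → ContractionTree (VD ⊕ AlgVertex VD)
  | leaf v =>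
    if {v} ∈ D.sketch.image ch.place then
      node (leaf (Sum.inl v)) (leaf (Sum.inr (.kron {v})))
    else leaf (Sum.inl v)
  | node l r =>
    let W := l.verts ∪ r.verts
    if W ∈ D.sketch.image ch.place then
      node ((node l r).map Sum.inl) (leaf (Sum.inr (.kron W)))
    else if BothSketched D l.verts r.verts then
      if GoesFirst D l.verts r.verts then
        node (node (node (algTree D ch l) (leaf (Sum.inr (.fst W)))) (algTree D ch r))
          (leaf (Sum.inr (.snd W)))
      else
        node (node (node (algTree D ch r) (leaf (Sum.inr (.fst W)))) (algTree D ch l))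
          (leaf (Sum.inr (.snd W)))
    else node (algTree D ch l) (algTree D ch r)

open ContractionTree in
/-- The edges adjacent to the tensor `x` in the embedding of a subtree whose sketch dimension leaves
through the edges in `o`. -/
def algInc (D : DataNetwork VD ED) (ch : AlgChoices VD ED) :
    ContractionTree VD → Finset (AlgEdge VD) → AlgVertex VD → Finset (ED ⊕ AlgEdge VD)
  | leaf v, o, x =>
    if {v} ∈ D.sketch.image ch.place ∧ x = .kron {v} then (D.sketchOf {v}).disjSum o else ∅
  | node l r, o, x =>
    let W := l.verts ∪ r.verts
    if W ∈ D.sketch.image ch.place then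
      if x = .kron W then (D.sketchOf W).disjSum o else ∅
    else if BothSketched D l.verts r.verts then
      if x = .fst W then {Sum.inr (.whole W), Sum.inr (.splitFst W), Sum.inr (.mid W)}
      else if x = .snd W then
        (∅ : Finset ED).disjSum ({AlgEdge.mid W, AlgEdge.splitSnd W} ∪ o)
      else if GoesFirst D l.verts r.verts then
        algInc D ch l {.whole W} x ∪ algInc D ch r {.splitFst W, .splitSnd W} x
      else
        algInc D ch r {.whole W} x ∪ algInc D ch l {.splitFst W, .splitSnd W} x
    else algInc D ch l o x ∪ algInc D ch r o x

/-- The sizes of the edges of the embedding built by the algorithm. -/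
def algSize (ch : AlgChoices VD ED) (m : ℕ) : AlgEdge VD → ℕ
  | .splitFst W => ch.split W
  | .splitSnd W => splitRest m (ch.split W)
  | .whole _ => m
  | .mid _ => m
  | .out => m

/-- The embedding built by the algorithm. -/
def algEmbedding (D : DataNetwork VD ED) (ch : AlgChoices VD ED) (T₀ : ContractionTree VD) (m : ℕ) :
    Embedding ED (AlgVertex VD) (AlgEdge VD) where
  verts := (algTree D ch T₀).verts.toRight
  inc := algInc D ch T₀ {.out}
  outs := {.out}
  size := algSize ch m

/-- The cost of the algorithm: that of its contraction tree for the data and its embedding. -/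
def algCost (D : DataNetwork VD ED) (ch : AlgChoices VD ED) (T₀ : ContractionTree VD) (m : ℕ) : ℕ :=
  (Embedding.total D (algEmbedding D ch T₀ m)).treeCost (algTree D ch T₀)

end Algorithm

/-! Lower bound. Fix an admissible embedding and a constrained tree `T`. Direct each edge of the
embedding from the earlier to the later tensor of the linearization, and each dimension to be
sketched from its data tensor into the embedding. Call a vertex active if it is an embedding tensor
or a data tensor with a dimension to be sketched. Admissibility gives every active vertex outgoing
edges of total size at least `μ = κ m`, with `κ = (c₁ / c₂) ^ 2`. In any set that meets the active
vertices, one of largest rank sends all its outgoing edges out of the set, so the output of the set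
carries at least `μ`. A contraction of `T` that matches a contraction `(U, V)` of `T₀` therefore
costs at least the product of the plain dimensions of `U` and `V` times `1`, `μ` or `μ ^ 2`,
according to whether none, at least one or both of `U`, `V` carry dimensions to be sketched
(`IsDirecting.cost_of_matches`). For each `e` to be sketched, `T` merges the tensor of `e` at some
moment with another active vertex. The data part of the tensor formed until then is a tensor of `T₀`
whose only dimension to be sketched is `e`. Up to a constant, `T` thus pays the placement cost
there, and the placement of the algorithm is optimal (`IsDirecting.exists_merge`,
`IsDirecting.sum_placeCost_le`).

Upper bound. The cost of the algorithm is at most twice the sum of its placement costs and of its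
step costs elsewhere (`algCost_le`). Only contractions with two sketched sides can cost much more
than the lower bound. With `X` the product of all plain dimensions of `U` and `V`, the split `p ≈
√m` costs `O(√m) · X m ^ 2`, while the lower bound is of order `X m ^ 2`. This is the first claim.

In a graph let `a ≤ b` be the products of the dimensions of only one of the two tensors and `c` that
of the common ones. Common dimensions are contracted, so the output has plain size at most `a b`,
and a balanced split costs about `a √(m b c) m ^ 2`, or `O(X m ^ 2)` when the balance falls outside
the admissible range. With `s = m ^ (1 / 8)` this is at most a constant times `s ^ 3 (X m ^ 2 + m ^
2 √m)` (`exists_splitShape_le_of_le`).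

The additive term `m ^ 2.5` is paid by a second lower bound: `T` has at least `(N - 1) / 5`
contractions of size of order `μ ^ 2.5` (`IsDirected.card_sources_le`,
`IsDirecting.sketch_card_mul_le`), while `T₀` has at most `N - 1` contractions with two sketched
sides (`card_bothSketched_le`). -/

set_option linter.unusedSectionVars false

/-! ### Laminar structure of contraction trees and of constrained trees -/

namespace ContractionTree

variable {V : Type*}

theorem nodup_left {l r : ContractionTree V} (h : (node l r).leaves.Nodup) : l.leaves.Nodup :=
  (List.nodup_append'.1 h).1

theorem nodup_right {l r : ContractionTree V} (h : (node l r).leaves.Nodup) : r.leaves.Nodup :=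
  (List.nodup_append'.1 h).2.1

variable [DecidableEq V]

@[simp] theorem verts_leaf (v : V) : (leaf v).verts = {v} := rfl

@[simp] theorem verts_node (l r : ContractionTree V) : (node l r).verts = l.verts ∪ r.verts := by
  simp [verts, leaves, List.toFinset_append]

theorem verts_nonempty (t : ContractionTree V) : t.verts.Nonempty := by
  induction t with
  | leaf v => simp
  | node l r hl _ => simpa using hl.mono Finset.subset_union_left

theorem disjoint_verts {l r : ContractionTree V} (h : (node l r).leaves.Nodup) :
    Disjoint l.verts r.verts := by
  rw [Finset.disjoint_left]
  intro a ha hb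
  exact (List.nodup_append'.1 h).2.2 (List.mem_toFinset.1 ha) (List.mem_toFinset.1 hb)

theorem verts_mem_tensors (t : ContractionTree V) : t.verts ∈ t.tensors := by
  cases t <;> simp [tensors]

theorem subset_verts_of_mem_tensors {t : ContractionTree V} {A : Finset V} (h : A ∈ t.tensors) :
    A ⊆ t.verts := by
  induction t with
  | leaf v => simp [tensors] at h; simp [h]
  | node l r hl hr =>
    simp only [tensors, List.mem_cons, List.mem_append] at h
    rw [verts_node]
    rcases h with h | h | h
    · exact h.le
    · exact (hl h).trans Finset.subset_union_left
    · exact (hr h).trans Finset.subset_union_right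

theorem nonempty_of_mem_tensors {t : ContractionTree V} {A : Finset V} (h : A ∈ t.tensors) :
    A.Nonempty := by
  induction t with
  | leaf v => simp [tensors] at h; simp [h]
  | node l r hl hr =>
    simp only [tensors, List.mem_cons, List.mem_append] at h
    rcases h with h | h | h
    · rw [h]; exact l.verts_nonempty.mono Finset.subset_union_left
    · exact hl h
    · exact hr h

theorem mem_tensors_of_mem_contractions {t : ContractionTree V} {p : Finset V × Finset V}
    (h : p ∈ t.contractions) : p.1 ∈ t.tensors ∧ p.2 ∈ t.tensors ∧ p.1 ∪ p.2 ∈ t.tensors := by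
  induction t with
  | leaf v => simp [contractions] at h
  | node l r hl hr =>
    simp only [contractions, List.mem_cons, List.mem_append] at h
    simp only [tensors, List.mem_cons, List.mem_append]
    rcases h with h | h | h
    · simp [h, verts_mem_tensors]
    · have := hl h; tauto
    · have := hr h; tauto

theorem union_subset_of_mem_contractions {t : ContractionTree V} {p : Finset V × Finset V}
    (h : p ∈ t.contractions) : p.1 ∪ p.2 ⊆ t.verts :=
  subset_verts_of_mem_tensors (mem_tensors_of_mem_contractions h).2.2

theorem disjoint_of_mem_contractions {t : ContractionTree V} (ht : t.leaves.Nodup)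
    {p : Finset V × Finset V} (h : p ∈ t.contractions) : Disjoint p.1 p.2 := by
  induction t with
  | leaf v => simp [contractions] at h
  | node l r hl hr =>
    simp only [contractions, List.mem_cons, List.mem_append] at h
    rcases h with h | h | h
    · rw [h]; exact disjoint_verts ht
    · exact hl (nodup_left ht) h
    · exact hr (nodup_right ht) h

theorem laminar {t : ContractionTree V} (ht : t.leaves.Nodup) {A B : Finset V}
    (hA : A ∈ t.tensors) (hB : B ∈ t.tensors) : Disjoint A B ∨ A ⊆ B ∨ B ⊆ A := by
  induction t with
  | leaf v => simp [tensors] at hA hB; simp [hA, hB]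
  | node l r hl hr =>
    have hd := disjoint_verts ht
    have hA' := subset_verts_of_mem_tensors hA
    have hB' := subset_verts_of_mem_tensors hB
    rw [verts_node] at hA' hB'
    simp only [tensors, List.mem_cons, List.mem_append] at hA hB
    rcases hA with rfl | hA | hA
    · exact .inr (.inr hB')
    · rcases hB with rfl | hB | hB
      · exact .inr (.inl hA')
      · exact hl (nodup_left ht) hA hB
      · exact .inl (hd.mono (subset_verts_of_mem_tensors hA) (subset_verts_of_mem_tensors hB))
    · rcases hB with rfl | hB | hB
      · exact .inr (.inl hA')
      · exact .inl
          (hd.symm.mono (subset_verts_of_mem_tensors hA) (subset_verts_of_mem_tensors hB))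
      · exact hr (nodup_right ht) hA hB

theorem not_subset_left {l r : ContractionTree V} (h : (node l r).leaves.Nodup) {A : Finset V}
    (hA : l.verts ∪ r.verts ⊆ A) : ¬ A ⊆ l.verts := by
  intro hs
  obtain ⟨x, hx⟩ := r.verts_nonempty
  exact Finset.disjoint_left.1 (disjoint_verts h) (hs (hA (Finset.mem_union_right _ hx))) hx

theorem not_subset_right {l r : ContractionTree V} (h : (node l r).leaves.Nodup) {A : Finset V}
    (hA : l.verts ∪ r.verts ⊆ A) : ¬ A ⊆ r.verts := by
  intro hs
  obtain ⟨x, hx⟩ := l.verts_nonempty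
  exact Finset.disjoint_left.1 (disjoint_verts h) hx (hs (hA (Finset.mem_union_left _ hx)))

theorem union_left_nonempty_of_mem_contractions {t : ContractionTree V}
    {p : Finset V × Finset V} (h : p ∈ t.contractions) : (p.1 ∪ p.2).Nonempty :=
  nonempty_of_mem_tensors (mem_tensors_of_mem_contractions h).2.2

/-- The output of a contraction determines the contraction. This makes the matching of `T₀` into a
constrained tree injective. -/
theorem contraction_ext {t : ContractionTree V} (ht : t.leaves.Nodup)
    {p q : Finset V × Finset V} (hp : p ∈ t.contractions) (hq : q ∈ t.contractions)
    (h : p.1 ∪ p.2 = q.1 ∪ q.2) : p = q := by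
  induction t with
  | leaf v => simp [contractions] at hp
  | node l r hl hr =>
    simp only [contractions, List.mem_cons, List.mem_append] at hp hq
    have key : ∀ {p q : Finset V × Finset V}, p ∈ l.contractions → q ∈ r.contractions →
        p.1 ∪ p.2 ≠ q.1 ∪ q.2 := by
      intro p q hp hq h
      obtain ⟨x, hx⟩ := union_left_nonempty_of_mem_contractions hp
      exact Finset.disjoint_left.1 (disjoint_verts ht) (union_subset_of_mem_contractions hp hx)
        (union_subset_of_mem_contractions hq (h ▸ hx))
    rcases hp with rfl | hp | hp
    · rcases hq with rfl | hq | hq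
      · rfl
      · exact absurd (union_subset_of_mem_contractions hq) (not_subset_left ht h.le)
      · exact absurd (union_subset_of_mem_contractions hq) (not_subset_right ht h.le)
    · rcases hq with rfl | hq | hq
      · exact absurd (union_subset_of_mem_contractions hp) (not_subset_left ht h.ge)
      · exact hl (nodup_left ht) hp hq
      · exact absurd h (key hp hq)
    · rcases hq with rfl | hq | hq
      · exact absurd (union_subset_of_mem_contractions hp) (not_subset_right ht h.ge)
      · exact absurd h.symm (key hq hp)
      · exact hr (nodup_right ht) hp hq

theorem nodup_contractions {t : ContractionTree V} (ht : t.leaves.Nodup) :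
    t.contractions.Nodup := by
  induction t with
  | leaf v => simp [contractions]
  | node l r hl hr =>
    simp only [contractions, List.nodup_cons, List.mem_append, not_or]
    refine ⟨⟨fun h => ?_, fun h => ?_⟩, List.nodup_append'.2
      ⟨hl (nodup_left ht), hr (nodup_right ht), fun p hp hq => ?_⟩⟩
    · exact not_subset_left ht le_rfl (union_subset_of_mem_contractions h)
    · exact not_subset_right ht le_rfl (union_subset_of_mem_contractions h)
    · obtain ⟨x, hx⟩ := union_left_nonempty_of_mem_contractions hp
      exact Finset.disjoint_left.1 (disjoint_verts ht) (union_subset_of_mem_contractions hp hx)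
        (union_subset_of_mem_contractions hq hx)

/-- A nonempty set of vertices of a tree is a single leaf or is split by a contraction. -/
theorem singleton_or_split {t : ContractionTree V} {W : Finset V} (hW : W ⊆ t.verts)
    (hne : W.Nonempty) :
    W ∈ t.tensors ∨ ∃ p ∈ t.contractions, W ⊆ p.1 ∪ p.2 ∧ ¬ W ⊆ p.1 ∧ ¬ W ⊆ p.2 := by
  induction t with
  | leaf v =>
    left
    rw [verts_leaf, Finset.Nonempty.subset_singleton_iff hne] at hW
    simp [tensors, hW]
  | node l r hl hr =>
    simp only [tensors, contractions, List.mem_cons, List.mem_append]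
    by_cases h1 : W ⊆ l.verts
    · rcases hl h1 with h | ⟨p, hp, h⟩
      · exact .inl (.inr (.inl h))
      · exact .inr ⟨p, .inr (.inl hp), h⟩
    by_cases h2 : W ⊆ r.verts
    · rcases hr h2 with h | ⟨p, hp, h⟩
      · exact .inl (.inr (.inr h))
      · exact .inr ⟨p, .inr (.inr hp), h⟩
    · exact .inr ⟨_, .inl rfl, by simpa using hW, h1, h2⟩

theorem sum_contractions {t : ContractionTree V} (ht : t.leaves.Nodup) {M : Type*}
    [AddCommMonoid M] (g : Finset V × Finset V → M) :
    (t.contractions.map g).sum = ∑ p ∈ t.contractions.toFinset, g p :=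
  (List.sum_toFinset g (nodup_contractions ht)).symm

section Constrained

variable {W : Type*} [DecidableEq W]

/-- In a constrained tree every tensor has no data vertices or those of a tensor of the data
tree. -/
theorem ConstrainedOn.toLeft_mem_tensors {T : ContractionTree (V ⊕ W)} {T₀ : ContractionTree V}
    (h : T.ConstrainedOn T₀) (hT : T.leaves.Nodup) {A : Finset (V ⊕ W)} (hA : A ∈ T.tensors)
    (hne : A.toLeft.Nonempty) (hsub : A.toLeft ⊆ T₀.verts) : A.toLeft ∈ T₀.tensors := by
  -- Let `p` split the data part of `A`. Then `A` meets both sides of the contraction of `T` over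
  -- `p`, and its data lie in neither side, so laminarity puts the data of both sides inside `A`.
  -- Hence the data part of `A` is exactly the output of `p`.
  rcases singleton_or_split hsub hne with h' | ⟨p, hp, h1, h2, h3⟩
  · exact h'
  have key : ∀ B C : Finset (V ⊕ W), B ∈ T.tensors → Disjoint B.toLeft C.toLeft →
      ¬ A.toLeft ⊆ B.toLeft → (A.toLeft ∩ B.toLeft).Nonempty → B.toLeft ⊆ A.toLeft := by
    intro B C hB hd hAB hi
    obtain ⟨x, hx⟩ := hi
    rw [Finset.mem_inter, Finset.mem_toLeft, Finset.mem_toLeft] at hx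
    rcases laminar hT hA hB with h | h | h
    · exact absurd hx.2 (Finset.disjoint_left.1 h hx.1)
    · exact absurd (Finset.toLeft_subset_toLeft h) hAB
    · exact Finset.toLeft_subset_toLeft h
  have hmeet : ∀ B C : Finset V, A.toLeft ⊆ B ∪ C → ¬ A.toLeft ⊆ C →
      (A.toLeft ∩ B).Nonempty := by
    intro B C hs hn
    obtain ⟨x, hx, hxC⟩ := Finset.not_subset.1 hn
    exact ⟨x, Finset.mem_inter.2 ⟨hx, (Finset.mem_union.1 (hs hx)).resolve_right hxC⟩⟩
  obtain ⟨q, hq, hqp⟩ := h p hp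
  have hm := mem_tensors_of_mem_contractions hq
  have hd := disjoint_of_mem_contractions hT hq
  have hd' : Disjoint q.1.toLeft q.2.toLeft := by
    rw [Finset.disjoint_left] at hd ⊢
    intro x hx hx'
    exact hd (Finset.mem_toLeft.1 hx) (Finset.mem_toLeft.1 hx')
  have hall : p.1 ∪ p.2 ⊆ A.toLeft := by
    have h1' : A.toLeft ⊆ p.2 ∪ p.1 := by rwa [Finset.union_comm]
    rcases hqp with ⟨e1, e2⟩ | ⟨e1, e2⟩
    · refine Finset.union_subset ?_ ?_
      · rw [← e1] at h2 ⊢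
        exact key q.1 q.2 hm.1 hd' h2 (hmeet _ _ (e1 ▸ h1) h3)
      · rw [← e2] at h3 ⊢
        exact key q.2 q.1 hm.2.1 hd'.symm h3 (hmeet _ _ (e2 ▸ h1') h2)
    · refine Finset.union_subset ?_ ?_
      · rw [← e2] at h2 ⊢
        exact key q.2 q.1 hm.2.1 hd'.symm h2 (hmeet _ _ (e2 ▸ h1) h3)
      · rw [← e1] at h3 ⊢
        exact key q.1 q.2 hm.1 hd' h3 (hmeet _ _ (e1 ▸ h1') h2)
  rw [h1.antisymm hall]
  exact (mem_tensors_of_mem_contractions hp).2.2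

end Constrained

end ContractionTree

/-! ### Directed edges: what leaves, enters and is carried by a contraction -/

namespace TensorNetwork

variable {α β : Type*} [DecidableEq α] [DecidableEq β]

/-- The edges in `F` are directed from `src` to `dst` (`none` for an edge with a dangling end)
along a ranking of the vertices, and they meet only vertices in `act`. -/
structure IsDirected (G : TensorNetwork α β) (F : Finset β) (act : Finset α) (rank : α → ℕ)
    (src : β → α) (dst : β → Option α) : Prop where
  size_pos : ∀ f, 0 < G.size f
  act_subset : act ⊆ G.verts
  src_mem : ∀ f ∈ F, src f ∈ act
  dst_mem : ∀ f ∈ F, ∀ d, dst f = some d → d ∈ act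
  rank_lt : ∀ f ∈ F, ∀ d, dst f = some d → rank (src f) < rank d
  src_inc : ∀ f ∈ F, f ∈ G.inc (src f)
  dst_inc : ∀ f ∈ F, ∀ d, dst f = some d → f ∈ G.inc d
  dangling : ∀ f ∈ F, dst f = none → f ∈ G.dangling

/-- The edges that leave `A`. -/
def outEdges (F : Finset β) (src : β → α) (dst : β → Option α) (A : Finset α) : Finset β :=
  F.filter fun f => src f ∈ A ∧ ∀ d ∈ dst f, d ∉ A

/-- The edges that enter `A`. -/
def inEdges (F : Finset β) (src : β → α) (dst : β → Option α) (A : Finset α) : Finset β :=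
  F.filter fun f => src f ∉ A ∧ ∃ d ∈ dst f, d ∈ A

/-- The edges with source `v`. -/
def rowEdges (F : Finset β) (src : β → α) (v : α) : Finset β := F.filter fun f => src f = v

/-- The product of the sizes of the edges in `B`. -/
def sizeProd (G : TensorNetwork α β) (B : Finset β) : ℕ := ∏ f ∈ B, G.size f

theorem sizeProd_mono {G : TensorNetwork α β} (hG : ∀ f, 0 < G.size f) {B C : Finset β}
    (h : B ⊆ C) : G.sizeProd B ≤ G.sizeProd C :=
  Finset.prod_le_prod_of_subset_of_one_le' h fun f _ _ => hG f

theorem sizeProd_pos {G : TensorNetwork α β} (hG : ∀ f, 0 < G.size f) (B : Finset β) :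
    0 < G.sizeProd B := Finset.prod_pos fun f _ => hG f

theorem sizeProd_union {G : TensorNetwork α β} {B C : Finset β} (h : Disjoint B C) :
    G.sizeProd (B ∪ C) = G.sizeProd B * G.sizeProd C := Finset.prod_union h

variable {G : TensorNetwork α β} {F : Finset β} {act : Finset α} {rank : α → ℕ} {src : β → α}
  {dst : β → Option α}

/-- The row edges of a vertex of largest rank leave the set. -/
theorem IsDirected.rowEdges_subset (h : G.IsDirected F act rank src dst) {A B : Finset α} {x : α}
    (hx : x ∈ A) (hB : A ⊆ B) (hB' : ∀ f ∈ F, ∀ d ∈ dst f, d ∈ B → rank d ≤ rank x) :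
    rowEdges F src x ⊆ outEdges F src dst B := by
  intro f hf
  simp only [rowEdges, outEdges, Finset.mem_filter] at hf ⊢
  refine ⟨hf.1, hf.2 ▸ hB hx, fun d hd hdB => ?_⟩
  have h1 := h.rank_lt f hf.1 d hd
  have h2 := hB' f hf.1 d hd hdB
  rw [hf.2] at h1
  omega

/-- A vertex of largest rank in `A ∩ S` sends every row edge out of `A`; maximality over `S` is
enough because all heads lie in `S`. `S` will be the set of all active vertices, or the embedding
tensors alone when their larger row bound is wanted. -/
theorem IsDirected.le_sizeProd_outEdges (h : G.IsDirected F act rank src dst) {S : Finset α}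
    (hS : ∀ f ∈ F, ∀ d ∈ dst f, d ∈ S) {μ : ℝ}
    (hμ : ∀ v ∈ S, μ ≤ G.sizeProd (rowEdges F src v)) {A : Finset α} (hA : (A ∩ S).Nonempty) :
    μ ≤ G.sizeProd (outEdges F src dst A) := by
  obtain ⟨x, hx, hmax⟩ := Finset.exists_max_image (A ∩ S) rank hA
  rw [Finset.mem_inter] at hx
  refine (hμ x hx.2).trans ?_
  have hm : ∀ f ∈ F, ∀ d ∈ dst f, d ∈ A → rank d ≤ rank x := fun f hf d hd hdA =>
    hmax d (Finset.mem_inter.2 ⟨hdA, hS f hf d hd⟩)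
  exact_mod_cast sizeProd_mono h.size_pos (h.rowEdges_subset hx.1 le_rfl hm)

theorem outEdges_subset_boundary (h : G.IsDirected F act rank src dst) (A : Finset α) :
    outEdges F src dst A ⊆ G.boundary A := by
  intro f hf
  simp only [outEdges, Finset.mem_filter] at hf
  obtain ⟨hf, hs, hd⟩ := hf
  refine Finset.mem_filter.2 ⟨Finset.mem_biUnion.2 ⟨_, hs, h.src_inc f hf⟩, ?_⟩
  cases hdst : dst f with
  | none => exact .inl (h.dangling f hf hdst)
  | some d =>
    exact .inr ⟨d, Finset.mem_sdiff.2 ⟨h.act_subset (h.dst_mem f hf d hdst), hd d hdst⟩,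
      h.dst_inc f hf d hdst⟩

theorem inEdges_subset_boundary (h : G.IsDirected F act rank src dst) (A : Finset α) :
    inEdges F src dst A ⊆ G.boundary A := by
  intro f hf
  simp only [inEdges, Finset.mem_filter] at hf
  obtain ⟨hf, hs, d, hd, hdA⟩ := hf
  exact Finset.mem_filter.2 ⟨Finset.mem_biUnion.2 ⟨d, hdA, h.dst_inc f hf d hd⟩,
    .inr ⟨_, Finset.mem_sdiff.2 ⟨h.act_subset (h.src_mem f hf), hs⟩, h.src_inc f hf⟩⟩

theorem inEdges_union_subset (A B : Finset α) :
    inEdges F src dst (A ∪ B) ⊆ inEdges F src dst A ∪ inEdges F src dst B := by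
  intro f hf
  simp only [inEdges, Finset.mem_filter, Finset.mem_union, not_or] at hf ⊢
  obtain ⟨hf, hs, d, hd, hdA⟩ := hf
  rcases hdA with hdA | hdA
  · exact .inl ⟨hf, hs.1, d, hd, hdA⟩
  · exact .inr ⟨hf, hs.2, d, hd, hdA⟩

theorem disjoint_outEdges {A B : Finset α} (hAB : Disjoint A B) :
    Disjoint (outEdges F src dst A) (outEdges F src dst B) := by
  rw [Finset.disjoint_left]
  intro f hf hf'
  simp only [outEdges, Finset.mem_filter] at hf hf'
  exact Finset.disjoint_left.1 hAB hf.2.1 hf'.2.1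

theorem disjoint_outEdges_inEdges (A B : Finset α) :
    Disjoint (outEdges F src dst A ∪ outEdges F src dst B) (inEdges F src dst (A ∪ B)) := by
  rw [Finset.disjoint_left]
  intro f hf hf'
  simp only [outEdges, inEdges, Finset.mem_filter, Finset.mem_union, not_or] at hf hf'
  rcases hf with hf | hf
  · exact hf'.2.1.1 hf.2.1
  · exact hf'.2.1.2 hf.2.1

/-- The directed edges carried by a contraction. -/
def carried (F : Finset β) (src : β → α) (dst : β → Option α) (A B : Finset α) : Finset β :=
  outEdges F src dst A ∪ outEdges F src dst B ∪ inEdges F src dst (A ∪ B)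

theorem carried_subset_boundary (h : G.IsDirected F act rank src dst) (A B : Finset α) :
    carried F src dst A B ⊆ G.boundary A ∪ G.boundary B :=
  Finset.union_subset
    (Finset.union_subset_union (outEdges_subset_boundary h A) (outEdges_subset_boundary h B))
    ((inEdges_union_subset A B).trans
      (Finset.union_subset_union (inEdges_subset_boundary h A) (inEdges_subset_boundary h B)))

theorem carried_subset (A B : Finset α) : carried F src dst A B ⊆ F := by
  intro f hf
  simp only [carried, outEdges, inEdges, Finset.mem_union, Finset.mem_filter] at hf
  tauto

/-- The three families are told apart by the position of the source: in `A`, in `B`, or outside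
both. -/
theorem sizeProd_carried {A B : Finset α} (hAB : Disjoint A B) :
    G.sizeProd (carried F src dst A B) = G.sizeProd (outEdges F src dst A) *
      G.sizeProd (outEdges F src dst B) * G.sizeProd (inEdges F src dst (A ∪ B)) := by
  rw [carried, sizeProd_union (disjoint_outEdges_inEdges A B),
    sizeProd_union (disjoint_outEdges hAB)]

/-- Inactive vertices do not matter, so the counting induction can pass over contractions with a
tensor that has no active vertex. -/
theorem IsDirected.outEdges_congr (h : G.IsDirected F act rank src dst) {A B : Finset α}
    (hAB : A ∩ act = B ∩ act) : outEdges F src dst A = outEdges F src dst B := by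
  have key : ∀ v ∈ act, (v ∈ A ↔ v ∈ B) := fun v hv => by
    have := Finset.ext_iff.1 hAB v
    simpa [hv] using this
  refine Finset.filter_congr fun f hf => ?_
  rw [key _ (h.src_mem f hf)]
  refine and_congr_right fun _ => forall₂_congr fun d hd => ?_
  rw [key d (h.dst_mem f hf d hd)]

theorem IsDirected.inEdges_congr (h : G.IsDirected F act rank src dst) {A B : Finset α}
    (hAB : A ∩ act = B ∩ act) : inEdges F src dst A = inEdges F src dst B := by
  have key : ∀ v ∈ act, (v ∈ A ↔ v ∈ B) := fun v hv => by
    have := Finset.ext_iff.1 hAB v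
    simpa [hv] using this
  refine Finset.filter_congr fun f hf => ?_
  rw [key _ (h.src_mem f hf)]
  refine and_congr_right fun _ => exists_congr fun d => and_congr_right fun hd => ?_
  rw [key d (h.dst_mem f hf d hd)]

/-- Two tensors with few incoming edges contract to one with many outgoing edges. -/
theorem IsDirected.sq_le_mul_outEdges_union (h : G.IsDirected F act rank src dst) {μ s : ℝ}
    (hμ0 : 0 ≤ μ) (hμ : ∀ v ∈ act, μ ≤ G.sizeProd (rowEdges F src v)) {A B : Finset α}
    (hAB : Disjoint A B) (hA : (A ∩ act).Nonempty) (hB : (B ∩ act).Nonempty)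
    (hsA : (G.sizeProd (inEdges F src dst A) : ℝ) ≤ s)
    (hsB : (G.sizeProd (inEdges F src dst B) : ℝ) ≤ s) :
    μ ^ 2 ≤ s * G.sizeProd (outEdges F src dst (A ∪ B)) := by
  -- Let `x` and `y` be active vertices of largest rank in `A` and `B`, with `x` not below `y`. The
  -- row edges of `x` all leave `A ∪ B`. Those of `y` leave it too, unless they enter `A`, and the
  -- edges entering `A` have total size at most `s`. So the union emits at least `μ * (μ / s)`.
  obtain ⟨x, hx, hxmax⟩ := Finset.exists_max_image (A ∩ act) rank hA
  obtain ⟨y, hy, hymax⟩ := Finset.exists_max_image (B ∩ act) rank hB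
  wlog hxy : rank y ≤ rank x generalizing A B x y
  · rw [Finset.union_comm]
    exact this hAB.symm hB hA hsB hsA y hy hymax x hx hxmax (by omega)
  rw [Finset.mem_inter] at hx hy
  have hne : x ≠ y := fun e => Finset.disjoint_left.1 hAB hx.1 (e ▸ hy.1)
  have hsub : rowEdges F src x ∪ (rowEdges F src y \ inEdges F src dst A) ⊆
      outEdges F src dst (A ∪ B) := by
    refine Finset.union_subset ?_ ?_
    · have hm : ∀ C : Finset α, C ⊆ A ∪ B → ∀ f ∈ F, ∀ d ∈ dst f, d ∈ C → rank d ≤ rank x := by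
        intro C hC f hf d hd hdC
        have hact := h.dst_mem f hf d hd
        rcases Finset.mem_union.1 (hC hdC) with hdA | hdB
        · exact hxmax d (Finset.mem_inter.2 ⟨hdA, hact⟩)
        · exact (hymax d (Finset.mem_inter.2 ⟨hdB, hact⟩)).trans hxy
      exact h.rowEdges_subset hx.1 Finset.subset_union_left (hm _ le_rfl)
    · intro f hf
      simp only [rowEdges, inEdges, outEdges, Finset.mem_sdiff, Finset.mem_filter,
        Finset.mem_union, not_or] at hf ⊢
      obtain ⟨⟨hf, hs⟩, hn⟩ := hf
      have hsA : src f ∉ A := fun hA' => Finset.disjoint_left.1 hAB hA' (hs ▸ hy.1)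
      refine ⟨hf, .inr (hs ▸ hy.1), fun d hd => ⟨fun hdA => hn ⟨hf, hsA, d, hd, hdA⟩, fun hdB => ?_⟩⟩
      have h1 := h.rank_lt f hf d hd
      have h2 := hymax d (Finset.mem_inter.2 ⟨hdB, h.dst_mem f hf d hd⟩)
      rw [hs] at h1
      omega
  have hdisj : Disjoint (rowEdges F src x) (rowEdges F src y \ inEdges F src dst A) := by
    rw [Finset.disjoint_left]
    intro f hf hf'
    simp only [rowEdges, Finset.mem_sdiff, Finset.mem_filter] at hf hf'
    exact hne (hf.2.symm.trans hf'.1.2)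
  have h1 : (G.sizeProd (rowEdges F src x) : ℝ) * G.sizeProd (rowEdges F src y \ inEdges F src dst A)
      ≤ G.sizeProd (outEdges F src dst (A ∪ B)) := by
    have := sizeProd_mono h.size_pos hsub
    rw [sizeProd_union hdisj] at this
    exact_mod_cast this
  have h2 : (G.sizeProd (rowEdges F src y) : ℝ) ≤
      G.sizeProd (inEdges F src dst A) * G.sizeProd (rowEdges F src y \ inEdges F src dst A) := by
    have : rowEdges F src y ⊆
        inEdges F src dst A ∪ (rowEdges F src y \ inEdges F src dst A) := by
      intro f hf
      by_cases hi : f ∈ inEdges F src dst A <;> simp [hf, hi]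
    have := sizeProd_mono h.size_pos this
    rw [sizeProd_union Finset.disjoint_sdiff] at this
    exact_mod_cast this
  have hx' := hμ x hx.2
  have hy' := hμ y hy.2
  have hs0 : 0 ≤ s := le_trans (by positivity) hsA
  calc μ ^ 2 = μ * μ := sq μ
    _ ≤ G.sizeProd (rowEdges F src x) *
        (s * G.sizeProd (rowEdges F src y \ inEdges F src dst A)) := by
        refine mul_le_mul hx' (hy'.trans (h2.trans ?_)) hμ0 (by positivity)
        gcongr
    _ = s * (G.sizeProd (rowEdges F src x) *
        G.sizeProd (rowEdges F src y \ inEdges F src dst A)) := by ring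
    _ ≤ _ := by gcongr

end TensorNetwork

/-! ### Counting heavy contractions against source vertices -/

namespace TensorNetwork

variable {α β : Type*} [DecidableEq α] [DecidableEq β]
variable {G : TensorNetwork α β} {F : Finset β} {act : Finset α} {rank : α → ℕ} {src : β → α}
  {dst : β → Option α}

open Classical in
/-- The number of contractions of `T` that carry directed edges of total size at least `c`. -/
noncomputable def heavyCount (G : TensorNetwork α β) (F : Finset β) (src : β → α)
    (dst : β → Option α) (T : ContractionTree α) (c : ℝ) : ℕ :=
  T.contractions.countP fun p => c ≤ (G.sizeProd (carried F src dst p.1 p.2) : ℝ)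

open Classical in
theorem heavyCount_node (l r : ContractionTree α) (c : ℝ) :
    heavyCount G F src dst (.node l r) c =
      heavyCount G F src dst l c + heavyCount G F src dst r c +
        (if c ≤ (G.sizeProd (carried F src dst l.verts r.verts) : ℝ) then 1 else 0) := by
  simp only [heavyCount, ContractionTree.contractions, List.countP_cons, List.countP_append,
    decide_eq_true_eq]

theorem heavyCount_anti (T : ContractionTree α) {c c' : ℝ} (h : c ≤ c') :
    heavyCount G F src dst T c' ≤ heavyCount G F src dst T c := by
  classical
  refine List.countP_mono_left fun p _ hp => ?_
  simp only [decide_eq_true_eq] at hp ⊢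
  exact h.trans hp

theorem one_le_sizeProd (hG : ∀ f, 0 < G.size f) (B : Finset β) : (1 : ℝ) ≤ G.sizeProd B := by
  exact_mod_cast sizeProd_pos hG B

theorem IsDirected.mul_outEdges_le_carried (h : G.IsDirected F act rank src dst) {A B : Finset α}
    (hAB : Disjoint A B) :
    (G.sizeProd (outEdges F src dst A) * G.sizeProd (outEdges F src dst B) : ℝ) ≤
      G.sizeProd (carried F src dst A B) := by
  rw [sizeProd_carried hAB]
  push_cast
  exact le_mul_of_one_le_right (by positivity) (one_le_sizeProd h.size_pos _)

open Classical in
/-- In a contraction tree, each further directed source vertex costs a heavy contraction, up to a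
constant factor. -/
theorem IsDirected.card_sources_le (h : G.IsDirected F act rank src dst) {σ : ℝ} (hσ : 0 < σ)
    (hμ : ∀ v ∈ act, σ ^ 2 ≤ G.sizeProd (rowEdges F src v)) {DA : Finset α} (hDA : DA ⊆ act)
    (hdst : ∀ f ∈ F, ∀ d ∈ dst f, d ∉ DA) {T : ContractionTree α} (hT : T.leaves.Nodup)
    (hne : (T.verts ∩ DA).Nonempty) :
    (T.verts ∩ DA).card + (if σ ≤ (G.sizeProd (inEdges F src dst T.verts) : ℝ) then 1 else 0) ≤
      4 * heavyCount G F src dst T (σ ^ 5) +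
        (if σ ^ 3 ≤ (G.sizeProd (outEdges F src dst T.verts) : ℝ) then 1 else 0) + 1 := by
  have hout : ∀ A : Finset α, (A ∩ act).Nonempty →
      σ ^ 2 ≤ (G.sizeProd (outEdges F src dst A) : ℝ) := fun A hA =>
    h.le_sizeProd_outEdges (fun f hf d hd => h.dst_mem f hf d hd) hμ hA
  have hmono : ∀ A : Finset α, (A ∩ DA).Nonempty → (A ∩ act).Nonempty := fun A hA =>
    hA.mono (Finset.inter_subset_inter_left hDA)
  -- The two indicators act as a potential: a large input is a credit, a large output a debt. A
  -- heavy contraction has to cover, besides the single `+ 1` that is kept, one more `+ 1`, two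
  -- output indicators and one new input indicator, which is the factor `4`.
  induction T with
  | leaf v =>
    have hv : v ∈ DA := by
      obtain ⟨x, hx⟩ := hne
      simp only [ContractionTree.verts_leaf, Finset.mem_inter, Finset.mem_singleton] at hx
      exact hx.1 ▸ hx.2
    have hin : inEdges F src dst (ContractionTree.leaf v).verts = ∅ := by
      refine Finset.filter_eq_empty_iff.2 fun f hf ⟨_, d, hd, hdv⟩ => ?_
      rw [ContractionTree.verts_leaf, Finset.mem_singleton] at hdv
      exact hdst f hf d hd (hdv ▸ hv)
    have hc : ((ContractionTree.leaf v).verts ∩ DA).card ≤ 1 := by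
      rw [ContractionTree.verts_leaf]
      exact (Finset.card_le_card Finset.inter_subset_left).trans (by simp)
    have ho := hout _ (hmono _ hne)
    have hin1 : G.sizeProd (inEdges F src dst (ContractionTree.leaf v).verts) = 1 := by
      rw [hin, sizeProd, Finset.prod_empty]
    rw [hin1, Nat.cast_one]
    -- The input of a data source is the empty product `1`, so its indicator is on when `σ ≤ 1`. In
    -- that case `σ ^ 3 ≤ σ ^ 2`, and the output indicator compensates.
    by_cases h1 : σ ≤ 1
    · have : σ ^ 3 ≤ σ ^ 2 := pow_le_pow_of_le_one hσ.le h1 (by norm_num)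
      rw [if_pos h1, if_pos (this.trans ho)]
      omega
    · rw [if_neg h1]
      omega
  | node l r ihl ihr =>
    have hd := ContractionTree.disjoint_verts hT
    have ihl := ihl (ContractionTree.nodup_left hT)
    have ihr := ihr (ContractionTree.nodup_right hT)
    rw [heavyCount_node]
    simp only [ContractionTree.verts_node] at hne ⊢
    have hcard : ((l.verts ∪ r.verts) ∩ DA).card = (l.verts ∩ DA).card + (r.verts ∩ DA).card := by
      rw [Finset.union_inter_distrib_right, Finset.card_union_of_disjoint]
      exact hd.mono Finset.inter_subset_left Finset.inter_subset_left
    -- Both sides emit at least `σ ^ 2`, so an output of `σ ^ 3` on either side, or an input of `σ`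
    -- into the union, would already carry `σ ^ 5`. If moreover neither side receives `σ`, the union
    -- emits at least `σ ^ 4 / σ`.
    have hcheap : (l.verts ∩ act).Nonempty → (r.verts ∩ act).Nonempty →
        ¬ σ ^ 5 ≤ (G.sizeProd (carried F src dst l.verts r.verts) : ℝ) →
        (¬ σ ^ 3 ≤ (G.sizeProd (outEdges F src dst l.verts) : ℝ)) ∧
        (¬ σ ^ 3 ≤ (G.sizeProd (outEdges F src dst r.verts) : ℝ)) ∧
        (¬ σ ≤ (G.sizeProd (inEdges F src dst (l.verts ∪ r.verts)) : ℝ)) ∧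
        ((¬ σ ≤ (G.sizeProd (inEdges F src dst l.verts) : ℝ)) →
          (¬ σ ≤ (G.sizeProd (inEdges F src dst r.verts) : ℝ)) →
          σ ^ 3 ≤ (G.sizeProd (outEdges F src dst (l.verts ∪ r.verts)) : ℝ)) := by
      intro hl hr hc
      have hol := hout _ hl
      have hor := hout _ hr
      have hmul := h.mul_outEdges_le_carried hd
      refine ⟨fun h3 => hc ?_, fun h3 => hc ?_, fun h3 => hc ?_, fun h1 h2 => ?_⟩
      · refine le_trans ?_ hmul
        calc σ ^ 5 = σ ^ 3 * σ ^ 2 := by ring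
          _ ≤ _ := by gcongr
      · refine le_trans ?_ hmul
        calc σ ^ 5 = σ ^ 2 * σ ^ 3 := by ring
          _ ≤ _ := by gcongr
      · rw [sizeProd_carried hd]
        push_cast
        calc σ ^ 5 = σ ^ 2 * σ ^ 2 * σ := by ring
          _ ≤ _ := by gcongr
      · have := h.sq_le_mul_outEdges_union (by positivity) hμ hd hl hr (not_le.1 h1).le
          (not_le.1 h2).le
        refine le_of_mul_le_mul_left ?_ hσ
        calc σ * σ ^ 3 = (σ ^ 2) ^ 2 := by ring
          _ ≤ _ := this
    have hinact : ∀ A B : Finset α, ¬ (B ∩ act).Nonempty →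
        (A ∪ B) ∩ act = A ∩ act ∧ (B ∩ DA).card = 0 := by
      intro A B hB
      rw [Finset.not_nonempty_iff_eq_empty] at hB
      refine ⟨by rw [Finset.union_inter_distrib_right, hB, Finset.union_empty], ?_⟩
      rw [Finset.card_eq_zero, ← Finset.subset_empty, ← hB]
      exact Finset.inter_subset_inter_left hDA
    rw [hcard]
    by_cases hla : (l.verts ∩ act).Nonempty
    · by_cases hra : (r.verts ∩ act).Nonempty
      · have hch := hcheap hla hra
        by_cases hlD : (l.verts ∩ DA).Nonempty
        · have ihl := ihl hlD
          by_cases hrD : (r.verts ∩ DA).Nonempty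
          · have ihr := ihr hrD
            by_cases hc : σ ^ 5 ≤ (G.sizeProd (carried F src dst l.verts r.verts) : ℝ)
            · rw [if_pos hc]
              split_ifs at ihl ihr ⊢ <;> omega
            · obtain ⟨h1, h2, h3, h4⟩ := hch hc
              rw [if_neg hc, if_neg h3]
              rw [if_neg h1] at ihl
              rw [if_neg h2] at ihr
              -- A cheap contraction of two tensors with data sources must absorb one of the two `+
              -- 1`. The input credit of a side does so, and if neither side has one, the union
              -- acquires the output debt.
              by_cases h5 : σ ≤ (G.sizeProd (inEdges F src dst l.verts) : ℝ)
              · rw [if_pos h5] at ihl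
                split_ifs at ihr ⊢ <;> omega
              · by_cases h6 : σ ≤ (G.sizeProd (inEdges F src dst r.verts) : ℝ)
                · rw [if_pos h6] at ihr
                  split_ifs at ihl ⊢ <;> omega
                · rw [if_pos (h4 h5 h6)]
                  rw [if_neg h5] at ihl
                  rw [if_neg h6] at ihr
                  omega
          · rw [Finset.not_nonempty_iff_eq_empty] at hrD
            rw [hrD, Finset.card_empty]
            by_cases hc : σ ^ 5 ≤ (G.sizeProd (carried F src dst l.verts r.verts) : ℝ)
            · rw [if_pos hc]
              split_ifs at ihl ⊢ <;> omega
            · obtain ⟨h1, h2, h3, h4⟩ := hch hc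
              rw [if_neg hc, if_neg h3]
              rw [if_neg h1] at ihl
              split_ifs at ihl ⊢ <;> omega
        · have hrD : (r.verts ∩ DA).Nonempty := by
            rw [Finset.union_inter_distrib_right, Finset.union_nonempty] at hne
            exact hne.resolve_left hlD
          have ihr := ihr hrD
          rw [Finset.not_nonempty_iff_eq_empty] at hlD
          rw [hlD, Finset.card_empty]
          by_cases hc : σ ^ 5 ≤ (G.sizeProd (carried F src dst l.verts r.verts) : ℝ)
          · rw [if_pos hc]
            split_ifs at ihr ⊢ <;> omega
          · obtain ⟨h1, h2, h3, h4⟩ := hch hc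
            rw [if_neg hc, if_neg h3]
            rw [if_neg h2] at ihr
            split_ifs at ihr ⊢ <;> omega
      · obtain ⟨he, hz⟩ := hinact l.verts r.verts hra
        rw [hz, h.inEdges_congr he, h.outEdges_congr he]
        have hlD : (l.verts ∩ DA).Nonempty := by
          rw [Finset.union_inter_distrib_right, Finset.union_nonempty] at hne
          exact hne.resolve_right fun hr => hra (hmono _ hr)
        have ihl := ihl hlD
        omega
    · obtain ⟨he, hz⟩ := hinact r.verts l.verts hla
      rw [Finset.union_comm l.verts r.verts, hz, h.inEdges_congr he, h.outEdges_congr he]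
      have hrD : (r.verts ∩ DA).Nonempty := by
        rw [Finset.union_inter_distrib_right, Finset.union_nonempty] at hne
        exact hne.resolve_left fun hl => hla (hmono _ hl)
      have ihr := ihr hrD
      omega

/-- The tree contracts a tensor that has vertices in `A` and none in `B` with one that has vertices
in `B`. -/
theorem exists_first_contraction {T : ContractionTree α} {x : α} {B : Finset α}
    (hx : x ∈ T.verts) (hxB : x ∉ B) (hB : (T.verts ∩ B).Nonempty) :
    ∃ p ∈ T.contractions, (x ∈ p.1 ∧ Disjoint p.1 B ∧ (p.2 ∩ B).Nonempty) ∨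
      (x ∈ p.2 ∧ Disjoint p.2 B ∧ (p.1 ∩ B).Nonempty) := by
  induction T with
  | leaf v =>
    obtain ⟨y, hy⟩ := hB
    simp only [ContractionTree.verts_leaf, Finset.mem_inter, Finset.mem_singleton] at hx hy
    exact absurd (hx ▸ hy.1 ▸ hy.2) hxB
  | node l r ihl ihr =>
    rw [ContractionTree.verts_node] at hx hB
    simp only [ContractionTree.contractions, List.mem_cons, List.mem_append]
    rw [Finset.union_inter_distrib_right, Finset.union_nonempty] at hB
    rcases Finset.mem_union.1 hx with hx | hx
    · by_cases hl : (l.verts ∩ B).Nonempty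
      · obtain ⟨p, hp, h⟩ := ihl hx hl
        exact ⟨p, .inr (.inl hp), h⟩
      · refine ⟨_, .inl rfl, .inl ⟨hx, ?_, hB.resolve_left hl⟩⟩
        rwa [Finset.not_nonempty_iff_eq_empty, ← Finset.disjoint_iff_inter_eq_empty] at hl
    · by_cases hr : (r.verts ∩ B).Nonempty
      · obtain ⟨p, hp, h⟩ := ihr hx hr
        exact ⟨p, .inr (.inr hp), h⟩
      · refine ⟨_, .inl rfl, .inr ⟨hx, ?_, hB.resolve_right hr⟩⟩
        rwa [Finset.not_nonempty_iff_eq_empty, ← Finset.disjoint_iff_inter_eq_empty] at hr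

end TensorNetwork

open TensorNetwork

/-! ### Directing the edges of data and embedding along a linearization -/

section Directing

variable {VD ED VE FE : Type*} [DecidableEq VD] [DecidableEq ED] [DecidableEq VE] [DecidableEq FE]

/-- The dimensions to be sketched and the edges of the embedding. -/
def embEdges (D : DataNetwork VD ED) (S : Embedding ED VE FE) : Finset (ED ⊕ FE) :=
  D.sketch.disjSum (S.verts.biUnion fun x => (S.inc x).toRight)

/-- The data tensors with a dimension to be sketched. -/
def dataSources (D : DataNetwork VD ED) (VE : Type*) : Finset (VD ⊕ VE) :=
  (D.verts.filter fun v => (D.sketch ∩ D.inc v).Nonempty).map Function.Embedding.inl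

/-- The tensors of the embedding as tensors of the total network. -/
def embVerts (S : Embedding ED VE FE) (VD : Type*) : Finset (VD ⊕ VE) :=
  S.verts.map Function.Embedding.inr

/-- Data tensors come first, followed by the tensors of the embedding in the order `ord`. -/
def totalRank (VD : Type*) (ord : VE → ℕ) : VD ⊕ VE → ℕ := Sum.elim (fun _ => 0) (fun x => ord x + 1)

/-- The edges of the embedding and the dimensions to be sketched, directed along a linearization of
the embedding. -/
structure IsDirecting (D : DataNetwork VD ED) (S : Embedding ED VE FE) (ord : VE → ℕ)
    (src : ED ⊕ FE → VD ⊕ VE) (dst : ED ⊕ FE → Option (VD ⊕ VE)) : Prop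
    extends (Embedding.total D S).IsDirected (embEdges D S)
      (dataSources D VE ∪ embVerts S VD) (totalRank VD ord) src dst where
  dst_emb : ∀ f ∈ embEdges D S, ∀ d, dst f = some d → d ∈ embVerts S VD
  src_data : ∀ e ∈ D.sketch, ∀ v ∈ D.verts, e ∈ D.inc v → src (Sum.inl e) = Sum.inl v
  src_emb : ∀ x ∈ S.verts, ∀ f ∈ (S.inc x).toRight,
    (f ∈ S.outs ∨ ∃ y ∈ S.verts, ord x < ord y ∧ Sum.inr f ∈ S.inc y) → src (Sum.inr f) = Sum.inr x

theorem DataNetwork.IsValid.existsUnique_vert {D : DataNetwork VD ED} (hD : D.IsValid) {e : ED}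
    (he : e ∈ D.sketch) :
    ∃ v ∈ D.verts, e ∈ D.inc v ∧ ∀ v' ∈ D.verts, e ∈ D.inc v' → v' = v := by
  obtain ⟨v, hv⟩ := Finset.card_eq_one.1 (hD.sketch_degree e he)
  have hm := Finset.ext_iff.1 hv
  simp only [Finset.mem_filter, Finset.mem_singleton] at hm
  exact ⟨v, ((hm v).2 rfl).1, ((hm v).2 rfl).2, fun v' h h' => (hm v').1 ⟨h, h'⟩⟩

theorem Embedding.existsUnique_vert {S : Embedding ED VE FE} {f : ED ⊕ FE} (h : S.degree f = 1) :
    ∃ x ∈ S.verts, f ∈ S.inc x ∧ ∀ x' ∈ S.verts, f ∈ S.inc x' → x' = x := by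
  obtain ⟨v, hv⟩ := Finset.card_eq_one.1 h
  have hm := Finset.ext_iff.1 hv
  simp only [Finset.mem_filter, Finset.mem_singleton] at hm
  exact ⟨v, ((hm v).2 rfl).1, ((hm v).2 rfl).2, fun v' h h' => (hm v').1 ⟨h, h'⟩⟩

/-- A dimension to be sketched runs from its unique data tensor to its unique embedding tensor, an
inner edge from the earlier to the later of its two tensors, and an output edge has no head. -/
theorem exists_isDirecting {D : DataNetwork VD ED} (hD : D.IsValid) {S : Embedding ED VE FE}
    (hS : S.IsGraphEmbedding D) {ord : VE → ℕ} (hord : Set.InjOn ord S.verts) :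
    ∃ src dst, IsDirecting D S ord src dst := by
  have key : ∀ f : ED ⊕ FE, ∃ s : VD ⊕ VE, ∃ d : Option (VD ⊕ VE), f ∈ embEdges D S →
      s ∈ dataSources D VE ∪ embVerts S VD ∧ f ∈ (Embedding.total D S).inc s ∧
      (d = none → f ∈ (Embedding.total D S).dangling) ∧
      (∀ y, d = some y → y ∈ embVerts S VD ∧ totalRank VD ord s < totalRank VD ord y ∧
        f ∈ (Embedding.total D S).inc y) ∧
      (∀ e ∈ D.sketch, f = Sum.inl e → ∀ v ∈ D.verts, e ∈ D.inc v → s = Sum.inl v) ∧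
      (∀ x ∈ S.verts, ∀ f' ∈ (S.inc x).toRight, f = Sum.inr f' →
        (f' ∈ S.outs ∨ ∃ y ∈ S.verts, ord x < ord y ∧ Sum.inr f' ∈ S.inc y) → s = Sum.inr x) := by
    -- `v₀` serves as a default source for the names that are not in `embEdges`.
    obtain ⟨e₀, he₀⟩ := hD.sketch_nonempty
    obtain ⟨v₀, -⟩ := hD.existsUnique_vert he₀
    rintro (e | f)
    · by_cases he : e ∈ D.sketch
      · obtain ⟨v, hv, hev, huv⟩ := hD.existsUnique_vert he
        obtain ⟨x, hx, hex, -⟩ := Embedding.existsUnique_vert (hS.data_degree e he)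
        refine ⟨Sum.inl v, some (Sum.inr x), fun _ => ⟨?_, ?_, by simp, ?_, ?_, by simp⟩⟩
        · simp only [dataSources, Finset.mem_union, Finset.mem_map, Finset.mem_filter]
          exact .inl ⟨v, ⟨hv, e, by simp [he, hev]⟩, rfl⟩
        · simpa [Embedding.total] using hev
        · rintro y ⟨rfl⟩
          simpa [embVerts, totalRank, Embedding.total] using ⟨hx, hex⟩
        · rintro e' - ⟨rfl⟩ v' hv' hev'
          rw [huv v' hv' hev']
      · exact ⟨Sum.inl v₀, none, fun h => absurd h (by simpa [embEdges] using he)⟩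
    · by_cases hf : ∃ x ∈ S.verts, Sum.inr f ∈ S.inc x
      · obtain ⟨x, hx, hfx⟩ := hf
        by_cases ho : f ∈ S.outs
        · obtain ⟨x, hx, hfx, hux⟩ := Embedding.existsUnique_vert (hS.out_degree f ho)
          refine ⟨Sum.inr x, none, fun _ => ⟨?_, ?_, ?_, by simp, by simp, ?_⟩⟩
          · simp [embVerts, hx]
          · simpa [Embedding.total] using hfx
          · simp [Embedding.total, ho]
          · rintro x' hx' f' hf' ⟨rfl⟩ -
            rw [hux x' hx' (by simpa using hf')]
        · obtain ⟨a, b, hab, hm⟩ := Finset.card_eq_two.1 (hS.inner_degree x hx f ho hfx)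
          replace hm := Finset.ext_iff.1 hm
          simp only [Finset.mem_filter, Finset.mem_insert, Finset.mem_singleton] at hm
          wlog hlt : ord a < ord b generalizing a b
          · refine this b a hab.symm (fun z => (hm z).trans or_comm) ?_
            have : ord a ≠ ord b := fun h => hab
              (hord ((hm a).2 (.inl rfl)).1 ((hm b).2 (.inr rfl)).1 h)
            omega
          obtain ⟨ha, hfa⟩ := (hm a).2 (.inl rfl)
          obtain ⟨hb, hfb⟩ := (hm b).2 (.inr rfl)
          refine ⟨Sum.inr a, some (Sum.inr b), fun _ => ⟨?_, ?_, by simp, ?_, by simp, ?_⟩⟩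
          · simp [embVerts, ha]
          · simpa [Embedding.total] using hfa
          · rintro y ⟨rfl⟩
            simpa [embVerts, totalRank, Embedding.total] using ⟨hb, hlt, hfb⟩
          · rintro x' hx' f' hf' ⟨rfl⟩ hor
            obtain ⟨y, hy, hxy, hfy⟩ := hor.resolve_left ho
            rcases (hm x').1 ⟨hx', by simpa using hf'⟩ with rfl | rfl
            · rfl
            · rcases (hm y).1 ⟨hy, hfy⟩ with rfl | rfl <;> omega
      · refine ⟨Sum.inl v₀, none, fun h => absurd h ?_⟩
        simpa [embEdges] using hf
  choose src dst hsd using key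
  refine ⟨src, dst, ⟨⟨?_, ?_, ?_, ?_, ?_, ?_, ?_, ?_⟩, ?_, ?_, ?_⟩⟩
  · rintro (e | f)
    · exact hD.size_pos e
    · exact hS.size_pos f
  · intro v hv
    simp only [dataSources, embVerts, Finset.mem_union, Finset.mem_map, Finset.mem_filter] at hv
    rcases hv with ⟨v, hv, rfl⟩ | ⟨v, hv, rfl⟩
    · simp [Embedding.total, hv.1]
    · simp [Embedding.total, hv]
  · exact fun f hf => (hsd f hf).1
  · exact fun f hf d hd => Finset.mem_union_right _ ((hsd f hf).2.2.2.1 d hd).1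
  · exact fun f hf d hd => ((hsd f hf).2.2.2.1 d hd).2.1
  · exact fun f hf => (hsd f hf).2.1
  · exact fun f hf d hd => ((hsd f hf).2.2.2.1 d hd).2.2
  · exact fun f hf hd => (hsd f hf).2.2.1 hd
  · exact fun f hf d hd => ((hsd f hf).2.2.2.1 d hd).1
  · exact fun e he v hv hev =>
      (hsd _ (by simp [embEdges, he])).2.2.2.2.1 e he rfl v hv hev
  · intro x hx f hf h
    refine (hsd _ ?_).2.2.2.2.2 x hx f hf rfl h
    simp only [embEdges, Finset.inr_mem_disjSum, Finset.mem_biUnion]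
    exact ⟨x, hx, hf⟩

variable {D : DataNetwork VD ED} {S : Embedding ED VE FE} {ord : VE → ℕ}
  {src : ED ⊕ FE → VD ⊕ VE} {dst : ED ⊕ FE → Option (VD ⊕ VE)}

theorem IsDirecting.rowSize_le (h : IsDirecting D S ord src dst) {x : VE} (hx : x ∈ S.verts) :
    S.rowSize ord x ≤
      (Embedding.total D S).sizeProd (rowEdges (embEdges D S) src (Sum.inr x)) := by
  have hsub : ((S.inc x).toRight.filter fun f => f ∈ S.outs ∨
      ∃ y ∈ S.verts, ord x < ord y ∧ Sum.inr f ∈ S.inc y).map Function.Embedding.inr ⊆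
      rowEdges (embEdges D S) src (Sum.inr x) := by
    intro f hf
    obtain ⟨f, hf', rfl⟩ := Finset.mem_map.1 hf
    replace hf := Finset.mem_filter.1 hf'
    refine Finset.mem_filter.2 ⟨?_, h.src_emb x hx f hf.1 hf.2⟩
    simp only [embEdges, Function.Embedding.inr_apply, Finset.inr_mem_disjSum, Finset.mem_biUnion]
    exact ⟨x, hx, hf.1⟩
  refine le_trans (le_of_eq ?_) (sizeProd_mono h.size_pos hsub)
  simp [Embedding.rowSize, sizeProd, Finset.prod_map, Embedding.total]

theorem mem_dataSources {v : VD} :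
    Sum.inl v ∈ dataSources D VE ↔ v ∈ D.verts ∧ ∃ e ∈ D.sketch, e ∈ D.inc v := by
  simp [dataSources, Finset.Nonempty]

theorem exists_of_mem_dataSources {x : VD ⊕ VE} (hx : x ∈ dataSources D VE) :
    ∃ v, x = Sum.inl v ∧ v ∈ D.verts ∧ ∃ e ∈ D.sketch, e ∈ D.inc v := by
  rcases x with v | x
  · exact ⟨v, rfl, mem_dataSources.1 hx⟩
  · simp [dataSources] at hx

theorem not_mem_dataSources_of_mem_embVerts {x : VD ⊕ VE} (hx : x ∈ embVerts S VD) :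
    x ∉ dataSources D VE := by
  rcases x with v | x
  · simp [embVerts] at hx
  · simp [dataSources]

/-- Every source has rows of total size `μ` if the dimensions to be sketched and the tensors of the
embedding have. -/
theorem IsDirecting.le_rowEdges (h : IsDirecting D S ord src dst) {μ : ℝ}
    (hdata : ∀ e ∈ D.sketch, μ ≤ D.size e) (hemb : ∀ x ∈ S.verts, μ ≤ S.rowSize ord x) :
    ∀ v ∈ dataSources D VE ∪ embVerts S VD,
      μ ≤ (Embedding.total D S).sizeProd (rowEdges (embEdges D S) src v) := by
  intro v hv
  rcases Finset.mem_union.1 hv with hv | hv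
  · obtain ⟨v, rfl, hvD, e, he, hev⟩ := exists_of_mem_dataSources hv
    refine (hdata e he).trans ?_
    have : ({Sum.inl e} : Finset (ED ⊕ FE)) ⊆ rowEdges (embEdges D S) src (Sum.inl v) := by
      rw [Finset.singleton_subset_iff]
      exact Finset.mem_filter.2 ⟨by simp [embEdges, he], h.src_data e he v hvD hev⟩
    have := sizeProd_mono h.size_pos this
    rw [sizeProd, Finset.prod_singleton] at this
    exact_mod_cast this
  · obtain ⟨x, hx, rfl⟩ := Finset.mem_map.1 hv
    exact (hemb x hx).trans (by exact_mod_cast h.rowSize_le hx)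

theorem IsDirecting.le_outEdges (h : IsDirecting D S ord src dst) {μ : ℝ}
    (hdata : ∀ e ∈ D.sketch, μ ≤ D.size e) (hemb : ∀ x ∈ S.verts, μ ≤ S.rowSize ord x)
    {A : Finset (VD ⊕ VE)} (hA : (A ∩ (dataSources D VE ∪ embVerts S VD)).Nonempty) :
    μ ≤ (Embedding.total D S).sizeProd (outEdges (embEdges D S) src dst A) :=
  h.le_sizeProd_outEdges (fun f hf d hd => h.dst_mem f hf d hd) (h.le_rowEdges hdata hemb) hA

/-- All heads are embedding tensors, so the maximal vertex can be chosen among these. The bound `r`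
then need not hold for the data dimensions. -/
theorem IsDirecting.le_outEdges_of_embVerts (h : IsDirecting D S ord src dst) {r : ℝ}
    (hemb : ∀ x ∈ S.verts, r ≤ S.rowSize ord x)
    {A : Finset (VD ⊕ VE)} (hA : (A ∩ embVerts S VD).Nonempty) :
    r ≤ (Embedding.total D S).sizeProd (outEdges (embEdges D S) src dst A) := by
  refine h.le_sizeProd_outEdges (fun f hf d hd => h.dst_emb f hf d hd) (fun v hv => ?_) hA
  obtain ⟨x, hx, rfl⟩ := Finset.mem_map.1 hv
  exact (hemb x hx).trans (by exact_mod_cast h.rowSize_le hx)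

/-- The part of the cost of a contraction due to the dimensions that are not sketched. -/
def plainCost (D : DataNetwork VD ED) (A B : Finset VD) : ℕ :=
  ∏ i ∈ D.plainBoundary A ∪ D.plainBoundary B, D.size i

theorem plainCost_comm (D : DataNetwork VD ED) (A B : Finset VD) :
    plainCost D A B = plainCost D B A := by rw [plainCost, plainCost, Finset.union_comm]

theorem map_plainBoundary_subset (A : Finset (VD ⊕ VE)) :
    (D.plainBoundary A.toLeft).map Function.Embedding.inl ⊆ (Embedding.total D S).boundary A := by
  intro f hf
  obtain ⟨e, he, rfl⟩ := Finset.mem_map.1 hf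
  simp only [DataNetwork.plainBoundary, boundary, Finset.mem_sdiff, Finset.mem_filter,
    Finset.mem_biUnion, Finset.mem_toLeft] at he ⊢
  obtain ⟨⟨⟨v, hv, hev⟩, hout⟩, hns⟩ := he
  refine ⟨⟨Sum.inl v, hv, by simpa [Embedding.total] using hev⟩, ?_⟩
  rcases hout with hd | ⟨w, hw, hew⟩
  · left; simp [Embedding.total, hd, hns]
  · right
    exact ⟨Sum.inl w, by simpa [Embedding.total] using hw, by simpa [Embedding.total] using hew⟩

/-- The plain dimensions of the data parts survive in the boundaries of the total network and are
disjoint from `embEdges`, so any carried edges `X` of the latter kind contribute an independent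
factor. -/
theorem plainCost_mul_le (hsize : ∀ f, 0 < (Embedding.total D S).size f)
    {A B : Finset (VD ⊕ VE)} {X : Finset (ED ⊕ FE)} (hX : X ⊆ embEdges D S)
    (hXAB : X ⊆ (Embedding.total D S).boundary A ∪ (Embedding.total D S).boundary B) :
    plainCost D A.toLeft B.toLeft * (Embedding.total D S).sizeProd X ≤
      (Embedding.total D S).contractionCost A B := by
  have hsub : (D.plainBoundary A.toLeft ∪ D.plainBoundary B.toLeft).map Function.Embedding.inl ⊆
      (Embedding.total D S).boundary A ∪ (Embedding.total D S).boundary B := by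
    rw [Finset.map_union]
    exact Finset.union_subset_union (map_plainBoundary_subset A) (map_plainBoundary_subset B)
  have hdisj : Disjoint
      ((D.plainBoundary A.toLeft ∪ D.plainBoundary B.toLeft).map Function.Embedding.inl) X := by
    rw [Finset.disjoint_left]
    intro f hf hfX
    obtain ⟨e, he, rfl⟩ := Finset.mem_map.1 hf
    have := hX hfX
    simp only [embEdges, Function.Embedding.inl_apply, Finset.inl_mem_disjSum] at this
    simp only [DataNetwork.plainBoundary, Finset.mem_union, Finset.mem_sdiff] at he
    tauto
  refine le_trans (le_of_eq ?_) (sizeProd_mono hsize (Finset.union_subset hsub hXAB))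
  rw [sizeProd_union hdisj]
  simp [plainCost, sizeProd, Finset.prod_map, Embedding.total]

theorem IsDirecting.plainCost_mul_carried_le (h : IsDirecting D S ord src dst)
    (A B : Finset (VD ⊕ VE)) :
    plainCost D A.toLeft B.toLeft *
      (Embedding.total D S).sizeProd (carried (embEdges D S) src dst A B) ≤
      (Embedding.total D S).contractionCost A B :=
  plainCost_mul_le h.size_pos (carried_subset A B) (carried_subset_boundary h.toIsDirected A B)

theorem plainCost_pos (hD : D.IsValid) (A B : Finset VD) : 0 < plainCost D A B :=
  Finset.prod_pos fun e _ => hD.size_pos e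

end Directing

/-! ### The number of dimensions to be sketched as a lower bound on cost -/

theorem countP_mul_le_sum {γ : Type*} (l : List γ) (P : γ → Bool) (c : γ → ℕ) {t : ℝ}
    (ht : ∀ x ∈ l, P x → t ≤ c x) : l.countP P * t ≤ ((l.map c).sum : ℕ) := by
  induction l with
  | nil => simp
  | cons x l ih =>
    have ih := ih fun y hy => ht y (List.mem_cons_of_mem _ hy)
    rw [List.countP_cons, List.map_cons, List.sum_cons, Nat.cast_add, Nat.cast_add]
    by_cases hx : P x
    · have := ht x List.mem_cons_self hx
      rw [if_pos hx, Nat.cast_one]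
      linarith
    · rw [if_neg hx, Nat.cast_zero]
      have : (0 : ℝ) ≤ c x := by positivity
      linarith

section SketchCount

variable {VD ED VE FE : Type*} [DecidableEq VD] [DecidableEq ED] [DecidableEq VE] [DecidableEq FE]
variable {D : DataNetwork VD ED} {S : Embedding ED VE FE} {ord : VE → ℕ}
  {src : ED ⊕ FE → VD ⊕ VE} {dst : ED ⊕ FE → Option (VD ⊕ VE)}

/-- Each data tensor has at most one dimension to be sketched, so sending a dimension to its tensor
is injective. -/
theorem IsDirecting.card_sketch_le (h : IsDirecting D S ord src dst) (hD : D.IsValid) :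
    D.sketch.card ≤ (dataSources D VE).card := by
  refine Finset.card_le_card_of_injOn (fun e => src (Sum.inl e)) (fun e he => ?_) ?_
  · obtain ⟨v, hv, hev, -⟩ := hD.existsUnique_vert he
    show src (Sum.inl e) ∈ dataSources D VE
    rw [h.src_data e he v hv hev]
    exact mem_dataSources.2 ⟨hv, e, he, hev⟩
  · intro e he e' he' hee
    obtain ⟨v, hv, hev, -⟩ := hD.existsUnique_vert he
    obtain ⟨v', hv', hev', -⟩ := hD.existsUnique_vert he'
    simp only at hee
    rw [h.src_data e he v hv hev, h.src_data e' he' v' hv' hev'] at hee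
    obtain rfl := Sum.inl_injective hee
    exact Finset.card_le_one.1 (hD.sketch_unique v hv) e (by simp_all) e' (by simp_all)

/-- The side with an embedding tensor keeps the full row bound `r`, which is the quantity comparable
with the sketch size; the other side only needs to be active. -/
theorem IsDirecting.mul_le_carried (h : IsDirecting D S ord src dst) {μ r : ℝ} (hμ0 : 0 ≤ μ)
    (hdata : ∀ e ∈ D.sketch, μ ≤ D.size e) (hemb : ∀ x ∈ S.verts, r ≤ S.rowSize ord x)
    (hμr : μ ≤ r) {A B : Finset (VD ⊕ VE)} (hAB : Disjoint A B)
    (hA : (A ∩ (dataSources D VE ∪ embVerts S VD)).Nonempty) (hB : (B ∩ embVerts S VD).Nonempty) :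
    μ * r ≤ (Embedding.total D S).sizeProd (carried (embEdges D S) src dst A B) := by
  refine le_trans ?_ (h.mul_outEdges_le_carried hAB)
  exact mul_le_mul (h.le_outEdges hdata (fun x hx => hμr.trans (hemb x hx)) hA)
    (h.le_outEdges_of_embVerts hemb hB) (hμ0.trans hμr) (by positivity)

/-- Each dimension to be sketched but one costs a contraction of size `μ ^ 2.5`, up to a constant
factor. -/
theorem IsDirecting.sketch_card_mul_le (h : IsDirecting D S ord src dst) (hD : D.IsValid)
    (hS : S.verts.Nonempty) {σ r K : ℝ} (hσ : 0 < σ) (hK : 1 ≤ K)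
    (hdata : ∀ e ∈ D.sketch, σ ^ 2 ≤ D.size e) (hemb : ∀ x ∈ S.verts, r ≤ S.rowSize ord x)
    (hσr : σ ^ 2 ≤ r) (hout : (S.sketchSize : ℝ) ≤ K * r) {T : ContractionTree (VD ⊕ VE)}
    (hT : T.IsTreeOn (Embedding.total D S).verts) :
    ((D.sketch.card - 1 : ℕ) : ℝ) * (σ ^ 5 / K) ≤ 5 * (Embedding.total D S).treeCost T := by
  classical
  set G := Embedding.total D S with hG
  set F := embEdges D S with hF
  have hK0 : 0 < K := by linarith
  have hinter : T.verts ∩ dataSources D VE = dataSources D VE := by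
    rw [hT.2, Finset.inter_eq_right]
    exact Finset.subset_union_left.trans h.act_subset
  have hN := h.card_sketch_le hD
  have hN1 : 0 < D.sketch.card := Finset.card_pos.2 hD.sketch_nonempty
  have hne : (dataSources D VE).Nonempty := Finset.card_pos.1 (by omega)
  -- The heads of all edges are embedding tensors, so the data sources receive nothing and qualify
  -- as the counted vertices.
  have hcount := h.toIsDirected.card_sources_le hσ
    (h.le_rowEdges hdata fun x hx => hσr.trans (hemb x hx)) Finset.subset_union_left
    (fun f hf d hd => not_mem_dataSources_of_mem_embVerts (h.dst_emb f hf d hd)) hT.1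
    (hinter.symm ▸ hne : (T.verts ∩ dataSources D VE).Nonempty)
  rw [hinter, ← hG, ← hF] at hcount
  have hmono : heavyCount G F src dst T (σ ^ 5) ≤ heavyCount G F src dst T (σ ^ 5 / K) :=
    heavyCount_anti T (div_le_self (by positivity) hK)
  -- The output debt at the root has to be removed. If it is present, the sketch size, hence `K *
  -- r`, reaches `σ ^ 3`. The contraction that first joins a data source to the embedding carries `σ
  -- ^ 2 * r ≥ σ ^ 5 / K`. So some contraction is heavy for the lowered threshold and absorbs the
  -- debt, and the factor `4` becomes `5`.
  have hone : σ ^ 3 ≤ (G.sizeProd (outEdges F src dst T.verts) : ℝ) →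
      1 ≤ heavyCount G F src dst T (σ ^ 5 / K) := by
    intro h3
    have hsub : outEdges F src dst T.verts ⊆ S.outs.map Function.Embedding.inr := by
      intro f hf
      obtain ⟨hf, -, hd⟩ := Finset.mem_filter.1 hf
      have hnone : dst f = none := by
        cases hdf : dst f with
        | none => rfl
        | some d => exact absurd (hT.2 ▸ h.act_subset (h.dst_mem f hf d hdf)) (hd d hdf)
      have hdang := h.dangling f hf hnone
      rcases f with e | f
      · simp only [hF, embEdges, Finset.inl_mem_disjSum] at hf
        simp [Embedding.total, hf] at hdang
      · simpa [Embedding.total] using hdang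
    have hle : (G.sizeProd (outEdges F src dst T.verts) : ℝ) ≤ K * r := by
      refine le_trans ?_ hout
      have := sizeProd_mono h.size_pos hsub
      have he : G.sizeProd (S.outs.map Function.Embedding.inr) = S.sketchSize := by
        simp [sizeProd, Embedding.sketchSize, Finset.prod_map, hG, Embedding.total]
      rw [← he]
      exact_mod_cast this
    obtain ⟨x, hx⟩ := hne
    have hxT : x ∈ T.verts := by
      rw [← hinter] at hx; exact (Finset.mem_inter.1 hx).1
    have hB : (T.verts ∩ embVerts S VD).Nonempty := by
      obtain ⟨y, hy⟩ := hS
      refine ⟨Sum.inr y, Finset.mem_inter.2 ⟨?_, by simpa [embVerts] using hy⟩⟩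
      rw [hT.2]
      simpa [Embedding.total, hG] using hy
    obtain ⟨p, hp, hpx⟩ := exists_first_contraction hxT
      (fun hx' => not_mem_dataSources_of_mem_embVerts hx' hx) hB
    have hd := ContractionTree.disjoint_of_mem_contractions hT.1 hp
    have hσ5 : σ ^ 5 / K ≤ σ ^ 2 * r := by
      rw [div_le_iff₀ hK0]
      calc σ ^ 5 = σ ^ 2 * σ ^ 3 := by ring
        _ ≤ σ ^ 2 * (K * r) := by gcongr; exact h3.trans hle
        _ = _ := by ring
    refine List.countP_pos_iff.2 ⟨p, hp, ?_⟩
    rw [decide_eq_true_eq]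
    refine hσ5.trans ?_
    rcases hpx with ⟨hx1, -, h2⟩ | ⟨hx2, -, h1⟩
    · exact h.mul_le_carried (by positivity) hdata hemb hσr hd
        ⟨x, Finset.mem_inter.2 ⟨hx1, Finset.mem_union_left _ hx⟩⟩ h2
    · have := h.mul_le_carried (by positivity) hdata hemb hσr hd.symm
        ⟨x, Finset.mem_inter.2 ⟨hx2, Finset.mem_union_left _ hx⟩⟩ h1
      rwa [carried, Finset.union_comm (outEdges _ _ _ _), Finset.union_comm p.2] at this
  have hfin : D.sketch.card - 1 ≤ 5 * heavyCount G F src dst T (σ ^ 5 / K) := by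
    by_cases h3 : σ ^ 3 ≤ (G.sizeProd (outEdges F src dst T.verts) : ℝ)
    · have := hone h3
      rw [if_pos h3] at hcount
      omega
    · rw [if_neg h3] at hcount
      omega
  have hsum : (heavyCount G F src dst T (σ ^ 5 / K) : ℝ) * (σ ^ 5 / K) ≤ G.treeCost T := by
    refine countP_mul_le_sum _ _ _ fun p hp hp' => ?_
    rw [decide_eq_true_eq] at hp'
    refine hp'.trans ?_
    have := h.plainCost_mul_carried_le p.1 p.2
    have hpos := plainCost_pos hD p.1.toLeft p.2.toLeft
    exact_mod_cast (Nat.le_mul_of_pos_left _ hpos).trans this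
  calc ((D.sketch.card - 1 : ℕ) : ℝ) * (σ ^ 5 / K)
      ≤ (5 * heavyCount G F src dst T (σ ^ 5 / K) : ℕ) * (σ ^ 5 / K) := by
        gcongr
    _ = 5 * ((heavyCount G F src dst T (σ ^ 5 / K) : ℝ) * (σ ^ 5 / K)) := by push_cast; ring
    _ ≤ _ := by gcongr

end SketchCount

/-! ### Lower bounds for constrained trees in terms of the data -/

/-- The contractions `q` and `p` agree on the data, as unordered pairs. -/
def Matches {V W : Type*} [DecidableEq V] [DecidableEq W]
    (q : Finset (V ⊕ W) × Finset (V ⊕ W)) (p : Finset V × Finset V) : Prop :=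
  (q.1.toLeft = p.1 ∧ q.2.toLeft = p.2) ∨ (q.1.toLeft = p.2 ∧ q.2.toLeft = p.1)

theorem Matches.union_eq {V W : Type*} [DecidableEq V] [DecidableEq W]
    {q : Finset (V ⊕ W) × Finset (V ⊕ W)} {p : Finset V × Finset V} (h : Matches q p) :
    q.1.toLeft ∪ q.2.toLeft = p.1 ∪ p.2 := by
  rcases h with ⟨h1, h2⟩ | ⟨h1, h2⟩
  · rw [h1, h2]
  · rw [h1, h2, Finset.union_comm]

/-- Summing over matched contractions of a constrained tree. -/
theorem sum_matched_le {V W : Type*} [DecidableEq V] [DecidableEq W]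
    {T : ContractionTree (V ⊕ W)} {T₀ : ContractionTree V} (hT₀ : T₀.leaves.Nodup)
    {φ : Finset V × Finset V → Finset (V ⊕ W) × Finset (V ⊕ W)}
    (hφ : ∀ p ∈ T₀.contractions, φ p ∈ T.contractions ∧ Matches (φ p) p)
    (c : Finset (V ⊕ W) × Finset (V ⊕ W) → ℕ) :
    ∑ p ∈ T₀.contractions.toFinset, c (φ p) ≤ ∑ q ∈ T.contractions.toFinset, c q := by
  rw [← Finset.sum_image (f := c) (g := φ)]
  · refine Finset.sum_le_sum_of_subset fun q hq => ?_
    obtain ⟨p, hp, rfl⟩ := Finset.mem_image.1 hq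
    exact List.mem_toFinset.2 (hφ p (List.mem_toFinset.1 hp)).1
  · intro p hp p' hp' he
    have hp := List.mem_toFinset.1 hp
    have hp' := List.mem_toFinset.1 hp'
    refine ContractionTree.contraction_ext hT₀ hp hp' ?_
    rw [← (hφ p hp).2.union_eq, he, (hφ p' hp').2.union_eq]

/-- The filters for different `e` are disjoint, so a sum over all dimensions charges each
contraction at most once. -/
theorem sum_sum_filter_eq_singleton {ι γ : Type*} [DecidableEq ι] [DecidableEq γ] (s : Finset ι)
    (C : Finset γ) (g : γ → Finset ι) (c : γ → ℕ) :
    ∑ e ∈ s, ∑ q ∈ C.filter (fun q => g q = {e}), c q =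
      ∑ q ∈ C.filter (fun q => ∃ e ∈ s, g q = {e}), c q := by
  rw [← Finset.sum_biUnion]
  · congr 1
    ext q
    simp only [Finset.mem_biUnion, Finset.mem_filter]
    tauto
  · intro e _ e' _ hne
    rw [Function.onFun, Finset.disjoint_left]
    intro q hq hq'
    rw [Finset.mem_filter] at hq hq'
    exact hne (Finset.singleton_injective (hq.2.symm.trans hq'.2))

section Lower

variable {VD ED VE FE : Type*} [DecidableEq VD] [DecidableEq ED] [DecidableEq VE] [DecidableEq FE]
variable {D : DataNetwork VD ED} {S : Embedding ED VE FE} {ord : VE → ℕ}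
  {src : ED ⊕ FE → VD ⊕ VE} {dst : ED ⊕ FE → Option (VD ⊕ VE)}

theorem Matches.plainCost_eq {q : Finset (VD ⊕ VE) × Finset (VD ⊕ VE)} {p : Finset VD × Finset VD}
    (h : Matches q p) : plainCost D q.1.toLeft q.2.toLeft = plainCost D p.1 p.2 := by
  rcases h with ⟨h1, h2⟩ | ⟨h1, h2⟩
  · rw [h1, h2]
  · rw [h1, h2, plainCost_comm]

theorem mem_sketchOf {A : Finset VD} {e : ED} :
    e ∈ D.sketchOf A ↔ (∃ v ∈ A, e ∈ D.inc v) ∧ e ∈ D.sketch := by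
  simp [DataNetwork.sketchOf]

theorem sketchOf_union (A B : Finset VD) :
    D.sketchOf (A ∪ B) = D.sketchOf A ∪ D.sketchOf B := by
  ext e
  simp only [mem_sketchOf, Finset.mem_union]
  aesop

theorem sketchOf_mono {A B : Finset VD} (h : A ⊆ B) : D.sketchOf A ⊆ D.sketchOf B := by
  intro e he
  rw [mem_sketchOf] at he ⊢
  exact ⟨he.1.imp fun v hv => ⟨h hv.1, hv.2⟩, he.2⟩

theorem disjoint_sketchOf (hD : D.IsValid) {A B : Finset VD} (hA : A ⊆ D.verts)
    (hB : B ⊆ D.verts) (hAB : Disjoint A B) : Disjoint (D.sketchOf A) (D.sketchOf B) := by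
  rw [Finset.disjoint_left]
  intro e he he'
  rw [mem_sketchOf] at he he'
  obtain ⟨⟨v, hv, hev⟩, hs⟩ := he
  obtain ⟨⟨v', hv', hev'⟩, -⟩ := he'
  obtain ⟨w, -, -, hw⟩ := hD.existsUnique_vert hs
  obtain rfl := hw v (hA hv) hev
  obtain rfl := hw v' (hB hv') hev'
  exact Finset.disjoint_left.1 hAB hv hv'

theorem active_of_sketchOf {A : Finset (VD ⊕ VE)} (hA : A.toLeft ⊆ D.verts)
    (h : (D.sketchOf A.toLeft).Nonempty) :
    (A ∩ (dataSources D VE ∪ embVerts S VD)).Nonempty := by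
  obtain ⟨e, he⟩ := h
  rw [mem_sketchOf] at he
  obtain ⟨⟨v, hv, hev⟩, hs⟩ := he
  refine ⟨Sum.inl v, Finset.mem_inter.2 ⟨Finset.mem_toLeft.1 hv, Finset.mem_union_left _ ?_⟩⟩
  exact mem_dataSources.2 ⟨hA hv, e, hs, hev⟩

theorem IsDirecting.plainCost_mul_out_le (h : IsDirecting D S ord src dst) {μ : ℝ}
    {A B : Finset (VD ⊕ VE)} {X : Finset (ED ⊕ FE)}
    (hX : X ⊆ outEdges (embEdges D S) src dst A ∪ outEdges (embEdges D S) src dst B)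
    (hμ : μ ≤ (Embedding.total D S).sizeProd X) :
    plainCost D A.toLeft B.toLeft * μ ≤ (Embedding.total D S).contractionCost A B := by
  have := plainCost_mul_le h.size_pos (A := A) (B := B)
    (hX.trans (Finset.union_subset (Finset.filter_subset _ _) (Finset.filter_subset _ _)))
    (hX.trans (Finset.union_subset_union (outEdges_subset_boundary h.toIsDirected A)
      (outEdges_subset_boundary h.toIsDirected B)))
  calc (plainCost D A.toLeft B.toLeft : ℝ) * μ
      ≤ plainCost D A.toLeft B.toLeft * (Embedding.total D S).sizeProd X := by gcongr
    _ ≤ _ := by exact_mod_cast this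

theorem toLeft_subset_of_mem_tensors {T : ContractionTree (VD ⊕ VE)}
    (hT : T.IsTreeOn (Embedding.total D S).verts) {A : Finset (VD ⊕ VE)} (hA : A ∈ T.tensors) :
    A.toLeft ⊆ D.verts := by
  intro v hv
  have := ContractionTree.subset_verts_of_mem_tensors hA (Finset.mem_toLeft.1 hv)
  rw [hT.2] at this
  simpa [Embedding.total] using this

/-- A side that carries a dimension to be sketched contains an active vertex and emits at least `μ`.
The edges leaving two disjoint sides are disjoint, so two such sides give `μ ^ 2`. -/
theorem IsDirecting.cost_of_matches (h : IsDirecting D S ord src dst) {μ : ℝ} (hμ0 : 0 ≤ μ)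
    (hdata : ∀ e ∈ D.sketch, μ ≤ D.size e) (hemb : ∀ x ∈ S.verts, μ ≤ S.rowSize ord x)
    {T : ContractionTree (VD ⊕ VE)} (hT : T.IsTreeOn (Embedding.total D S).verts)
    {p : Finset VD × Finset VD} {q : Finset (VD ⊕ VE) × Finset (VD ⊕ VE)}
    (hq : q ∈ T.contractions) (hqp : Matches q p) :
    (plainCost D p.1 p.2 ≤ (Embedding.total D S).contractionCost q.1 q.2) ∧
    ((D.sketchOf (p.1 ∪ p.2)).Nonempty →
      plainCost D p.1 p.2 * μ ≤ (Embedding.total D S).contractionCost q.1 q.2) ∧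
    (BothSketched D p.1 p.2 →
      plainCost D p.1 p.2 * (μ ^ 2) ≤ (Embedding.total D S).contractionCost q.1 q.2) := by
  have hm := ContractionTree.mem_tensors_of_mem_contractions hq
  have h1 := toLeft_subset_of_mem_tensors hT hm.1
  have h2 := toLeft_subset_of_mem_tensors hT hm.2.1
  have hout : ∀ A : Finset (VD ⊕ VE), A.toLeft ⊆ D.verts → (D.sketchOf A.toLeft).Nonempty →
      μ ≤ (Embedding.total D S).sizeProd (outEdges (embEdges D S) src dst A) := fun A hA hs =>
    h.le_outEdges hdata hemb (active_of_sketchOf hA hs)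
  refine ⟨?_, ?_, ?_⟩
  · have := plainCost_mul_le h.size_pos (A := q.1) (B := q.2) (Finset.empty_subset _)
      (Finset.empty_subset _)
    rwa [sizeProd, Finset.prod_empty, mul_one, hqp.plainCost_eq] at this
  · intro hs
    rw [← hqp.union_eq, sketchOf_union, Finset.union_nonempty] at hs
    rw [← hqp.plainCost_eq]
    rcases hs with hs | hs
    · exact h.plainCost_mul_out_le Finset.subset_union_left (hout _ h1 hs)
    · exact h.plainCost_mul_out_le Finset.subset_union_right (hout _ h2 hs)
  · intro hb
    have hb' : (D.sketchOf q.1.toLeft).Nonempty ∧ (D.sketchOf q.2.toLeft).Nonempty := by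
      rcases hqp with ⟨e1, e2⟩ | ⟨e1, e2⟩
      · rw [e1, e2]; exact hb
      · rw [e1, e2]; exact hb.symm
    rw [← hqp.plainCost_eq]
    refine h.plainCost_mul_out_le le_rfl ?_
    rw [sizeProd_union (disjoint_outEdges (ContractionTree.disjoint_of_mem_contractions hT.1 hq)),
      sq, Nat.cast_mul]
    exact mul_le_mul (hout _ h1 hb'.1) (hout _ h2 hb'.2) hμ0 (by positivity)

/-- For each dimension `e` to be sketched, the tree first merges a tensor `W` of the data tree that
carries `e` with another source. -/
theorem IsDirecting.exists_merge (h : IsDirecting D S ord src dst) (hD : D.IsValid)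
    (hS : S.verts.Nonempty) {μ : ℝ} (hμ0 : 0 ≤ μ)
    (hdata : ∀ e ∈ D.sketch, μ ≤ D.size e) (hemb : ∀ x ∈ S.verts, μ ≤ S.rowSize ord x)
    {T₀ : ContractionTree VD} (hT₀ : T₀.IsTreeOn D.verts)
    {T : ContractionTree (VD ⊕ VE)} (hT : T.IsTreeOn (Embedding.total D S).verts)
    (hc : T.ConstrainedOn T₀) {e : ED} (he : e ∈ D.sketch) :
    ∃ W ∈ T₀.tensors, D.sketchOf W = {e} ∧ (∃ q ∈ T.contractions,
      (D.sketchOf q.1.toLeft = {e} ∨ D.sketchOf q.2.toLeft = {e}) ∧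
      (∏ i ∈ D.plainBoundary W, D.size i : ℕ) * (D.size e * μ) ≤
        (Embedding.total D S).contractionCost q.1 q.2) ∧
      ∀ p ∈ T₀.contractions, p.1 ∪ p.2 ⊆ W → D.sketchOf (p.1 ∪ p.2) = {e} →
        ∀ q ∈ T.contractions, Matches q p →
          plainCost D p.1 p.2 * D.size e ≤ (Embedding.total D S).contractionCost q.1 q.2 := by
  obtain ⟨v, hv, hev, huv⟩ := hD.existsUnique_vert he
  have hsrc := h.src_data e he v hv hev
  have heF : Sum.inl e ∈ embEdges D S := by simp [embEdges, he]
  have hvsrc : Sum.inl v ∈ dataSources D VE := mem_dataSources.2 ⟨hv, e, he, hev⟩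
  have hskv : ∀ e' ∈ D.sketch, e' ∈ D.inc v → e' = e := fun e' he' hev' =>
    Finset.card_le_one.1 (hD.sketch_unique v hv) e' (by simp_all) e (by simp_all)
  have hout : ∀ A : Finset (VD ⊕ VE), Sum.inl v ∈ A →
      (∀ d ∈ dst (Sum.inl e), d ∉ A) → {Sum.inl e} ⊆ outEdges (embEdges D S) src dst A := by
    intro A hA hd
    rw [Finset.singleton_subset_iff]
    exact Finset.mem_filter.2 ⟨heF, hsrc ▸ hA, hd⟩
  have hsz : (Embedding.total D S).sizeProd ({Sum.inl e} : Finset (ED ⊕ FE)) = D.size e := by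
    simp [sizeProd, Embedding.total]
  -- `P` contains `v` and no other active vertex, and `Q` is the tensor with another active vertex
  -- that it is merged with. So `e` is the only dimension to be sketched in the data of `P` and is
  -- still open there, while `Q` emits at least `μ`. The witness for `W` is the data part of `P`.
  have main : ∀ P Q : Finset (VD ⊕ VE), P ∈ T.tensors → Q ∈ T.tensors → Disjoint P Q →
      Sum.inl v ∈ P → Disjoint P ((dataSources D VE ∪ embVerts S VD).erase (Sum.inl v)) →
      (Q ∩ (dataSources D VE ∪ embVerts S VD).erase (Sum.inl v)).Nonempty →
      P.toLeft ∈ T₀.tensors ∧ D.sketchOf P.toLeft = {e} ∧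
      ((∏ i ∈ D.plainBoundary P.toLeft, D.size i : ℕ) : ℝ) * (D.size e * μ) ≤
        plainCost D P.toLeft Q.toLeft *
          (Embedding.total D S).sizeProd (outEdges (embEdges D S) src dst P ∪
            outEdges (embEdges D S) src dst Q) ∧
      ∀ p ∈ T₀.contractions, p.1 ∪ p.2 ⊆ P.toLeft → D.sketchOf (p.1 ∪ p.2) = {e} →
        ∀ q ∈ T.contractions, Matches q p →
          plainCost D p.1 p.2 * D.size e ≤ (Embedding.total D S).contractionCost q.1 q.2 := by
    intro P Q hP hQ hPQ hvP hPB hQB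
    have hPe : ∀ d ∈ embVerts S VD, d ∉ P := by
      intro d hd hdP
      refine Finset.disjoint_left.1 hPB hdP (Finset.mem_erase.2 ⟨?_, Finset.mem_union_right _ hd⟩)
      rintro rfl
      exact not_mem_dataSources_of_mem_embVerts hd hvsrc
    have hPD := toLeft_subset_of_mem_tensors hT hP
    have hskP : D.sketchOf P.toLeft = {e} := by
      ext e'
      rw [Finset.mem_singleton, mem_sketchOf]
      constructor
      · rintro ⟨⟨w, hw, hew⟩, he'⟩
        have hwv : w = v := by
          by_contra hne
          refine Finset.disjoint_left.1 hPB (Finset.mem_toLeft.1 hw) (Finset.mem_erase.2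
            ⟨fun h => hne (Sum.inl_injective h), Finset.mem_union_left _ ?_⟩)
          exact mem_dataSources.2 ⟨hPD hw, e', he', hew⟩
        exact hskv e' he' (hwv ▸ hew)
      · rintro rfl
        exact ⟨⟨v, Finset.mem_toLeft.2 hvP, hev⟩, he⟩
    have hPT : P.toLeft ∈ T₀.tensors :=
      hc.toLeft_mem_tensors hT.1 hP ⟨v, Finset.mem_toLeft.2 hvP⟩ (by rw [hT₀.2]; exact hPD)
    refine ⟨hPT, hskP, ?_, ?_⟩
    · rw [sizeProd_union (disjoint_outEdges hPQ)]
      push_cast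
      have h1 : D.size e ≤ (Embedding.total D S).sizeProd (outEdges (embEdges D S) src dst P) := by
        rw [← hsz]
        exact sizeProd_mono h.size_pos (hout P hvP fun d hd => hPe d (h.dst_emb _ heF d hd))
      have h2 := h.le_outEdges hdata hemb
        (hQB.mono (Finset.inter_subset_inter_left (Finset.erase_subset _ _)))
      have h3 : (∏ i ∈ D.plainBoundary P.toLeft, D.size i) ≤ plainCost D P.toLeft Q.toLeft :=
        Finset.prod_le_prod_of_subset_of_one_le' Finset.subset_union_left
          fun i _ _ => hD.size_pos i
      have h1' : (D.size e : ℝ) ≤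
        (Embedding.total D S).sizeProd (outEdges (embEdges D S) src dst P) := by exact_mod_cast h1
      have h3' : ((∏ i ∈ D.plainBoundary P.toLeft, D.size i : ℕ) : ℝ) ≤
        plainCost D P.toLeft Q.toLeft := by exact_mod_cast h3
      push_cast at h3'
      exact mul_le_mul h3' (mul_le_mul h1' h2 hμ0 (by positivity)) (by positivity) (by positivity)
    · intro p hp hpP hpe q hq hqp
      have hqt := ContractionTree.mem_tensors_of_mem_contractions hq
      have hpt := ContractionTree.mem_tensors_of_mem_contractions hp
      have hpd := ContractionTree.disjoint_of_mem_contractions hT₀.1 hp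
      have hn : ¬ P.toLeft ⊆ p.1 ∧ ¬ P.toLeft ⊆ p.2 := by
        constructor
        · intro hs
          obtain ⟨x, hx⟩ := ContractionTree.nonempty_of_mem_tensors hpt.2.1
          exact Finset.disjoint_left.1 hpd (hs (hpP (Finset.mem_union_right _ hx))) hx
        · intro hs
          obtain ⟨x, hx⟩ := ContractionTree.nonempty_of_mem_tensors hpt.1
          exact Finset.disjoint_left.1 hpd hx (hs (hpP (Finset.mem_union_left _ hx)))
      -- A tensor of `T` that contains `v` but not all data of `P` lies in `P` by laminarity, hence
      -- contains no embedding tensor and still has `e` open at its full size.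
      have hsub : ∀ B ∈ T.tensors, Sum.inl v ∈ B → ¬ P.toLeft ⊆ B.toLeft →
          {Sum.inl e} ⊆ outEdges (embEdges D S) src dst B := by
        intro B hB hvB hPB
        rcases ContractionTree.laminar hT.1 hB hP with hl | hl | hl
        · exact absurd hvP (Finset.disjoint_left.1 hl hvB)
        · exact hout B hvB fun d hd hdB => hPe d (h.dst_emb _ heF d hd) (hl hdB)
        · exact absurd (Finset.toLeft_subset_toLeft hl) hPB
      have hX : {Sum.inl e} ⊆ outEdges (embEdges D S) src dst q.1 ∪
          outEdges (embEdges D S) src dst q.2 := by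
        have hn' : ¬ P.toLeft ⊆ q.1.toLeft ∧ ¬ P.toLeft ⊆ q.2.toLeft := by
          rcases hqp with ⟨e1, e2⟩ | ⟨e1, e2⟩
          · rw [e1, e2]; exact hn
          · rw [e1, e2]; exact hn.symm
        have hvq : v ∈ q.1.toLeft ∪ q.2.toLeft := by
          rw [hqp.union_eq]
          have : e ∈ D.sketchOf (p.1 ∪ p.2) := by rw [hpe]; exact Finset.mem_singleton_self e
          obtain ⟨⟨w, hw, hew⟩, -⟩ := mem_sketchOf.1 this
          exact huv w (hPD (hpP hw)) hew ▸ hw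
        rcases Finset.mem_union.1 hvq with hv1 | hv2
        · exact (hsub q.1 hqt.1 (Finset.mem_toLeft.1 hv1) hn'.1).trans Finset.subset_union_left
        · exact (hsub q.2 hqt.2.1 (Finset.mem_toLeft.1 hv2) hn'.2).trans
            Finset.subset_union_right
      have := h.plainCost_mul_out_le (μ := D.size e) hX (by rw [hsz])
      rw [hqp.plainCost_eq] at this
      exact_mod_cast this
  have hvT : Sum.inl v ∈ T.verts := by
    rw [hT.2]; simpa [Embedding.total] using hv
  have hBT : (T.verts ∩ (dataSources D VE ∪ embVerts S VD).erase (Sum.inl v)).Nonempty := by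
    obtain ⟨y, hy⟩ := hS
    refine ⟨Sum.inr y, Finset.mem_inter.2 ⟨?_, ?_⟩⟩
    · rw [hT.2]
      simpa [Embedding.total] using hy
    · simp [embVerts, hy]
  obtain ⟨p, hp, hpx⟩ := exists_first_contraction hvT (Finset.notMem_erase _ _) hBT
  have hpt := ContractionTree.mem_tensors_of_mem_contractions hp
  have hd := ContractionTree.disjoint_of_mem_contractions hT.1 hp
  rcases hpx with ⟨hx1, hx2, hx3⟩ | ⟨hx1, hx2, hx3⟩
  · obtain ⟨m1, m2, m3, m4⟩ := main p.1 p.2 hpt.1 hpt.2.1 hd hx1 hx2 hx3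
    exact ⟨_, m1, m2, ⟨p, hp, .inl m2, m3.trans (h.plainCost_mul_out_le le_rfl le_rfl)⟩, m4⟩
  · obtain ⟨m1, m2, m3, m4⟩ := main p.2 p.1 hpt.2.1 hpt.1 hd.symm hx1 hx2 hx3
    refine ⟨_, m1, m2, ⟨p, hp, .inr m2, m3.trans ?_⟩, m4⟩
    rw [plainCost_comm, Finset.union_comm]
    exact h.plainCost_mul_out_le le_rfl le_rfl

/-- The cost of a constrained tree, in terms of the data only. -/
theorem IsDirecting.sum_plainCost_le (h : IsDirecting D S ord src dst) {μ : ℝ} (hμ0 : 0 ≤ μ)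
    (hdata : ∀ e ∈ D.sketch, μ ≤ D.size e) (hemb : ∀ x ∈ S.verts, μ ≤ S.rowSize ord x)
    {T₀ : ContractionTree VD} (hT₀ : T₀.IsTreeOn D.verts)
    {T : ContractionTree (VD ⊕ VE)} (hT : T.IsTreeOn (Embedding.total D S).verts)
    (hc : T.ConstrainedOn T₀) (b : Finset VD × Finset VD → ℝ)
    (hb : ∀ p ∈ T₀.contractions, b p ≤ 1 ∨ ((D.sketchOf (p.1 ∪ p.2)).Nonempty ∧ b p ≤ μ) ∨
      (BothSketched D p.1 p.2 ∧ b p ≤ μ ^ 2)) :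
    ∑ p ∈ T₀.contractions.toFinset, plainCost D p.1 p.2 * b p ≤
      (Embedding.total D S).treeCost T := by
  choose! φ hφ using hc
  have hle : ∑ p ∈ T₀.contractions.toFinset, plainCost D p.1 p.2 * b p ≤
      ∑ p ∈ T₀.contractions.toFinset,
        ((Embedding.total D S).contractionCost (φ p).1 (φ p).2 : ℝ) := by
    refine Finset.sum_le_sum fun p hp => ?_
    have hp := List.mem_toFinset.1 hp
    obtain ⟨c1, c2, c3⟩ := h.cost_of_matches hμ0 hdata hemb hT (hφ p hp).1 (hφ p hp).2
    rcases hb p hp with hb | ⟨hs, hb⟩ | ⟨hs, hb⟩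
    · refine le_trans ?_ (Nat.cast_le.2 c1)
      exact mul_le_of_le_one_right (by positivity) hb
    · exact le_trans (by gcongr) (c2 hs)
    · exact le_trans (by gcongr) (c3 hs)
  refine hle.trans ?_
  rw [treeCost, ContractionTree.sum_contractions hT.1]
  exact_mod_cast sum_matched_le hT₀.1 hφ
    fun q => (Embedding.total D S).contractionCost q.1 q.2

theorem placeCost_eq {T₀ : ContractionTree VD} (hT₀ : T₀.leaves.Nodup) (m : ℕ) (e : ED)
    (W : Finset VD) :
    placeCost D T₀ m e W = ∑ p ∈ T₀.contractions.toFinset.filter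
        (fun p => D.sketchOf (p.1 ∪ p.2) = {e}),
        plainCost D p.1 p.2 * (if p.1 ∪ p.2 ⊆ W then D.size e else m) +
      (∏ i ∈ D.plainBoundary W, D.size i) * D.size e * m := by
  rw [placeCost, ← List.sum_toFinset _ ((ContractionTree.nodup_contractions hT₀).filter _),
    List.toFinset_filter]
  congr 2
  simp

/-- Minimality of the placement allows a comparison with the tensor found by `exists_merge`. A
contraction of `T` is charged at most three times: once as the match of a contraction of `T₀` with
one dimension to be sketched, and once for each of its two sides as a merge, since a side whose data
carry a single such dimension determines it. -/
theorem IsDirecting.sum_placeCost_le (h : IsDirecting D S ord src dst) (hD : D.IsValid)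
    (hS : S.verts.Nonempty) {κ : ℝ} {m : ℕ} (hκ0 : 0 ≤ κ) (hκ : κ ≤ 1)
    (hdata : ∀ e ∈ D.sketch, m < D.size e) (hemb : ∀ x ∈ S.verts, κ * m ≤ S.rowSize ord x)
    {T₀ : ContractionTree VD} (hT₀ : T₀.IsTreeOn D.verts)
    {T : ContractionTree (VD ⊕ VE)} (hT : T.IsTreeOn (Embedding.total D S).verts)
    (hc : T.ConstrainedOn T₀) {place : ED → Finset VD}
    (hplace : ∀ e ∈ D.sketch, ∀ W ∈ T₀.tensors, D.sketchOf W = {e} →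
      placeCost D T₀ m e (place e) ≤ placeCost D T₀ m e W) :
    κ * (∑ e ∈ D.sketch, placeCost D T₀ m e (place e) : ℕ) ≤
      3 * (Embedding.total D S).treeCost T := by
  have hμ0 : 0 ≤ κ * m := by positivity
  have hdata' : ∀ e ∈ D.sketch, κ * m ≤ D.size e := fun e he =>
    (mul_le_of_le_one_left (by positivity) hκ).trans (by exact_mod_cast (hdata e he).le)
  have hmerge := fun e he => h.exists_merge hD hS hμ0 hdata' hemb hT₀ hT hc (e := e) he
  choose! W hW hWe hq hbelow using hmerge
  choose! q hqT hqe hqcost using hq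
  have hc' := hc
  choose! φ hφ using hc'
  set cost : Finset (VD ⊕ VE) × Finset (VD ⊕ VE) → ℕ :=
    fun q => (Embedding.total D S).contractionCost q.1 q.2 with hcost
  have htree : (Embedding.total D S).treeCost T = ∑ q ∈ T.contractions.toFinset, cost q := by
    rw [treeCost, ContractionTree.sum_contractions hT.1]
  have hone : ∀ e ∈ D.sketch, κ * (placeCost D T₀ m e (place e) : ℝ) ≤
      ((∑ p ∈ T₀.contractions.toFinset.filter (fun p => D.sketchOf (p.1 ∪ p.2) = {e}),
        cost (φ p) : ℕ) : ℝ) +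
      ((∑ q ∈ T.contractions.toFinset.filter (fun q => D.sketchOf q.1.toLeft = {e}), cost q : ℕ) +
       (∑ q ∈ T.contractions.toFinset.filter (fun q => D.sketchOf q.2.toLeft = {e}),
        cost q : ℕ)) := by
    intro e he
    have h1 : κ * (placeCost D T₀ m e (place e) : ℝ) ≤ κ * placeCost D T₀ m e (W e) := by
      have := hplace e he (W e) (hW e he) (hWe e he)
      gcongr
    refine h1.trans ?_
    rw [placeCost_eq hT₀.1, Nat.cast_add, mul_add]
    refine add_le_add ?_ ?_
    · rw [Nat.cast_sum, Nat.cast_sum, Finset.mul_sum]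
      refine Finset.sum_le_sum fun p hp => ?_
      obtain ⟨hp, hpe⟩ := Finset.mem_filter.1 hp
      replace hp := List.mem_toFinset.1 hp
      have hm := hφ p hp
      split_ifs with hsub
      · have := hbelow e he p hp hsub hpe (φ p) hm.1 hm.2
        calc κ * ((plainCost D p.1 p.2 * D.size e : ℕ) : ℝ)
            ≤ ((plainCost D p.1 p.2 * D.size e : ℕ) : ℝ) :=
              mul_le_of_le_one_left (by positivity) hκ
          _ ≤ _ := by exact_mod_cast this
      · have := (h.cost_of_matches hμ0 hdata' hemb hT hm.1 hm.2).2.1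
          (by rw [hpe]; exact Finset.singleton_nonempty e)
        calc κ * ((plainCost D p.1 p.2 * m : ℕ) : ℝ) = plainCost D p.1 p.2 * (κ * m) := by
              push_cast; ring
          _ ≤ _ := this
    · have hle : κ * (((∏ i ∈ D.plainBoundary (W e), D.size i) * D.size e * m : ℕ) : ℝ) ≤
          cost (q e) := by
        refine le_trans (le_of_eq ?_) (hqcost e he)
        push_cast; ring
      refine hle.trans ?_
      have hmem := List.mem_toFinset.2 (hqT e he)
      rw [← Nat.cast_add, Nat.cast_le]
      rcases hqe e he with hs | hs
      · exact (Finset.single_le_sum (f := cost) (fun _ _ => Nat.zero_le _)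
          (Finset.mem_filter.2 ⟨hmem, hs⟩)).trans (Nat.le_add_right _ _)
      · exact (Finset.single_le_sum (f := cost) (fun _ _ => Nat.zero_le _)
          (Finset.mem_filter.2 ⟨hmem, hs⟩)).trans (Nat.le_add_left _ _)
  rw [Nat.cast_sum, Finset.mul_sum]
  refine (Finset.sum_le_sum hone).trans ?_
  rw [Finset.sum_add_distrib, Finset.sum_add_distrib]
  have hs1 : ∑ e ∈ D.sketch, ∑ p ∈ T₀.contractions.toFinset.filter
      (fun p => D.sketchOf (p.1 ∪ p.2) = {e}), cost (φ p) ≤ (Embedding.total D S).treeCost T := by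
    rw [sum_sum_filter_eq_singleton _ _ (fun p : Finset VD × Finset VD => D.sketchOf (p.1 ∪ p.2)),
      htree]
    exact (Finset.sum_le_sum_of_subset (Finset.filter_subset _ _)).trans
      (sum_matched_le hT₀.1 hφ cost)
  have hs2 : ∑ e ∈ D.sketch, ∑ q ∈ T.contractions.toFinset.filter
      (fun q => D.sketchOf q.1.toLeft = {e}), cost q ≤ (Embedding.total D S).treeCost T := by
    rw [sum_sum_filter_eq_singleton _ _
      (fun q : Finset (VD ⊕ VE) × Finset (VD ⊕ VE) => D.sketchOf q.1.toLeft), htree]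
    exact Finset.sum_le_sum_of_subset (Finset.filter_subset _ _)
  have hs3 : ∑ e ∈ D.sketch, ∑ q ∈ T.contractions.toFinset.filter
      (fun q => D.sketchOf q.2.toLeft = {e}), cost q ≤ (Embedding.total D S).treeCost T := by
    rw [sum_sum_filter_eq_singleton _ _
      (fun q : Finset (VD ⊕ VE) × Finset (VD ⊕ VE) => D.sketchOf q.2.toLeft), htree]
    exact Finset.sum_le_sum_of_subset (Finset.filter_subset _ _)
  rw [← Nat.cast_sum, ← Nat.cast_sum, ← Nat.cast_sum]
  have h1 : ((∑ e ∈ D.sketch, ∑ p ∈ T₀.contractions.toFinset.filter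
      (fun p => D.sketchOf (p.1 ∪ p.2) = {e}), cost (φ p) : ℕ) : ℝ) ≤
        (Embedding.total D S).treeCost T := by exact_mod_cast hs1
  have h2 : ((∑ e ∈ D.sketch, ∑ q ∈ T.contractions.toFinset.filter
      (fun q => D.sketchOf q.1.toLeft = {e}), cost q : ℕ) : ℝ) ≤
        (Embedding.total D S).treeCost T := by exact_mod_cast hs2
  have h3 : ((∑ e ∈ D.sketch, ∑ q ∈ T.contractions.toFinset.filter
      (fun q => D.sketchOf q.2.toLeft = {e}), cost q : ℕ) : ℝ) ≤
        (Embedding.total D S).treeCost T := by exact_mod_cast hs3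
  linarith

/-- The data tree has at most one contraction of two tensors to be sketched less than it has
dimensions to be sketched. -/
theorem card_bothSketched_le (hD : D.IsValid) {t : ContractionTree VD} (ht : t.leaves.Nodup)
    (hv : t.verts ⊆ D.verts) :
    t.contractions.countP (fun p => BothSketched D p.1 p.2) ≤ (D.sketchOf t.verts).card - 1 := by
  induction t with
  | leaf v => simp [ContractionTree.contractions]
  | node l r ihl ihr =>
    rw [ContractionTree.verts_node] at hv ⊢
    have hl := Finset.union_subset_left hv
    have hr := Finset.union_subset_right hv
    have ihl := ihl (ContractionTree.nodup_left ht) hl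
    have ihr := ihr (ContractionTree.nodup_right ht) hr
    rw [sketchOf_union, Finset.card_union_of_disjoint
      (disjoint_sketchOf hD hl hr (ContractionTree.disjoint_verts ht)),
      ContractionTree.contractions, List.countP_cons, List.countP_append]
    by_cases hb : BothSketched D l.verts r.verts
    · have h1 := Finset.card_pos.2 hb.1
      have h2 := Finset.card_pos.2 hb.2
      simp only [hb, decide_true, if_true]
      omega
    · have hb' : (D.sketchOf l.verts).card = 0 ∨ (D.sketchOf r.verts).card = 0 := by
        rwa [BothSketched, not_and_or, Finset.not_nonempty_iff_eq_empty,
          Finset.not_nonempty_iff_eq_empty, ← Finset.card_eq_zero, ← Finset.card_eq_zero] at hb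
      simp only [hb, decide_false, Bool.false_eq_true, if_false]
      omega

end Lower

/-! ### Boundaries in the total network and names in the algorithm's embedding -/

section Upper

variable {VD ED VE FE : Type*} [DecidableEq VD] [DecidableEq ED] [DecidableEq VE] [DecidableEq FE]
variable {D : DataNetwork VD ED} {S : Embedding ED VE FE}

/-- No tensor of the embedding outside `A` is adjacent to `f`. -/
def ClosedIn (S : Embedding ED VE FE) (A : Finset (VD ⊕ VE)) (f : ED ⊕ FE) : Prop :=
  ∀ y ∈ S.verts, Sum.inr y ∉ A → f ∉ S.inc y

/-- An embedding edge with a tensor in `A` disappears from the boundary once all its embedding ends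
lie in `A` and it is not an output. A dimension to be sketched disappears in the same way once its
embedding tensor is in `A`. `X` lists what is still open. -/
theorem boundary_total_subset (hD : D.IsValid) {A : Finset (VD ⊕ VE)} {X : Finset (ED ⊕ FE)}
    (hmem : ∀ x ∈ S.verts, ∀ e, Sum.inl e ∈ S.inc x → e ∈ D.sketch) (hA : A.toLeft ⊆ D.verts)
    (h1 : ∀ e ∈ D.sketchOf A.toLeft, Sum.inl e ∈ X ∨ ClosedIn S A (Sum.inl e))
    (h2 : ∀ x, Sum.inr x ∈ A → ∀ e, Sum.inl e ∈ S.inc x → e ∈ D.sketchOf A.toLeft)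
    (h3 : ∀ x, Sum.inr x ∈ A → ∀ f, Sum.inr f ∈ S.inc x →
      Sum.inr f ∈ X ∨ (f ∉ S.outs ∧ ClosedIn S A (Sum.inr f))) :
    (Embedding.total D S).boundary A ⊆
      (D.plainBoundary A.toLeft).map Function.Embedding.inl ∪ X := by
  intro f hf
  obtain ⟨hf, hout⟩ := Finset.mem_filter.1 hf
  obtain ⟨z, hz, hfz⟩ := Finset.mem_biUnion.1 hf
  rcases f with e | f
  · have key : e ∈ D.sketchOf A.toLeft →
        Sum.inl e ∈ (D.plainBoundary A.toLeft).map Function.Embedding.inl ∪ X := by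
      intro he
      rcases h1 e he with hX | hcl
      · exact Finset.mem_union_right _ hX
      · exfalso
        obtain ⟨⟨v, hv, hev⟩, hs⟩ := mem_sketchOf.1 he
        rcases hout with hd | ⟨w, hw, hew⟩
        · simp [Embedding.total, hs] at hd
        · obtain ⟨hwv, hwA⟩ := Finset.mem_sdiff.1 hw
          rcases w with w | y
          · obtain ⟨u, -, -, hu⟩ := hD.existsUnique_vert hs
            have hwD : w ∈ D.verts := by simpa [Embedding.total] using hwv
            have hew' : e ∈ D.inc w := by simpa [Embedding.total] using hew
            obtain rfl := hu w hwD hew'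
            obtain rfl := hu v (hA hv) hev
            exact hwA (Finset.mem_toLeft.1 hv)
          · exact hcl y (by simpa [Embedding.total] using hwv) hwA
              (by simpa [Embedding.total] using hew)
    rcases z with v | x
    · have hev : e ∈ D.inc v := by simpa [Embedding.total] using hfz
      by_cases hs : e ∈ D.sketch
      · exact key (mem_sketchOf.2 ⟨⟨v, Finset.mem_toLeft.2 hz, hev⟩, hs⟩)
      · refine Finset.mem_union_left _ (Finset.mem_map.2 ⟨e, ?_, rfl⟩)
        refine Finset.mem_sdiff.2 ⟨Finset.mem_filter.2
          ⟨Finset.mem_biUnion.2 ⟨v, Finset.mem_toLeft.2 hz, hev⟩, ?_⟩, hs⟩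
        rcases hout with hd | ⟨w, hw, hew⟩
        · left
          simp only [Embedding.total, Finset.inl_mem_disjSum, Finset.mem_sdiff] at hd
          exact hd.1
        · right
          obtain ⟨hwv, hwA⟩ := Finset.mem_sdiff.1 hw
          rcases w with w | y
          · exact ⟨w, Finset.mem_sdiff.2 ⟨by simpa [Embedding.total] using hwv,
              fun h => hwA (Finset.mem_toLeft.1 h)⟩, by simpa [Embedding.total] using hew⟩
          · exact absurd (hmem y (by simpa [Embedding.total] using hwv) e
              (by simpa [Embedding.total] using hew)) hs
    · exact key (h2 x hz e hfz)
  · rcases z with v | x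
    · simp [Embedding.total] at hfz
    · rcases h3 x hz f hfz with hX | ⟨ho, hcl⟩
      · exact Finset.mem_union_right _ hX
      · exfalso
        rcases hout with hd | ⟨w, hw, hew⟩
        · simp [Embedding.total, ho] at hd
        · obtain ⟨hwv, hwA⟩ := Finset.mem_sdiff.1 hw
          rcases w with w | y
          · simp [Embedding.total] at hew
          · exact hcl y (by simpa [Embedding.total] using hwv) hwA
              (by simpa [Embedding.total] using hew)


/-- An overlap of the two families only enlarges the right side, so no disjointness is required.
Positivity is asked on `Y` alone because `ch.split` is constrained only at contractions with two
sketched sides. -/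
theorem contractionCost_le {VD ED VE FE : Type*} [DecidableEq VD] [DecidableEq ED] [DecidableEq VE]
    [DecidableEq FE] {D : DataNetwork VD ED} {S : Embedding ED VE FE}
    (hD : D.IsValid) {A B : Finset (VD ⊕ VE)} {P : Finset ED} {Y : Finset (ED ⊕ FE)}
    (hY : ∀ f ∈ Y, 0 < (Embedding.total D S).size f)
    (h : (Embedding.total D S).boundary A ∪ (Embedding.total D S).boundary B ⊆
      P.map Function.Embedding.inl ∪ Y) :
    (Embedding.total D S).contractionCost A B ≤
      (∏ i ∈ P, D.size i) * (Embedding.total D S).sizeProd Y := by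
  have hP : ∀ f ∈ P.map (Function.Embedding.inl : ED ↪ ED ⊕ FE),
      0 < (Embedding.total D S).size f := by
    intro f hf
    obtain ⟨e, -, rfl⟩ := Finset.mem_map.1 hf
    exact hD.size_pos e
  have h1 : (Embedding.total D S).contractionCost A B ≤
      ∏ f ∈ P.map Function.Embedding.inl ∪ Y, (Embedding.total D S).size f :=
    Finset.prod_le_prod_of_subset_of_one_le' h fun f hf _ =>
      (Finset.mem_union.1 hf).elim (hP f) (hY f)
  refine h1.trans ?_
  have h2 : (∏ i ∈ P, D.size i) = ∏ f ∈ P.map (Function.Embedding.inl : ED ↪ ED ⊕ FE),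
      (Embedding.total D S).size f := by
    rw [Finset.prod_map]; rfl
  rw [h2, sizeProd, ← Finset.prod_union_inter]
  exact Nat.le_mul_of_pos_right _ (Finset.prod_pos fun f hf => hY f (Finset.mem_inter.1 hf).2)

theorem sizeProd_union_le {G : TensorNetwork VD ED} {B C : Finset ED}
    (hC : ∀ f ∈ C, 0 < G.size f) : G.sizeProd (B ∪ C) ≤ G.sizeProd B * G.sizeProd C := by
  rw [sizeProd, sizeProd, sizeProd, ← Finset.prod_union_inter]
  exact Nat.le_mul_of_pos_right _ (Finset.prod_pos fun f hf => hC f (Finset.mem_inter.1 hf).2)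

theorem treeCost_node (G : TensorNetwork VD ED) (l r : ContractionTree VD) :
    G.treeCost (.node l r) = G.contractionCost l.verts r.verts + (G.treeCost l + G.treeCost r) := by
  simp [treeCost, ContractionTree.contractions]

theorem ContractionTree.verts_map (f : VD → VE) (t : ContractionTree VD) :
    (t.map f).verts = t.verts.image f := by
  induction t with
  | leaf v => simp [ContractionTree.map]
  | node l r hl hr => simp [ContractionTree.map, hl, hr, Finset.image_union]

theorem ContractionTree.contractions_map (f : VD → VE) (t : ContractionTree VD) :
    (t.map f).contractions = t.contractions.map fun p => (p.1.image f, p.2.image f) := by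
  induction t with
  | leaf v => simp [ContractionTree.map, ContractionTree.contractions]
  | node l r hl hr =>
    simp [ContractionTree.map, ContractionTree.contractions, hl, hr, ContractionTree.verts_map]

/-- The data tensor an embedding tensor is named after. -/
def AlgVertex.name : AlgVertex VD → Finset VD
  | .kron W => W
  | .fst W => W
  | .snd W => W

/-- The edge is named after a nonempty tensor contained in `A`. -/
def AlgEdge.Inside (A : Finset VD) : AlgEdge VD → Prop
  | .whole W => W.Nonempty ∧ W ⊆ A
  | .splitFst W => W.Nonempty ∧ W ⊆ A
  | .splitSnd W => W.Nonempty ∧ W ⊆ A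
  | .mid W => W.Nonempty ∧ W ⊆ A
  | .out => False

theorem AlgEdge.Inside.mono {A B : Finset VD} (h : A ⊆ B) {f : AlgEdge VD} (hf : f.Inside A) :
    f.Inside B := by
  cases f
  case out => exact hf
  all_goals exact ⟨hf.1, hf.2.trans h⟩

theorem toLeft_algTree (ch : AlgChoices VD ED) (t : ContractionTree VD) :
    (algTree D ch t).verts.toLeft = t.verts := by
  induction t with
  | leaf v =>
    rw [algTree]
    ext w
    split_ifs <;> simp
  | node l r hl hr =>
    rw [algTree]
    ext w
    rw [Finset.ext_iff] at hl hr
    simp only [Finset.mem_toLeft] at hl hr ⊢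
    split_ifs <;> simp [hl, hr, ContractionTree.verts_map, or_comm]

theorem inl_mem_algTree {ch : AlgChoices VD ED} {t : ContractionTree VD} {v : VD} :
    Sum.inl v ∈ (algTree D ch t).verts ↔ v ∈ t.verts := by
  rw [← toLeft_algTree (D := D) ch t, Finset.mem_toLeft]

theorem name_mem_tensors {ch : AlgChoices VD ED} {t : ContractionTree VD} {x : AlgVertex VD}
    (hx : Sum.inr x ∈ (algTree D ch t).verts) : x.name ∈ t.tensors := by
  induction t with
  | leaf v =>
    rw [algTree] at hx
    split_ifs at hx
    · have : x = .kron {v} := by simpa using hx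
      simp [this, AlgVertex.name, ContractionTree.tensors]
    · simp at hx
  | node l r hl hr =>
    rw [algTree] at hx
    simp only [ContractionTree.tensors, List.mem_cons, List.mem_append]
    split_ifs at hx <;>
      simp only [ContractionTree.verts_node, ContractionTree.verts_leaf, Finset.mem_union,
        Finset.mem_singleton, ContractionTree.verts_map, Finset.mem_image, reduceCtorEq,
        and_false, exists_false, false_or, Sum.inr.injEq] at hx
    · simp [hx, AlgVertex.name]
    · rcases hx with ((hx | hx) | hx) | hx
      · exact .inr (.inl (hl hx))
      · simp [hx, AlgVertex.name]
      · exact .inr (.inr (hr hx))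
      · simp [hx, AlgVertex.name]
    · rcases hx with ((hx | hx) | hx) | hx
      · exact .inr (.inr (hr hx))
      · simp [hx, AlgVertex.name]
      · exact .inr (.inl (hl hx))
      · simp [hx, AlgVertex.name]
    · exact .inr (hx.imp hl hr)

/-- The part of the embedding built over a subtree uses only names of tensors inside the subtree,
apart from the outgoing edges `o`. Disjoint subtrees therefore have disjoint tensors and inner
edges, which is how edges are seen to be closed. -/
theorem mem_algInc {ch : AlgChoices VD ED} {t : ContractionTree VD} {o : Finset (AlgEdge VD)}
    {x : AlgVertex VD} {f : ED ⊕ AlgEdge VD} (hf : f ∈ algInc D ch t o x) :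
    x.name ∈ t.tensors ∧ (∀ e, f = Sum.inl e → e ∈ D.sketchOf t.verts) ∧
      ∀ g, f = Sum.inr g → g ∈ o ∨ g.Inside t.verts := by
  induction t generalizing o with
  | leaf v =>
    rw [algInc] at hf
    split_ifs at hf with h
    · rw [h.2]
      refine ⟨by simp [AlgVertex.name, ContractionTree.tensors], ?_, ?_⟩
      · rintro e rfl
        simpa using hf
      · rintro g rfl
        left
        simpa using hf
    · simp at hf
  | node l r hl hr =>
    rw [algInc] at hf
    simp only [ContractionTree.tensors, List.mem_cons, List.mem_append,
      ContractionTree.verts_node]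
    have hleft : ∀ {o'}, f ∈ algInc D ch l o' x →
        (x.name = l.verts ∪ r.verts ∨ x.name ∈ l.tensors ∨ x.name ∈ r.tensors) ∧
        (∀ e, f = Sum.inl e → e ∈ D.sketchOf (l.verts ∪ r.verts)) ∧
        ∀ g, f = Sum.inr g → g ∈ o' ∨ g.Inside (l.verts ∪ r.verts) := by
      intro o' hf
      obtain ⟨h1, h2, h3⟩ := hl hf
      exact ⟨.inr (.inl h1), fun e he => sketchOf_mono Finset.subset_union_left (h2 e he),
        fun g hg => (h3 g hg).imp id (AlgEdge.Inside.mono Finset.subset_union_left)⟩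
    have hright : ∀ {o'}, f ∈ algInc D ch r o' x →
        (x.name = l.verts ∪ r.verts ∨ x.name ∈ l.tensors ∨ x.name ∈ r.tensors) ∧
        (∀ e, f = Sum.inl e → e ∈ D.sketchOf (l.verts ∪ r.verts)) ∧
        ∀ g, f = Sum.inr g → g ∈ o' ∨ g.Inside (l.verts ∪ r.verts) := by
      intro o' hf
      obtain ⟨h1, h2, h3⟩ := hr hf
      exact ⟨.inr (.inr h1), fun e he => sketchOf_mono Finset.subset_union_right (h2 e he),
        fun g hg => (h3 g hg).imp id (AlgEdge.Inside.mono Finset.subset_union_right)⟩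
    have hins : ∀ {o' : Finset (AlgEdge VD)}, (∀ g ∈ o', g.Inside (l.verts ∪ r.verts)) →
        ∀ {p q : Prop},
        (p ∧ q ∧ ∀ g, f = Sum.inr g → g ∈ o' ∨ g.Inside (l.verts ∪ r.verts)) →
        p ∧ q ∧ ∀ g, f = Sum.inr g → g ∈ o ∨ g.Inside (l.verts ∪ r.verts) :=
      fun ho p q h => ⟨h.1, h.2.1, fun g hg => .inr ((h.2.2 g hg).elim (ho g) id)⟩
    have hne : (l.verts ∪ r.verts).Nonempty := l.verts_nonempty.mono Finset.subset_union_left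
    have hw : ∀ g ∈ ({.whole (l.verts ∪ r.verts)} : Finset (AlgEdge VD)),
        g.Inside (l.verts ∪ r.verts) := by
      simpa [AlgEdge.Inside] using hne
    have hs : ∀ g ∈ ({.splitFst (l.verts ∪ r.verts), .splitSnd (l.verts ∪ r.verts)} :
        Finset (AlgEdge VD)), g.Inside (l.verts ∪ r.verts) := by
      simpa [AlgEdge.Inside] using hne
    split_ifs at hf with h1 h2 h3 h4 h5 h6
    · subst h2
      refine ⟨.inl rfl, ?_, ?_⟩
      · rintro e rfl
        simpa using hf
      · rintro g rfl
        left
        simpa using hf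
    · simp at hf
    · subst h4
      refine ⟨.inl rfl, ?_, ?_⟩
      · rintro e rfl
        simp at hf
      · rintro g rfl
        right
        simp only [Finset.mem_insert, Finset.mem_singleton, Sum.inr.injEq] at hf
        rcases hf with rfl | rfl | rfl <;> exact ⟨hne, Finset.Subset.refl _⟩
    · subst h5
      refine ⟨.inl rfl, ?_, ?_⟩
      · rintro e rfl
        simp at hf
      · rintro g rfl
        simp only [Finset.inr_mem_disjSum, Finset.mem_union, Finset.mem_insert,
          Finset.mem_singleton] at hf
        rcases hf with (rfl | rfl) | hf
        · exact .inr ⟨hne, Finset.Subset.refl _⟩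
        · exact .inr ⟨hne, Finset.Subset.refl _⟩
        · exact .inl hf
    · rcases Finset.mem_union.1 hf with hf | hf
      · exact hins hw (hleft hf)
      · exact hins hs (hright hf)
    · rcases Finset.mem_union.1 hf with hf | hf
      · exact hins hw (hright hf)
      · exact hins hs (hleft hf)
    · rcases Finset.mem_union.1 hf with hf | hf
      · exact hleft hf
      · exact hright hf

/-- A matrix is applied only to a tensor with a dimension to be sketched, and a two-tensor network
needs such a dimension on both sides. -/
theorem not_mem_algTree_of_sketchOf_eq_empty {ch : AlgChoices VD ED}
    (hch : ∀ e ∈ D.sketch, D.sketchOf (ch.place e) = {e}) {t : ContractionTree VD}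
    (ht : D.sketchOf t.verts = ∅) (x : AlgVertex VD) : Sum.inr x ∉ (algTree D ch t).verts := by
  have hplace : ∀ W : Finset VD, D.sketchOf W = ∅ → W ∉ D.sketch.image ch.place := by
    intro W hW hmem
    obtain ⟨e, he, rfl⟩ := Finset.mem_image.1 hmem
    rw [hch e he] at hW
    exact Finset.singleton_ne_empty e hW
  induction t with
  | leaf v =>
    rw [ContractionTree.verts_leaf] at ht
    rw [algTree, if_neg (hplace _ ht)]
    simp
  | node l r hl hr =>
    rw [ContractionTree.verts_node] at ht
    have h12 := ht
    rw [sketchOf_union, Finset.union_eq_empty] at h12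
    rw [algTree]
    rw [if_neg (hplace _ ht), if_neg]
    · simp [hl h12.1, hr h12.2]
    · rintro ⟨h, -⟩
      exact h.ne_empty h12.1

end Upper

/-! ### Locality of the embedding and the two-tensor step -/

section Local

variable {VD ED : Type*} [DecidableEq VD] [DecidableEq ED]
variable {D : DataNetwork VD ED} {S : Embedding ED (AlgVertex VD) (AlgEdge VD)}
  {ch : AlgChoices VD ED} {m : ℕ}

/-- Within the tensors `A`, whose data vertices are `B`, the embedding has the adjacencies `adj`,
and only edges in `o` lead from there to the rest of the embedding. -/
structure IsLocal (D : DataNetwork VD ED) (S : Embedding ED (AlgVertex VD) (AlgEdge VD))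
    (B : Finset VD) (A : Finset (VD ⊕ AlgVertex VD)) (adj : AlgVertex VD → Finset (ED ⊕ AlgEdge VD))
    (o : Finset (AlgEdge VD)) : Prop where
  names : ∀ f ∈ o, ¬ f.Inside B
  inc_eq : ∀ x, Sum.inr x ∈ A → S.inc x = adj x
  sketch_closed : ∀ e ∈ D.sketchOf B, ClosedIn S A (Sum.inl e)
  edge_closed : ∀ f : AlgEdge VD, f.Inside B → ClosedIn S A (Sum.inr f)

/-- The embedding restricted to the part of the tree of the algorithm above `t`. -/
abbrev IsLocalTree (D : DataNetwork VD ED) (S : Embedding ED (AlgVertex VD) (AlgEdge VD))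
    (ch : AlgChoices VD ED) (t : ContractionTree VD) (o : Finset (AlgEdge VD)) : Prop :=
  IsLocal D S t.verts (algTree D ch t).verts (algInc D ch t o) o

/-- Locality passes to a smaller part as soon as the tensors newly left outside avoid its sketched
dimensions and inner edges; the tensors already outside are covered by the old closedness. -/
theorem IsLocal.restrict {B B' : Finset VD} {A A' : Finset (VD ⊕ AlgVertex VD)}
    {adj adj' : AlgVertex VD → Finset (ED ⊕ AlgEdge VD)} {o o' : Finset (AlgEdge VD)}
    (h : IsLocal D S B A adj o) (hB : B' ⊆ B) (ho : ∀ f ∈ o', ¬ f.Inside B')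
    (hadj : ∀ x, Sum.inr x ∈ A' → Sum.inr x ∈ A ∧ adj x = adj' x)
    (hcl : ∀ y, Sum.inr y ∈ A → Sum.inr y ∉ A' →
      (∀ e ∈ D.sketchOf B', Sum.inl e ∉ adj y) ∧
      ∀ f : AlgEdge VD, f.Inside B' → Sum.inr f ∉ adj y) :
    IsLocal D S B' A' adj' o' where
  names := ho
  inc_eq x hx := (h.inc_eq x (hadj x hx).1).trans (hadj x hx).2
  sketch_closed e he y hy hyA' := by
    by_cases hyA : Sum.inr y ∈ A
    · rw [h.inc_eq y hyA]
      exact (hcl y hyA hyA').1 e he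
    · exact h.sketch_closed e (sketchOf_mono hB he) y hy hyA
  edge_closed f hf y hy hyA' := by
    by_cases hyA : Sum.inr y ∈ A
    · rw [h.inc_eq y hyA]
      exact (hcl y hyA hyA').2 f hf
    · exact h.edge_closed f (hf.mono hB) y hy hyA

theorem AlgEdge.Inside.not_mem_outs (houts : S.outs = {.out}) {B : Finset VD} {f : AlgEdge VD}
    (hf : f.Inside B) : f ∉ S.outs := by
  rw [houts, Finset.mem_singleton]
  rintro rfl
  exact hf

theorem IsLocalTree.boundary_subset (hD : D.IsValid)
    (hmem : ∀ x ∈ S.verts, ∀ e, Sum.inl e ∈ S.inc x → e ∈ D.sketch) (houts : S.outs = {.out})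
    {t : ContractionTree VD} (ht : t.verts ⊆ D.verts) {o : Finset (AlgEdge VD)}
    (h : IsLocalTree D S ch t o) :
    (Embedding.total D S).boundary (algTree D ch t).verts ⊆
      (D.plainBoundary t.verts).map Function.Embedding.inl ∪ o.map Function.Embedding.inr := by
  have := boundary_total_subset (S := S) hD (A := (algTree D ch t).verts)
    (X := o.map Function.Embedding.inr) hmem (by rwa [toLeft_algTree])
    (fun e he => .inr (h.sketch_closed e (by rwa [toLeft_algTree] at he)))
    (fun x hx e he => by
      rw [h.inc_eq x hx] at he
      rw [toLeft_algTree]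
      exact (mem_algInc he).2.1 e rfl)
    (fun x hx f hf => by
      rw [h.inc_eq x hx] at hf
      rcases (mem_algInc hf).2.2 f rfl with hf | hf
      · exact .inl (Finset.mem_map_of_mem _ hf)
      · exact .inr ⟨hf.not_mem_outs houts, h.edge_closed f hf⟩)
  rwa [toLeft_algTree] at this

/-- Such a subtree has no embedding tensor to which `o` could be attached. Without this, a
contraction of two unsketched tensors would be charged a spurious factor of order `m`. -/
theorem boundary_subset_of_unsketched (hD : D.IsValid)
    (hmem : ∀ x ∈ S.verts, ∀ e, Sum.inl e ∈ S.inc x → e ∈ D.sketch)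
    (hch : ∀ e ∈ D.sketch, D.sketchOf (ch.place e) = {e})
    {t : ContractionTree VD} (ht : t.verts ⊆ D.verts) (h : D.sketchOf t.verts = ∅) :
    (Embedding.total D S).boundary (algTree D ch t).verts ⊆
      (D.plainBoundary t.verts).map Function.Embedding.inl := by
  have hx := not_mem_algTree_of_sketchOf_eq_empty hch h
  have := boundary_total_subset (S := S) hD (A := (algTree D ch t).verts) (X := ∅) hmem
    (by rwa [toLeft_algTree]) (fun e he => by simp [toLeft_algTree, h] at he)
    (fun x hx' => absurd hx' (hx x)) (fun x hx' => absurd hx' (hx x))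
  rwa [toLeft_algTree, Finset.union_empty] at this

theorem boundary_image_inl_subset (hD : D.IsValid)
    (hmem : ∀ x ∈ S.verts, ∀ e, Sum.inl e ∈ S.inc x → e ∈ D.sketch) {B : Finset VD}
    (hB : B ⊆ D.verts) :
    (Embedding.total D S).boundary (B.image Sum.inl) ⊆
      (D.plainBoundary B).map Function.Embedding.inl ∪
        (D.sketchOf B).map Function.Embedding.inl := by
  have hl : (B.image (Sum.inl : VD → VD ⊕ AlgVertex VD)).toLeft = B := by
    ext v; simp
  have := boundary_total_subset (S := S) hD (A := B.image Sum.inl)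
    (X := (D.sketchOf B).map Function.Embedding.inl) hmem (by rwa [hl])
    (fun e he => .inl (by rw [hl] at he; exact Finset.mem_map_of_mem _ he))
    (fun x hx => by simp at hx) (fun x hx => by simp at hx)
  rwa [hl] at this

theorem boundary_singleton_subset {α β : Type*} [DecidableEq α] [DecidableEq β]
    (G : TensorNetwork α β) (x : α) : G.boundary {x} ⊆ G.inc x := by
  intro f hf
  simpa using (Finset.mem_filter.1 hf).1

theorem splitRest_pos {m p : ℕ} (hm : 0 < m) (hp : 0 < p) : 0 < splitRest m p :=
  Nat.div_pos (by omega) hp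

/-- Rounding up gives `p * q ≤ m + p - 1`, at most `2 * m`. This is the origin of the factor `2` in
the cost bounds of the algorithm. -/
theorem mul_splitRest_le {m p : ℕ} (hpm : p ≤ m) : p * splitRest m p ≤ 2 * m :=
  (Nat.mul_div_le _ _).trans (by omega)

/-- This is what the nonemptiness in `AlgEdge.Inside` is for. -/
theorem AlgEdge.Inside.not_of_disjoint {A B : Finset VD} (h : Disjoint A B) {f : AlgEdge VD}
    (hA : f.Inside A) : ¬ f.Inside B := by
  intro hB
  have key : ∀ W' : Finset VD, W'.Nonempty → W' ⊆ A → ¬ W' ⊆ B := by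
    rintro W' ⟨x, hx⟩ h1 h2
    exact Finset.disjoint_left.1 h (h1 hx) (h2 hx)
  cases f
  case out => exact hA
  all_goals exact key _ hA.1 hA.2 hB.2

/-- The step of the algorithm for two tensors that both have dimensions to be sketched. -/
theorem both_step (hD : D.IsValid)
    (hmem : ∀ x ∈ S.verts, ∀ e, Sum.inl e ∈ S.inc x → e ∈ D.sketch) (houts : S.outs = {.out})
    (hsize : S.size = algSize ch m) (hm : 0 < m) {U V : ContractionTree VD} {W : Finset VD}
    (hW : W = U.verts ∪ V.verts) (hUV : Disjoint U.verts V.verts) (hWD : W ⊆ D.verts)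
    {o : Finset (AlgEdge VD)} {A : Finset (VD ⊕ AlgVertex VD)}
    {adj : AlgVertex VD → Finset (ED ⊕ AlgEdge VD)}
    (hA : ∀ x, Sum.inr x ∈ A ↔ Sum.inr x ∈ (algTree D ch U).verts ∨ x = .fst W ∨
      Sum.inr x ∈ (algTree D ch V).verts ∨ x = .snd W)
    (hadj : ∀ x, adj x =
      if x = .fst W then {Sum.inr (.whole W), Sum.inr (.splitFst W), Sum.inr (.mid W)}
      else if x = .snd W then
        (∅ : Finset ED).disjSum ({AlgEdge.mid W, AlgEdge.splitSnd W} ∪ o)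
      else algInc D ch U {.whole W} x ∪ algInc D ch V {.splitFst W, .splitSnd W} x)
    (h : IsLocal D S W A adj o) (hp : 0 < ch.split W)
    (ho : ∀ f ∈ o, 0 < S.size f) (ho2 : ∏ f ∈ o, S.size f ≤ 2 * m) :
    IsLocalTree D S ch U {.whole W} ∧ IsLocalTree D S ch V {.splitFst W, .splitSnd W} ∧
    (Embedding.total D S).contractionCost (algTree D ch U).verts {Sum.inr (.fst W)} +
    (Embedding.total D S).contractionCost ((algTree D ch U).verts ∪ {Sum.inr (.fst W)})
      (algTree D ch V).verts +
    (Embedding.total D S).contractionCost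
      ((algTree D ch U).verts ∪ {Sum.inr (.fst W)} ∪ (algTree D ch V).verts)
      {Sum.inr (.snd W)} ≤ 2 * splitCost D m U.verts V.verts (ch.split W) := by
  have hUW : U.verts ⊆ W := hW ▸ Finset.subset_union_left
  have hVW : V.verts ⊆ W := hW ▸ Finset.subset_union_right
  have hWU : ¬ W ⊆ U.verts := by
    intro hs
    obtain ⟨x, hx⟩ := V.verts_nonempty
    exact Finset.disjoint_left.1 hUV (hs (hVW hx)) hx
  have hWV : ¬ W ⊆ V.verts := by
    intro hs
    obtain ⟨x, hx⟩ := U.verts_nonempty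
    exact Finset.disjoint_left.1 hUV hx (hs (hUW hx))
  have hnU : ∀ {x : AlgVertex VD}, x.name ∈ U.tensors → x ≠ .fst W ∧ x ≠ .snd W := by
    intro x hx
    have := ContractionTree.subset_verts_of_mem_tensors hx
    constructor <;> rintro rfl <;> exact hWU this
  have hnV : ∀ {x : AlgVertex VD}, x.name ∈ V.tensors → x ≠ .fst W ∧ x ≠ .snd W := by
    intro x hx
    have := ContractionTree.subset_verts_of_mem_tensors hx
    constructor <;> rintro rfl <;> exact hWV this
  have hnUV : ∀ {x : AlgVertex VD}, x.name ∈ U.tensors → x.name ∉ V.tensors := by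
    intro x hx hx'
    obtain ⟨y, hy⟩ := ContractionTree.nonempty_of_mem_tensors hx
    exact Finset.disjoint_left.1 hUV (ContractionTree.subset_verts_of_mem_tensors hx hy)
      (ContractionTree.subset_verts_of_mem_tensors hx' hy)
  have hinU : ∀ x, x.name ∈ U.tensors → adj x = algInc D ch U {.whole W} x := by
    intro x hx
    rw [hadj, if_neg (hnU hx).1, if_neg (hnU hx).2, Finset.union_eq_left]
    intro f hf
    exact absurd (mem_algInc hf).1 (hnUV hx)
  have hinV : ∀ x, x.name ∈ V.tensors → adj x = algInc D ch V {.splitFst W, .splitSnd W} x := by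
    intro x hx
    rw [hadj, if_neg (hnV hx).1, if_neg (hnV hx).2, Finset.union_eq_right]
    intro f hf
    exact absurd hx (hnUV (mem_algInc hf).1)
  have hfst : adj (.fst W) = {Sum.inr (.whole W), Sum.inr (.splitFst W), Sum.inr (.mid W)} := by
    rw [hadj, if_pos rfl]
  have hsnd : adj (.snd W) = (∅ : Finset ED).disjSum ({AlgEdge.mid W, AlgEdge.splitSnd W} ∪ o) := by
    rw [hadj, if_neg (by simp), if_pos rfl]
  have hnotboth : ∀ f : AlgEdge VD, f.Inside U.verts → ¬ f.Inside V.verts := by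
    exact fun f hf => hf.not_of_disjoint hUV
  have hWin : ∀ f : AlgEdge VD, f = .whole W ∨ f = .splitFst W ∨ f = .splitSnd W ∨ f = .mid W →
      f.Inside W ∧ ¬ f.Inside U.verts ∧ ¬ f.Inside V.verts := by
    have hne : W.Nonempty := U.verts_nonempty.mono hUW
    rintro f (rfl | rfl | rfl | rfl) <;>
      exact ⟨⟨hne, Finset.Subset.refl _⟩, fun h => hWU h.2, fun h => hWV h.2⟩
  have hdsk := disjoint_sketchOf hD (hUW.trans hWD) (hVW.trans hWD) hUV
  have hlU : IsLocalTree D S ch U {.whole W} := by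
    refine h.restrict hUW ?_ ?_ ?_
    · intro f hf
      exact (hWin f (.inl (Finset.mem_singleton.1 hf))).2.1
    · intro x hx
      exact ⟨(hA x).2 (.inl hx), hinU x (name_mem_tensors hx)⟩
    · intro y hy hyU
      rcases (hA y).1 hy with hy | rfl | hy | rfl
      · exact absurd hy hyU
      · rw [hfst]
        refine ⟨by simp, fun f hf hmem => ?_⟩
        simp only [Finset.mem_insert, Finset.mem_singleton, Sum.inr.injEq] at hmem
        exact (hWin f (by tauto)).2.1 hf
      · rw [hinV y (name_mem_tensors hy)]
        refine ⟨fun e he he' => ?_, fun f hf hf' => ?_⟩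
        · exact Finset.disjoint_left.1 hdsk he ((mem_algInc he').2.1 e rfl)
        · rcases (mem_algInc hf').2.2 f rfl with hf' | hf'
          · simp only [Finset.mem_insert, Finset.mem_singleton] at hf'
            exact (hWin f (by tauto)).2.1 hf
          · exact hnotboth f hf hf'
      · rw [hsnd]
        refine ⟨by simp, fun f hf hmem => ?_⟩
        simp only [Finset.inr_mem_disjSum, Finset.mem_union, Finset.mem_insert,
          Finset.mem_singleton] at hmem
        rcases hmem with hmem | hmem
        · exact (hWin f (by tauto)).2.1 hf
        · exact h.names f hmem (hf.mono hUW)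
  have hlV : IsLocalTree D S ch V {.splitFst W, .splitSnd W} := by
    refine h.restrict hVW ?_ ?_ ?_
    · intro f hf
      simp only [Finset.mem_insert, Finset.mem_singleton] at hf
      exact (hWin f (by tauto)).2.2
    · intro x hx
      exact ⟨(hA x).2 (.inr (.inr (.inl hx))), hinV x (name_mem_tensors hx)⟩
    · intro y hy hyV
      rcases (hA y).1 hy with hy | rfl | hy | rfl
      · rw [hinU y (name_mem_tensors hy)]
        refine ⟨fun e he he' => ?_, fun f hf hf' => ?_⟩
        · exact Finset.disjoint_left.1 hdsk ((mem_algInc he').2.1 e rfl) he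
        · rcases (mem_algInc hf').2.2 f rfl with hf' | hf'
          · exact (hWin f (.inl (Finset.mem_singleton.1 hf'))).2.2 hf
          · exact hnotboth f hf' hf
      · rw [hfst]
        refine ⟨by simp, fun f hf hmem => ?_⟩
        simp only [Finset.mem_insert, Finset.mem_singleton, Sum.inr.injEq] at hmem
        exact (hWin f (by tauto)).2.2 hf
      · exact absurd hy hyV
      · rw [hsnd]
        refine ⟨by simp, fun f hf hmem => ?_⟩
        simp only [Finset.inr_mem_disjSum, Finset.mem_union, Finset.mem_insert,
          Finset.mem_singleton] at hmem
        rcases hmem with hmem | hmem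
        · exact (hWin f (by tauto)).2.2 hf
        · exact h.names f hmem (hf.mono hVW)
  refine ⟨hlU, hlV, ?_⟩
  set G := Embedding.total D S with hG
  set p := ch.split W with hpdef
  have hq := splitRest_pos hm hp
  have hGs : ∀ f, G.size (Sum.inr f) = algSize ch m f := fun f => by
    rw [← hsize]; rfl
  have hUb := IsLocalTree.boundary_subset hD hmem houts (hUW.trans hWD) hlU
  have hVb := IsLocalTree.boundary_subset hD hmem houts (hVW.trans hWD) hlV
  have hfstA : Sum.inr (AlgVertex.fst W) ∈ A := (hA _).2 (.inr (.inl rfl))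
  have hsndA : Sum.inr (AlgVertex.snd W) ∈ A := (hA _).2 (.inr (.inr (.inr rfl)))
  have hfstb : G.boundary {Sum.inr (.fst W)} ⊆
      {Sum.inr (.whole W), Sum.inr (.splitFst W), Sum.inr (.mid W)} := by
    refine (boundary_singleton_subset _ _).trans ?_
    rw [← hfst, ← h.inc_eq _ hfstA]
    exact Finset.Subset.refl _
  have hsndb : G.boundary {Sum.inr (.snd W)} ⊆
      {Sum.inr (.mid W), Sum.inr (.splitSnd W)} ∪ o.map Function.Embedding.inr := by
    refine (boundary_singleton_subset _ _).trans ?_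
    have : G.inc (Sum.inr (.snd W)) = adj (.snd W) := h.inc_eq _ hsndA
    rw [this, hsnd]
    intro f hf
    rcases f with e | f
    · simp at hf
    · simpa [or_assoc] using hf
  have hUvert : ∀ x, Sum.inr x ∈ (algTree D ch U).verts → ∀ e, Sum.inl e ∈ S.inc x →
      e ∈ D.sketchOf U.verts := fun x hx e he => by
    rw [hlU.inc_eq x hx] at he
    exact (mem_algInc he).2.1 e rfl
  have hVvert : ∀ x, Sum.inr x ∈ (algTree D ch V).verts → ∀ e, Sum.inl e ∈ S.inc x →
      e ∈ D.sketchOf V.verts := fun x hx e he => by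
    rw [hlV.inc_eq x hx] at he
    exact (mem_algInc he).2.1 e rfl
  -- `whole W` can occur only at `fst W` or in the part over `U`, and `splitFst W` below only at
  -- `fst W` or in the part over `V`. An edge is contracted as soon as the tensors allowed to carry
  -- it have been gathered.
  have hwhole : ∀ B : Finset (VD ⊕ AlgVertex VD),
      (∀ x, Sum.inr x ∈ (algTree D ch U).verts → Sum.inr x ∈ B) → Sum.inr (.fst W) ∈ B →
      ClosedIn S B (Sum.inr (.whole W)) := by
    intro B hB hfB y hy hyB
    by_cases hyA : Sum.inr y ∈ A
    · rw [h.inc_eq y hyA]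
      rcases (hA y).1 hyA with hyA | rfl | hyA | rfl
      · exact absurd (hB y hyA) hyB
      · exact absurd hfB hyB
      · rw [hinV y (name_mem_tensors hyA)]
        intro hf
        rcases (mem_algInc hf).2.2 _ rfl with hf | hf
        · simp at hf
        · exact hWV hf.2
      · rw [hsnd]
        simp only [Finset.inr_mem_disjSum, Finset.mem_union, Finset.mem_insert,
          Finset.mem_singleton, reduceCtorEq, false_or]
        exact fun hf => h.names _ hf (hWin _ (by simp)).1
    · exact h.edge_closed _ (hWin _ (by simp)).1 y hy hyA
  have hsplit : ∀ B : Finset (VD ⊕ AlgVertex VD),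
      (∀ x, Sum.inr x ∈ (algTree D ch U).verts → Sum.inr x ∈ B) → Sum.inr (.fst W) ∈ B →
      (∀ x, Sum.inr x ∈ (algTree D ch V).verts → Sum.inr x ∈ B) →
      ClosedIn S B (Sum.inr (.splitFst W)) := by
    intro B hB hfB hB' y hy hyB
    by_cases hyA : Sum.inr y ∈ A
    · rw [h.inc_eq y hyA]
      rcases (hA y).1 hyA with hyA | rfl | hyA | rfl
      · exact absurd (hB y hyA) hyB
      · exact absurd hfB hyB
      · exact absurd (hB' y hyA) hyB
      · rw [hsnd]
        simp only [Finset.inr_mem_disjSum, Finset.mem_union, Finset.mem_insert,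
          Finset.mem_singleton, reduceCtorEq, false_or]
        exact fun hf => h.names _ hf (hWin _ (by simp)).1
    · exact h.edge_closed _ (hWin _ (by simp)).1 y hy hyA
  have hmono : ∀ {B B' : Finset (VD ⊕ AlgVertex VD)} {f : ED ⊕ AlgEdge VD}, B ⊆ B' →
      ClosedIn S B f → ClosedIn S B' f := fun hB hc y hy hyB => hc y hy fun hy' => hyB (hB hy')
  have hl2 : ((algTree D ch U).verts ∪ {Sum.inr (AlgVertex.fst W)}).toLeft = U.verts := by
    ext v; simp [inl_mem_algTree]
  have hl3 : ((algTree D ch U).verts ∪ {Sum.inr (AlgVertex.fst W)} ∪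
      (algTree D ch V).verts).toLeft = W := by
    ext v; simp [inl_mem_algTree, hW]
  -- After `fst W` is absorbed, `whole W` is closed, while `splitFst W` still waits for `V` and `mid
  -- W` for `snd W`. After `V` is absorbed, `splitFst W` closes and `splitSnd W` opens.
  have hb2 : G.boundary ((algTree D ch U).verts ∪ {Sum.inr (.fst W)}) ⊆
      (D.plainBoundary U.verts).map Function.Embedding.inl ∪
        {Sum.inr (.splitFst W), Sum.inr (.mid W)} := by
    have := boundary_total_subset (S := S) hD
      (A := (algTree D ch U).verts ∪ {Sum.inr (AlgVertex.fst W)})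
      (X := {Sum.inr (.splitFst W), Sum.inr (.mid W)}) hmem (by rw [hl2]; exact hUW.trans hWD)
      (fun e he => .inr (hmono Finset.subset_union_left (hlU.sketch_closed e (by rwa [hl2] at he))))
      (fun x hx e he => by
        rw [hl2]
        rcases Finset.mem_union.1 hx with hx | hx
        · exact hUvert x hx e he
        · obtain rfl : x = .fst W := by simpa using hx
          rw [h.inc_eq _ hfstA, hfst] at he
          simp at he)
      (fun x hx f hf => by
        rcases Finset.mem_union.1 hx with hx | hx
        · rw [hlU.inc_eq x hx] at hf
          rcases (mem_algInc hf).2.2 f rfl with hf | hf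
          · rw [Finset.mem_singleton] at hf
            subst hf
            exact .inr ⟨by simp [houts], hwhole _ (fun x hx => Finset.mem_union_left _ hx)
              (by simp)⟩
          · exact .inr ⟨hf.not_mem_outs houts,
              hmono Finset.subset_union_left (hlU.edge_closed f hf)⟩
        · obtain rfl : x = .fst W := by simpa using hx
          rw [h.inc_eq _ hfstA, hfst] at hf
          simp only [Finset.mem_insert, Finset.mem_singleton, Sum.inr.injEq] at hf
          rcases hf with rfl | rfl | rfl
          · exact .inr ⟨by simp [houts], hwhole _ (fun x hx => Finset.mem_union_left _ hx)
              (by simp)⟩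
          · exact .inl (by simp)
          · exact .inl (by simp))
    rwa [hl2] at this
  have hb3 : G.boundary ((algTree D ch U).verts ∪ {Sum.inr (.fst W)} ∪ (algTree D ch V).verts) ⊆
      (D.plainBoundary W).map Function.Embedding.inl ∪
        {Sum.inr (.mid W), Sum.inr (.splitSnd W)} := by
    have hU3 : ∀ x, x ∈ (algTree D ch U).verts →
        x ∈ (algTree D ch U).verts ∪ {Sum.inr (AlgVertex.fst W)} ∪ (algTree D ch V).verts :=
      fun x hx => Finset.mem_union_left _ (Finset.mem_union_left _ hx)
    have hV3 : ∀ x, x ∈ (algTree D ch V).verts →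
        x ∈ (algTree D ch U).verts ∪ {Sum.inr (AlgVertex.fst W)} ∪ (algTree D ch V).verts :=
      fun x hx => Finset.mem_union_right _ hx
    have hf3 : Sum.inr (AlgVertex.fst W) ∈
        (algTree D ch U).verts ∪ {Sum.inr (AlgVertex.fst W)} ∪ (algTree D ch V).verts := by simp
    have hwh := hwhole _ (fun x hx => hU3 _ hx) hf3
    have hsp := hsplit _ (fun x hx => hU3 _ hx) hf3 (fun x hx => hV3 _ hx)
    have := boundary_total_subset (S := S) hD
      (A := (algTree D ch U).verts ∪ {Sum.inr (AlgVertex.fst W)} ∪ (algTree D ch V).verts)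
      (X := {Sum.inr (.mid W), Sum.inr (.splitSnd W)}) hmem (by rwa [hl3])
      (fun e he => by
        rw [hl3, hW, sketchOf_union] at he
        rcases Finset.mem_union.1 he with he | he
        · exact .inr (hmono hU3 (hlU.sketch_closed e he))
        · exact .inr (hmono hV3 (hlV.sketch_closed e he)))
      (fun x hx e he => by
        rw [hl3, hW, sketchOf_union]
        rcases Finset.mem_union.1 hx with hx | hx
        · rcases Finset.mem_union.1 hx with hx | hx
          · exact Finset.mem_union_left _ (hUvert x hx e he)
          · obtain rfl : x = .fst W := by simpa using hx
            rw [h.inc_eq _ hfstA, hfst] at he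
            simp at he
        · exact Finset.mem_union_right _ (hVvert x hx e he))
      (fun x hx f hf => by
        rcases Finset.mem_union.1 hx with hx | hx
        · rcases Finset.mem_union.1 hx with hx | hx
          · rw [hlU.inc_eq x hx] at hf
            rcases (mem_algInc hf).2.2 f rfl with hf | hf
            · rw [Finset.mem_singleton] at hf
              subst hf
              exact .inr ⟨by simp [houts], hwh⟩
            · exact .inr ⟨hf.not_mem_outs houts, hmono hU3 (hlU.edge_closed f hf)⟩
          · obtain rfl : x = .fst W := by simpa using hx
            rw [h.inc_eq _ hfstA, hfst] at hf
            simp only [Finset.mem_insert, Finset.mem_singleton, Sum.inr.injEq] at hf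
            rcases hf with rfl | rfl | rfl
            · exact .inr ⟨by simp [houts], hwh⟩
            · exact .inr ⟨by simp [houts], hsp⟩
            · exact .inl (by simp)
        · rw [hlV.inc_eq x hx] at hf
          rcases (mem_algInc hf).2.2 f rfl with hf | hf
          · simp only [Finset.mem_insert, Finset.mem_singleton] at hf
            rcases hf with rfl | rfl
            · exact .inr ⟨by simp [houts], hsp⟩
            · exact .inl (by simp)
          · exact .inr ⟨hf.not_mem_outs houts, hmono hV3 (hlV.edge_closed f hf)⟩)
    rwa [hl3] at this
  have hpos : ∀ f : AlgEdge VD, f = .whole W ∨ f = .splitFst W ∨ f = .splitSnd W ∨ f = .mid W →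
      0 < G.size (Sum.inr f) := by
    rintro f (rfl | rfl | rfl | rfl) <;> rw [hGs] <;> simpa [algSize]
  have c1 : G.contractionCost (algTree D ch U).verts {Sum.inr (.fst W)} ≤
      (∏ i ∈ D.plainBoundary U.verts, D.size i) * (m * (p * m)) := by
    have hs : G.sizeProd ({Sum.inr (.whole W), Sum.inr (.splitFst W), Sum.inr (.mid W)} :
        Finset (ED ⊕ AlgEdge VD)) = m * (p * m) := by
      rw [sizeProd, Finset.prod_insert (by simp), Finset.prod_insert (by simp),
        Finset.prod_singleton, hGs, hGs, hGs]
      rfl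
    rw [← hs]
    refine contractionCost_le hD ?_ ?_
    · intro f hf
      simp only [Finset.mem_insert, Finset.mem_singleton] at hf
      rcases hf with rfl | rfl | rfl <;> exact hpos _ (by simp)
    · refine Finset.union_subset (hUb.trans (Finset.union_subset_union_right ?_))
        (hfstb.trans Finset.subset_union_right)
      simp
  have c2 : G.contractionCost ((algTree D ch U).verts ∪ {Sum.inr (.fst W)})
      (algTree D ch V).verts ≤
      (∏ i ∈ D.plainBoundary U.verts ∪ D.plainBoundary V.verts, D.size i) *
        (p * (splitRest m p * m)) := by
    have hs : G.sizeProd ({Sum.inr (.splitFst W), Sum.inr (.splitSnd W), Sum.inr (.mid W)} :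
        Finset (ED ⊕ AlgEdge VD)) = p * (splitRest m p * m) := by
      rw [sizeProd, Finset.prod_insert (by simp), Finset.prod_insert (by simp),
        Finset.prod_singleton, hGs, hGs, hGs]
      rfl
    rw [← hs]
    refine contractionCost_le hD ?_ ?_
    · intro f hf
      simp only [Finset.mem_insert, Finset.mem_singleton] at hf
      rcases hf with rfl | rfl | rfl <;> exact hpos _ (by simp)
    · rw [Finset.map_union]
      refine Finset.union_subset (hb2.trans (Finset.union_subset_union
        Finset.subset_union_left ?_)) (hVb.trans (Finset.union_subset_union
        Finset.subset_union_right ?_))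
      · intro f hf; simp only [Finset.mem_insert, Finset.mem_singleton] at hf ⊢; tauto
      · intro f hf
        rcases f with e | f
        · simp at hf
        · simp at hf ⊢; tauto
  -- Only this term exceeds its counterpart in `splitCost`: the outgoing edges may be a split pair,
  -- whose total size is bounded by `2 * m` and not by `m`.
  have c3 : G.contractionCost
      ((algTree D ch U).verts ∪ {Sum.inr (.fst W)} ∪ (algTree D ch V).verts)
      {Sum.inr (.snd W)} ≤
      (∏ i ∈ D.plainBoundary W, D.size i) * (m * splitRest m p * (2 * m)) := by
    have hoG : ∀ f ∈ o.map (Function.Embedding.inr : AlgEdge VD ↪ ED ⊕ AlgEdge VD),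
        0 < G.size f := by
      intro f hf
      obtain ⟨f, hf, rfl⟩ := Finset.mem_map.1 hf
      exact ho f ‹_›
    have hs : G.sizeProd (({Sum.inr (.mid W), Sum.inr (.splitSnd W)} :
        Finset (ED ⊕ AlgEdge VD)) ∪ o.map Function.Embedding.inr) ≤
        m * splitRest m p * (2 * m) := by
      refine (sizeProd_union_le hoG).trans (Nat.mul_le_mul (le_of_eq ?_) ?_)
      · rw [sizeProd, Finset.prod_insert (by simp), Finset.prod_singleton, hGs, hGs]
        rfl
      · rw [sizeProd, Finset.prod_map]
        exact ho2
    refine le_trans (contractionCost_le hD ?_ ?_) (Nat.mul_le_mul_left _ hs)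
    · intro f hf
      rcases Finset.mem_union.1 hf with hf | hf
      · simp only [Finset.mem_insert, Finset.mem_singleton] at hf
        rcases hf with rfl | rfl <;> exact hpos _ (by simp)
      · exact hoG f hf
    · refine Finset.union_subset (hb3.trans (Finset.union_subset_union_right
        Finset.subset_union_left)) (hsndb.trans Finset.subset_union_right)
  rw [splitCost, ← hW]
  calc _ ≤ _ := Nat.add_le_add (Nat.add_le_add c1 c2) c3
    _ = (∏ i ∈ D.plainBoundary U.verts, D.size i) * m * p * m +
      (∏ i ∈ D.plainBoundary U.verts ∪ D.plainBoundary V.verts, D.size i) * m * p *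
        splitRest m p +
      2 * ((∏ i ∈ D.plainBoundary W, D.size i) * m * splitRest m p * m) := by ring
    _ ≤ _ := by
      rw [mul_add, mul_add]
      exact Nat.add_le_add_right (Nat.add_le_add (by omega) (by omega)) _

end Local

/-! ### The cost of the tree built by the algorithm -/

section AlgUpper

variable {VD ED : Type*} [DecidableEq VD] [DecidableEq ED]
variable {D : DataNetwork VD ED} {S : Embedding ED (AlgVertex VD) (AlgEdge VD)}
  {ch : AlgChoices VD ED} {m : ℕ}

/-- What the algorithm spends on a contraction of the data tree, the sketching matrices left
aside. -/
def stepCost (D : DataNetwork VD ED) (ch : AlgChoices VD ED) (m : ℕ)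
    (p : Finset VD × Finset VD) : ℕ :=
  if D.sketchOf (p.1 ∪ p.2) = ∅ then plainCost D p.1 p.2
  else if BothSketched D p.1 p.2 then
    if GoesFirst D p.1 p.2 then splitCost D m p.1 p.2 (ch.split (p.1 ∪ p.2))
    else splitCost D m p.2 p.1 (ch.split (p.1 ∪ p.2))
  else plainCost D p.1 p.2 * (if ∃ e ∈ D.sketchOf (p.1 ∪ p.2), p.1 ∪ p.2 ⊆ ch.place e then
    ∏ e ∈ D.sketchOf (p.1 ∪ p.2), D.size e else m)

/-- Contractions below the tensor to which a sketching matrix is applied. -/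
theorem cost_below_place (hD : D.IsValid)
    (hmem : ∀ x ∈ S.verts, ∀ e, Sum.inl e ∈ S.inc x → e ∈ D.sketch)
    {e : ED} (he : D.sketchOf (ch.place e) = {e}) {t : ContractionTree VD}
    (ht : t.leaves.Nodup) (htD : t.verts ⊆ D.verts) (hte : t.verts = ch.place e) :
    (Embedding.total D S).treeCost (t.map Sum.inl) ≤ (t.contractions.map (stepCost D ch m)).sum := by
  rw [treeCost, ContractionTree.contractions_map, List.map_map]
  refine List.sum_le_sum fun p hp => ?_
  have hpt := ContractionTree.union_subset_of_mem_contractions hp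
  have hpd := ContractionTree.disjoint_of_mem_contractions ht hp
  have h1 := Finset.union_subset_left hpt
  have h2 := Finset.union_subset_right hpt
  have hb1 := boundary_image_inl_subset (S := S) hD hmem (h1.trans htD)
  have hb2 := boundary_image_inl_subset (S := S) hD hmem (h2.trans htD)
  have hcost : (Embedding.total D S).contractionCost (p.1.image Sum.inl) (p.2.image Sum.inl) ≤
      plainCost D p.1 p.2 * ∏ e ∈ D.sketchOf (p.1 ∪ p.2), D.size e := by
    have hs : ∏ e ∈ D.sketchOf (p.1 ∪ p.2), D.size e = (Embedding.total D S).sizeProd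
        ((D.sketchOf (p.1 ∪ p.2)).map Function.Embedding.inl) := by
      rw [sizeProd, Finset.prod_map]; rfl
    rw [hs]
    refine contractionCost_le hD ?_ ?_
    · intro f hf
      obtain ⟨e, -, rfl⟩ := Finset.mem_map.1 hf
      exact hD.size_pos e
    · rw [sketchOf_union, Finset.map_union, Finset.map_union]
      exact Finset.union_subset
        (hb1.trans (Finset.union_subset_union Finset.subset_union_left Finset.subset_union_left))
        (hb2.trans (Finset.union_subset_union Finset.subset_union_right Finset.subset_union_right))
  -- At most one dimension to be sketched occurs below the placement, so the two-sketched branches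
  -- of `stepCost` are impossible, and in the remaining sketched branch the placement condition
  -- holds.
  have hsub : D.sketchOf (p.1 ∪ p.2) ⊆ {e} := by
    rw [← he, ← hte]; exact sketchOf_mono hpt
  refine hcost.trans ?_
  rw [stepCost]
  split_ifs with c1 c2 c3 c4
  · rw [c1, Finset.prod_empty, mul_one]
  · exfalso
    obtain ⟨⟨a, ha⟩, ⟨b, hb⟩⟩ := c2
    rw [sketchOf_union] at hsub
    have ha' := Finset.mem_singleton.1 (hsub (Finset.mem_union_left _ ha))
    have hb' := Finset.mem_singleton.1 (hsub (Finset.mem_union_right _ hb))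
    exact Finset.disjoint_left.1 (disjoint_sketchOf hD (h1.trans htD) (h2.trans htD) hpd)
      (ha' ▸ ha) (hb' ▸ hb)
  · exfalso
    obtain ⟨⟨a, ha⟩, ⟨b, hb⟩⟩ := c2
    rw [sketchOf_union] at hsub
    have ha' := Finset.mem_singleton.1 (hsub (Finset.mem_union_left _ ha))
    have hb' := Finset.mem_singleton.1 (hsub (Finset.mem_union_right _ hb))
    exact Finset.disjoint_left.1 (disjoint_sketchOf hD (h1.trans htD) (h2.trans htD) hpd)
      (ha' ▸ ha) (hb' ▸ hb)
  · exact le_rfl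
  · exfalso
    obtain ⟨a, ha⟩ := Finset.nonempty_iff_ne_empty.2 c1
    have ha' := Finset.mem_singleton.1 (hsub ha)
    exact c4 ⟨a, ha, ha' ▸ hte ▸ hpt⟩

/-- The step of the algorithm that applies a sketching matrix. -/
theorem place_step (hD : D.IsValid)
    (hmem : ∀ x ∈ S.verts, ∀ e, Sum.inl e ∈ S.inc x → e ∈ D.sketch)
    {W : Finset VD} (hW : W ⊆ D.verts) {e : ED} (he : D.sketchOf W = {e})
    {o : Finset (AlgEdge VD)} (hinc : S.inc (.kron W) = (D.sketchOf W).disjSum o)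
    (ho : ∀ f ∈ o, 0 < S.size f) (ho2 : ∏ f ∈ o, S.size f ≤ 2 * m) :
    (Embedding.total D S).contractionCost (W.image Sum.inl) {Sum.inr (.kron W)} ≤
      2 * ((∏ i ∈ D.plainBoundary W, D.size i) * D.size e * m) := by
  have hb1 := boundary_image_inl_subset (S := S) hD hmem hW
  have hb2 : (Embedding.total D S).boundary {Sum.inr (.kron W)} ⊆
      (D.sketchOf W).map Function.Embedding.inl ∪ o.map Function.Embedding.inr := by
    refine (boundary_singleton_subset _ _).trans ?_
    have : (Embedding.total D S).inc (Sum.inr (.kron W)) = (D.sketchOf W).disjSum o := hinc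
    rw [this]
    intro f hf
    rcases f with f | f
    · simpa using hf
    · simpa using hf
  have hoG : ∀ f ∈ o.map (Function.Embedding.inr : AlgEdge VD ↪ ED ⊕ AlgEdge VD),
      0 < (Embedding.total D S).size f := by
    intro f hf
    obtain ⟨f, hf, rfl⟩ := Finset.mem_map.1 hf
    exact ho f ‹_›
  have hs : (Embedding.total D S).sizeProd ((D.sketchOf W).map Function.Embedding.inl ∪
      o.map Function.Embedding.inr) ≤ D.size e * (2 * m) := by
    refine (sizeProd_union_le hoG).trans (Nat.mul_le_mul (le_of_eq ?_) ?_)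
    · rw [he, sizeProd, Finset.prod_map, Finset.prod_singleton]; rfl
    · rw [sizeProd, Finset.prod_map]
      exact ho2
  refine (contractionCost_le hD (P := D.plainBoundary W) ?_ ?_).trans
    ((Nat.mul_le_mul_left _ hs).trans (le_of_eq (by ring)))
  · intro f hf
    rcases Finset.mem_union.1 hf with hf | hf
    · obtain ⟨i, -, rfl⟩ := Finset.mem_map.1 hf
      exact hD.size_pos i
    · exact hoG f hf
  · exact Finset.union_subset
      (hb1.trans (Finset.union_subset_union_right Finset.subset_union_left))
      (hb2.trans Finset.subset_union_right)

/-- The induction has to run over all families `o` of outgoing edges, because the recursive calls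
pass one edge, a split pair, or `o` itself. Their total size may be `2 * m` where `stepCost` counts
`m`, which accounts for the factor `2`. -/
theorem treeCost_algTree_le (hD : D.IsValid)
    (hmem : ∀ x ∈ S.verts, ∀ e, Sum.inl e ∈ S.inc x → e ∈ D.sketch) (houts : S.outs = {.out})
    (hsize : S.size = algSize ch m) (hm : 0 < m) (hms : ∀ e ∈ D.sketch, m ≤ D.size e)
    (hch : ∀ e ∈ D.sketch, D.sketchOf (ch.place e) = {e})
    {t : ContractionTree VD} (ht : t.leaves.Nodup) (htD : t.verts ⊆ D.verts)
    (hsplit : ∀ p ∈ t.contractions, BothSketched D p.1 p.2 →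
      ch.split (p.1 ∪ p.2) ∈ Finset.Icc 1 m)
    {o : Finset (AlgEdge VD)} (h : IsLocalTree D S ch t o)
    (ho : ∀ f ∈ o, 0 < S.size f) (ho2 : ∏ f ∈ o, S.size f ≤ 2 * m) :
    (Embedding.total D S).treeCost (algTree D ch t) ≤
      2 * ((t.contractions.map (stepCost D ch m)).sum +
        ∑ e ∈ D.sketchOf t.verts,
          (∏ i ∈ D.plainBoundary (ch.place e), D.size i) * D.size e * m) := by
  induction t generalizing o with
  | leaf v =>
    by_cases hv : {v} ∈ D.sketch.image ch.place
    · obtain ⟨e, he, hev⟩ := Finset.mem_image.1 hv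
      have hsk : D.sketchOf {v} = {e} := by rw [← hev]; exact hch e he
      have hkron : Sum.inr (AlgVertex.kron {v}) ∈ (algTree D ch (.leaf v)).verts := by
        rw [algTree, if_pos hv]; simp
      have hinc : S.inc (.kron {v}) = (D.sketchOf {v}).disjSum o := by
        rw [h.inc_eq _ hkron, algInc, if_pos ⟨hv, rfl⟩]
      have := place_step (S := S) (m := m) hD hmem htD hsk hinc ho ho2
      rw [ContractionTree.verts_leaf, Finset.image_singleton] at this
      rw [algTree, if_pos hv, treeCost_node]
      simp only [ContractionTree.verts_leaf, hsk, Finset.sum_singleton, hev, treeCost,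
        ContractionTree.contractions, List.map_nil, List.sum_nil, zero_add, add_zero]
      exact this
    · rw [algTree, if_neg hv]
      simp [treeCost, ContractionTree.contractions]
  | node l r ihl ihr =>
    have hd := ContractionTree.disjoint_verts ht
    rw [ContractionTree.verts_node] at htD
    have hlD := Finset.union_subset_left htD
    have hrD := Finset.union_subset_right htD
    have ihl := fun {o} => ihl (ContractionTree.nodup_left ht) hlD
      (fun p hp => hsplit p (by simp [ContractionTree.contractions, hp])) (o := o)
    have ihr := fun {o} => ihr (ContractionTree.nodup_right ht) hrD
      (fun p hp => hsplit p (by simp [ContractionTree.contractions, hp])) (o := o)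
    have hdsk := disjoint_sketchOf hD hlD hrD hd
    set W := l.verts ∪ r.verts with hWdef
    by_cases hW : W ∈ D.sketch.image ch.place
    · obtain ⟨e, he, heW⟩ := Finset.mem_image.1 hW
      have hsk : D.sketchOf W = {e} := by rw [← heW]; exact hch e he
      have htree : algTree D ch (.node l r) =
          .node ((ContractionTree.node l r).map Sum.inl) (.leaf (Sum.inr (.kron W))) := by
        rw [algTree, if_pos hW]
      have hkron : Sum.inr (AlgVertex.kron W) ∈ (algTree D ch (.node l r)).verts := by
        rw [htree]; simp
      have hinc : S.inc (.kron W) = (D.sketchOf W).disjSum o := by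
        rw [h.inc_eq _ hkron, algInc, if_pos hW, if_pos rfl]
      have h1 := place_step (S := S) (m := m) hD hmem htD hsk hinc ho ho2
      have h2 := cost_below_place (S := S) (m := m) hD hmem (hch e he) ht
        (by rwa [ContractionTree.verts_node]) (by rw [ContractionTree.verts_node, heW])
      rw [htree, treeCost_node, ContractionTree.verts_map, ContractionTree.verts_node,
        ContractionTree.verts_leaf, ← hWdef, hsk, Finset.sum_singleton, heW]
      have h0 : (Embedding.total D S).treeCost (.leaf (Sum.inr (AlgVertex.kron W))) = 0 := by
        simp [treeCost, ContractionTree.contractions]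
      rw [h0]
      omega
    · have hskW : D.sketchOf W = D.sketchOf l.verts ∪ D.sketchOf r.verts := sketchOf_union _ _
      rw [ContractionTree.verts_node, ← hWdef, hskW, Finset.sum_union hdsk]
      have hsum : ((ContractionTree.node l r).contractions.map (stepCost D ch m)).sum =
          stepCost D ch m (l.verts, r.verts) + ((l.contractions.map (stepCost D ch m)).sum +
            (r.contractions.map (stepCost D ch m)).sum) := by
        simp [ContractionTree.contractions]
      rw [hsum]
      have hleaf : ∀ x, (Embedding.total D S).treeCost
          (.leaf x : ContractionTree (VD ⊕ AlgVertex VD)) = 0 := by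
        simp [treeCost, ContractionTree.contractions]
      have hsizes : S.size (.whole W) = m ∧ S.size (.splitFst W) = ch.split W ∧
          S.size (.splitSnd W) = splitRest m (ch.split W) := by
        rw [hsize]; exact ⟨rfl, rfl, rfl⟩
      obtain ⟨z1, z2, z3⟩ := hsizes
      by_cases hb : BothSketched D l.verts r.verts
      · have hloc : IsLocal D S W (algTree D ch (.node l r)).verts (algInc D ch (.node l r) o) o := by
          rw [hWdef, ← ContractionTree.verts_node]
          exact h
        have hWne : D.sketchOf W ≠ ∅ := by
          rw [hskW]; exact (hb.1.mono Finset.subset_union_left).ne_empty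
        have hsp := Finset.mem_Icc.1 (hsplit (l.verts, r.verts)
          (by simp [ContractionTree.contractions]) hb)
        have hw1 : ∀ f ∈ ({.whole W} : Finset (AlgEdge VD)), 0 < S.size f := by
          simpa [z1] using hm
        have hw2 : ∏ f ∈ ({.whole W} : Finset (AlgEdge VD)), S.size f ≤ 2 * m := by
          rw [Finset.prod_singleton, z1]; omega
        have hs1 : ∀ f ∈ ({.splitFst W, .splitSnd W} : Finset (AlgEdge VD)), 0 < S.size f := by
          intro f hf
          simp only [Finset.mem_insert, Finset.mem_singleton] at hf
          rcases hf with rfl | rfl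
          · rw [z2]; exact hsp.1
          · rw [z3]; exact splitRest_pos hm hsp.1
        have hs2 : ∏ f ∈ ({.splitFst W, .splitSnd W} : Finset (AlgEdge VD)), S.size f ≤
            2 * m := by
          rw [Finset.prod_insert (by simp), Finset.prod_singleton, z2, z3]
          exact mul_splitRest_le hsp.2
        by_cases hg : GoesFirst D l.verts r.verts
        · have htree : algTree D ch (.node l r) =
              .node (.node (.node (algTree D ch l) (.leaf (Sum.inr (.fst W)))) (algTree D ch r))
                (.leaf (Sum.inr (.snd W))) := by
            rw [algTree, if_neg hW, if_pos hb, if_pos hg]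
          obtain ⟨hl, hr, hc⟩ := both_step hD hmem houts hsize hm hWdef hd htD
            (A := (algTree D ch (.node l r)).verts) (adj := algInc D ch (.node l r) o) (o := o)
            (fun x => by rw [htree]; simp only [ContractionTree.verts_node, ContractionTree.verts_leaf,
              Finset.mem_union, Finset.mem_singleton, Sum.inr.injEq, or_assoc])
            (fun x => by rw [algInc, if_neg hW, if_pos hb, if_pos hg])
            hloc hsp.1 ho ho2
          have ihl := ihl hl hw1 hw2
          have ihr := ihr hr hs1 hs2
          have hst : stepCost D ch m (l.verts, r.verts) =
              splitCost D m l.verts r.verts (ch.split W) := by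
            rw [stepCost, if_neg hWne, if_pos hb, if_pos hg]
          rw [htree, treeCost_node, treeCost_node, treeCost_node, hleaf, hleaf, hst]
          simp only [ContractionTree.verts_node, ContractionTree.verts_leaf]
          omega
        · have htree : algTree D ch (.node l r) =
              .node (.node (.node (algTree D ch r) (.leaf (Sum.inr (.fst W)))) (algTree D ch l))
                (.leaf (Sum.inr (.snd W))) := by
            rw [algTree, if_neg hW, if_pos hb, if_neg hg]
          obtain ⟨hr, hl, hc⟩ := both_step hD hmem houts hsize hm
            (hWdef.trans (Finset.union_comm _ _)) hd.symm htD
            (A := (algTree D ch (.node l r)).verts) (adj := algInc D ch (.node l r) o) (o := o)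
            (fun x => by rw [htree]; simp only [ContractionTree.verts_node, ContractionTree.verts_leaf,
              Finset.mem_union, Finset.mem_singleton, Sum.inr.injEq, or_assoc])
            (fun x => by rw [algInc, if_neg hW, if_pos hb, if_neg hg])
            hloc hsp.1 ho ho2
          have ihl := ihl hl hs1 hs2
          have ihr := ihr hr hw1 hw2
          have hst : stepCost D ch m (l.verts, r.verts) =
              splitCost D m r.verts l.verts (ch.split W) := by
            rw [stepCost, if_neg hWne, if_pos hb, if_neg hg]
          rw [htree, treeCost_node, treeCost_node, treeCost_node, hleaf, hleaf, hst]
          simp only [ContractionTree.verts_node, ContractionTree.verts_leaf]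
          omega
      · have htree : algTree D ch (.node l r) = .node (algTree D ch l) (algTree D ch r) := by
          rw [algTree, if_neg hW, if_neg hb]
        have hadj : ∀ x, algInc D ch (.node l r) o x = algInc D ch l o x ∪ algInc D ch r o x :=
          fun x => by rw [algInc, if_neg hW, if_neg hb]
        have hA : ∀ x, Sum.inr x ∈ (algTree D ch (.node l r)).verts ↔
            Sum.inr x ∈ (algTree D ch l).verts ∨ Sum.inr x ∈ (algTree D ch r).verts :=
          fun x => by rw [htree]; simp
        have hnlr : ∀ {x : AlgVertex VD}, x.name ∈ l.tensors → x.name ∉ r.tensors := by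
          intro x hx hx'
          obtain ⟨y, hy⟩ := ContractionTree.nonempty_of_mem_tensors hx
          exact Finset.disjoint_left.1 hd (ContractionTree.subset_verts_of_mem_tensors hx hy)
            (ContractionTree.subset_verts_of_mem_tensors hx' hy)
        have hinl : ∀ x, x.name ∈ l.tensors →
            algInc D ch (.node l r) o x = algInc D ch l o x := by
          intro x hx
          rw [hadj, Finset.union_eq_left]
          exact fun f hf => absurd (mem_algInc hf).1 (hnlr hx)
        have hinr : ∀ x, x.name ∈ r.tensors →
            algInc D ch (.node l r) o x = algInc D ch r o x := by
          intro x hx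
          rw [hadj, Finset.union_eq_right]
          exact fun f hf => absurd hx (hnlr (mem_algInc hf).1)
        have hsubl : l.verts ⊆ (ContractionTree.node l r).verts := by
          rw [ContractionTree.verts_node]; exact Finset.subset_union_left
        have hsubr : r.verts ⊆ (ContractionTree.node l r).verts := by
          rw [ContractionTree.verts_node]; exact Finset.subset_union_right
        have hl : IsLocalTree D S ch l o := by
          refine h.restrict hsubl (fun f hf hfl => h.names f hf (hfl.mono hsubl))
            (fun x hx => ⟨(hA x).2 (.inl hx), hinl x (name_mem_tensors hx)⟩) ?_
          intro y hy hyl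
          have hyr := ((hA y).1 hy).resolve_left hyl
          rw [hinr y (name_mem_tensors hyr)]
          refine ⟨fun e he he' => Finset.disjoint_left.1 hdsk he ((mem_algInc he').2.1 e rfl),
            fun f hf hf' => ?_⟩
          rcases (mem_algInc hf').2.2 f rfl with hf' | hf'
          · exact h.names f hf' (hf.mono hsubl)
          · exact hf.not_of_disjoint hd hf'
        have hr : IsLocalTree D S ch r o := by
          refine h.restrict hsubr (fun f hf hfr => h.names f hf (hfr.mono hsubr))
            (fun x hx => ⟨(hA x).2 (.inr hx), hinr x (name_mem_tensors hx)⟩) ?_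
          intro y hy hyr
          have hyl := ((hA y).1 hy).resolve_right hyr
          rw [hinl y (name_mem_tensors hyl)]
          refine ⟨fun e he he' => Finset.disjoint_left.1 hdsk ((mem_algInc he').2.1 e rfl) he,
            fun f hf hf' => ?_⟩
          rcases (mem_algInc hf').2.2 f rfl with hf' | hf'
          · exact h.names f hf' (hf.mono hsubr)
          · exact hf'.not_of_disjoint hd hf
        have ihl := ihl hl ho ho2
        have ihr := ihr hr ho ho2
        have hc : (Embedding.total D S).contractionCost (algTree D ch l).verts
            (algTree D ch r).verts ≤ 2 * stepCost D ch m (l.verts, r.verts) := by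
          rw [stepCost]
          by_cases hWe : D.sketchOf W = ∅
          · have hlr := hWe
            rw [hskW, Finset.union_eq_empty] at hlr
            have b1 := boundary_subset_of_unsketched (S := S) hD hmem hch hlD hlr.1
            have b2 := boundary_subset_of_unsketched (S := S) hD hmem hch hrD hlr.2
            have := contractionCost_le (S := S) hD (A := (algTree D ch l).verts)
              (B := (algTree D ch r).verts) (P := D.plainBoundary l.verts ∪ D.plainBoundary r.verts)
              (Y := ∅) (by simp) (by
                rw [Finset.union_empty, Finset.map_union]
                exact Finset.union_subset_union b1 b2)
            rw [sizeProd, Finset.prod_empty, mul_one] at this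
            rw [if_pos hWe]
            exact this.trans (Nat.le_mul_of_pos_left (plainCost D l.verts r.verts) two_pos)
          · have b1 := IsLocalTree.boundary_subset hD hmem houts hlD hl
            have b2 := IsLocalTree.boundary_subset hD hmem houts hrD hr
            have hoG : ∀ f ∈ o.map (Function.Embedding.inr : AlgEdge VD ↪ ED ⊕ AlgEdge VD),
                0 < (Embedding.total D S).size f := by
              intro f hf
              obtain ⟨f, hf, rfl⟩ := Finset.mem_map.1 hf
              exact ho f ‹_›
            have := contractionCost_le (S := S) hD (A := (algTree D ch l).verts)
              (B := (algTree D ch r).verts) (P := D.plainBoundary l.verts ∪ D.plainBoundary r.verts)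
              hoG (by
                rw [Finset.map_union]
                exact Finset.union_subset
                  (b1.trans (Finset.union_subset_union_left Finset.subset_union_left))
                  (b2.trans (Finset.union_subset_union_left Finset.subset_union_right)))
            have hos : (Embedding.total D S).sizeProd
                (o.map (Function.Embedding.inr : AlgEdge VD ↪ ED ⊕ AlgEdge VD)) ≤ 2 * m := by
              rw [sizeProd, Finset.prod_map]
              exact ho2
            -- Whichever factor `stepCost` uses, it is at least `m`, since every dimension to be
            -- sketched has size at least `m`.
            have hfac : m ≤ (if ∃ e ∈ D.sketchOf W, W ⊆ ch.place e then
                ∏ e ∈ D.sketchOf W, D.size e else m) := by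
              split_ifs with hex
              · obtain ⟨e, he, -⟩ := hex
                refine (hms e (mem_sketchOf.1 he).2).trans ?_
                exact Finset.single_le_prod' (f := D.size) (fun i _ => hD.size_pos i) he
              · exact le_rfl
            rw [if_neg hWe, if_neg hb]
            calc _ ≤ _ := this
              _ ≤ plainCost D l.verts r.verts * (2 * m) := Nat.mul_le_mul_left _ hos
              _ = 2 * (plainCost D l.verts r.verts * m) := by ring
              _ ≤ _ := Nat.mul_le_mul_left _ (Nat.mul_le_mul_left _ hfac)
        rw [htree, treeCost_node]
        omega

end AlgUpper

/-! ### Optimizing the split of the sketch dimension -/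

/-- The shape of `splitCost`, for given products of the plain dimensions. -/
def splitShape (m A X Y k : ℕ) : ℕ :=
  A * m * k * m + X * m * k * splitRest m k + Y * m * splitRest m k * m

/-- Take `k = ⌊√m⌋`. Then `k ≤ √m`, `k * q ≤ 2 * m` and `q ≤ 4 * √m`, and the three terms contribute
`1 + 2 + 4 = 7`. -/
theorem exists_splitShape_le_sqrt {m A X Y : ℕ} (hm : 0 < m) (hA : A ≤ X) (hY : Y ≤ X) :
    ∃ k ∈ Finset.Icc 1 m, (splitShape m A X Y k : ℝ) ≤ 7 * √(m : ℝ) * (X * (m : ℝ) ^ 2) := by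
  have hk1 : 1 ≤ Nat.sqrt m := Nat.sqrt_pos.2 hm
  refine ⟨Nat.sqrt m, Finset.mem_Icc.2 ⟨hk1, Nat.sqrt_le_self m⟩, ?_⟩
  set k := Nat.sqrt m with hk
  set q := splitRest m k with hq
  have hkq : (k : ℝ) * q ≤ 2 * m := by exact_mod_cast mul_splitRest_le (Nat.sqrt_le_self m)
  have h1 : (k : ℝ) ≤ √(m : ℝ) := Real.nat_sqrt_le_real_sqrt
  have h2 : √(m : ℝ) ≤ 2 * k := by
    have h3 : √(m : ℝ) < (k : ℝ) + 1 := Real.real_sqrt_lt_nat_sqrt_succ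
    have h4 : (1 : ℝ) ≤ k := by exact_mod_cast hk1
    linarith
  have hm1 : (1 : ℝ) ≤ m := by exact_mod_cast hm
  have hs1 : 1 ≤ √(m : ℝ) := Real.one_le_sqrt.2 hm1
  have hss : √(m : ℝ) * √(m : ℝ) = m := Real.mul_self_sqrt (by positivity)
  have hq4 : (q : ℝ) ≤ 4 * √(m : ℝ) := by
    have : (q : ℝ) * √(m : ℝ) ≤ 4 * √(m : ℝ) * √(m : ℝ) := by
      calc (q : ℝ) * √(m : ℝ) ≤ q * (2 * k) := by gcongr
        _ = 2 * (k * q) := by ring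
        _ ≤ 2 * (2 * m) := by gcongr
        _ = 4 * (√(m : ℝ) * √(m : ℝ)) := by rw [hss]; ring
        _ = _ := by ring
    exact le_of_mul_le_mul_right this (by linarith)
  have hA' : (A : ℝ) ≤ X := by exact_mod_cast hA
  have hY' : (Y : ℝ) ≤ X := by exact_mod_cast hY
  rw [splitShape, ← hq]
  push_cast
  calc (A : ℝ) * m * k * m + X * m * k * q + Y * m * q * m
      = A * (m : ℝ) ^ 2 * k + X * m * (k * q) + Y * (m : ℝ) ^ 2 * q := by ring
    _ ≤ X * (m : ℝ) ^ 2 * √(m : ℝ) + X * m * (2 * m) + X * (m : ℝ) ^ 2 * (4 * √(m : ℝ)) := by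
        gcongr
    _ = 5 * √(m : ℝ) * (X * (m : ℝ) ^ 2) + 2 * 1 * (X * (m : ℝ) ^ 2) := by ring
    _ ≤ 5 * √(m : ℝ) * (X * (m : ℝ) ^ 2) + 2 * √(m : ℝ) * (X * (m : ℝ) ^ 2) := by gcongr
    _ = _ := by ring

/-- For `k * q` of order `m`, the terms `a c k m ^ 2` and `a b q m ^ 2` balance at about `a √(m b c)
m ^ 2`. This exceeds `s ^ 3 * a b c m ^ 2` only when `b c < s ^ 2`; then `a ≤ b` makes `a` small
too, and the excess is covered by the additive term. -/
theorem exists_splitShape_le_of_le {m a b c Y : ℕ} (hm : 0 < m) (ha : 0 < a) (hc : 0 < c)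
    (hab : a ≤ b) (hY : Y ≤ a * b) {s : ℝ} (hs : 0 ≤ s) (hsm : s ^ 8 = m) :
    ∃ k ∈ Finset.Icc 1 m, (splitShape m (a * c) (a * b * c) Y k : ℝ) ≤
      7 * s ^ 3 * ((a * b * c : ℕ) * (m : ℝ) ^ 2 + (m : ℝ) ^ 2 * s ^ 4) := by
  have hm1 : (1 : ℝ) ≤ m := by exact_mod_cast hm
  have hs1 : 1 ≤ s := by
    by_contra hlt
    have := pow_lt_one₀ hs (not_le.1 hlt) (n := 8) (by norm_num)
    linarith
  have hs3 : 1 ≤ s ^ 3 := one_le_pow₀ hs1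
  have ha1 : (1 : ℝ) ≤ a := by exact_mod_cast ha
  have hb1 : (1 : ℝ) ≤ b := by exact_mod_cast ha.trans_le hab
  have hc1 : (1 : ℝ) ≤ c := by exact_mod_cast hc
  have hab' : (a : ℝ) ≤ b := by exact_mod_cast hab
  have hY' : (Y : ℝ) ≤ a * b := by exact_mod_cast hY
  have hYX : (Y : ℝ) ≤ a * b * c := hY'.trans (le_mul_of_one_le_right (by positivity) hc1)
  have hX0 : (0 : ℝ) ≤ a * b * c * (m : ℝ) ^ 2 := by positivity
  have hfin : ∀ {x : ℝ}, x ≤ 3 * (a * b * c * (m : ℝ) ^ 2) →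
      x ≤ 7 * s ^ 3 * ((a * b * c : ℕ) * (m : ℝ) ^ 2 + (m : ℝ) ^ 2 * s ^ 4) := by
    intro x hx
    push_cast
    calc x ≤ 7 * 1 * (a * b * c * (m : ℝ) ^ 2 + 0) := by linarith
      _ ≤ _ := by gcongr; positivity
  -- `θ` is the real split for which `a * c * k = a * b * q` when `k * q = m`, that is `θ ^ 2 * c =
  -- m * b`.
  set θ : ℝ := s ^ 4 * √(b / c) with hθ
  have hθ0 : 0 ≤ θ := by positivity
  have hθ2 : θ ^ 2 * c = m * b := by
    rw [hθ, mul_pow, Real.sq_sqrt (by positivity), ← pow_mul, hsm]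
    field_simp
  -- The balance point lies below the range. Then `m * b ≤ c`, and with `k = 1` even the last term,
  -- with its factor `m ^ 3`, is at most `a * c * m ^ 2`.
  by_cases hθ1 : θ < 1
  · refine ⟨1, Finset.mem_Icc.2 ⟨le_rfl, hm⟩, hfin ?_⟩
    have hmb : (m : ℝ) * b ≤ c := by
      rw [← hθ2]
      exact mul_le_of_le_one_left (by positivity) (pow_le_one₀ hθ0 hθ1.le)
    have hq : splitRest m 1 = m := by simp [splitRest]
    rw [splitShape, hq]
    push_cast
    have e1 : (a : ℝ) * c * m * 1 * m ≤ a * b * c * (m : ℝ) ^ 2 := by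
      calc (a : ℝ) * c * m * 1 * m = a * 1 * c * (m : ℝ) ^ 2 := by ring
        _ ≤ _ := by gcongr
    have e3 : (Y : ℝ) * m * m * m ≤ a * b * c * (m : ℝ) ^ 2 := by
      calc (Y : ℝ) * m * m * m ≤ a * b * m * m * m := by gcongr
        _ = a * (m * b) * (m : ℝ) ^ 2 := by ring
        _ ≤ a * c * (m : ℝ) ^ 2 := by gcongr
        _ = a * 1 * c * (m : ℝ) ^ 2 := by ring
        _ ≤ _ := by gcongr
    linarith [e1, e3]
  -- The balance point lies above the range. Then `m * c ≤ b`, and `k = m` makes the first term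
  -- harmless.
  by_cases hθm : (m : ℝ) < θ
  · refine ⟨m, Finset.mem_Icc.2 ⟨hm, le_rfl⟩, hfin ?_⟩
    have hmc : (m : ℝ) * c ≤ b := by
      have : (m : ℝ) * (m * c) ≤ m * b := by
        rw [← hθ2]
        calc (m : ℝ) * (m * c) = (m : ℝ) ^ 2 * c := by ring
          _ ≤ _ := by gcongr
      exact le_of_mul_le_mul_left this (by linarith)
    have hq : splitRest m m = 1 := by
      rw [splitRest]
      exact Nat.div_eq_of_lt_le (by omega) (by omega)
    rw [splitShape, hq]
    push_cast
    have e1 : (a : ℝ) * c * m * m * m ≤ a * b * c * (m : ℝ) ^ 2 := by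
      calc (a : ℝ) * c * m * m * m = a * (m * c) * 1 * (m : ℝ) ^ 2 := by ring
        _ ≤ _ := by gcongr
    have e3 : (Y : ℝ) * m * 1 * m ≤ a * b * c * (m : ℝ) ^ 2 := by
      calc (Y : ℝ) * m * 1 * m = Y * (m : ℝ) ^ 2 := by ring
        _ ≤ _ := by gcongr
    linarith [e1, e3]
  rw [not_lt] at hθ1 hθm
  have hk1 : 1 ≤ ⌊θ⌋₊ := Nat.one_le_floor_iff _ |>.2 hθ1
  have hkm : ⌊θ⌋₊ ≤ m := Nat.floor_le_of_le hθm
  refine ⟨⌊θ⌋₊, Finset.mem_Icc.2 ⟨hk1, hkm⟩, ?_⟩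
  set k := ⌊θ⌋₊ with hk
  set q := splitRest m k with hq
  have hkq : (k : ℝ) * q ≤ 2 * m := by exact_mod_cast mul_splitRest_le hkm
  have hkθ : (k : ℝ) ≤ θ := Nat.floor_le hθ0
  have hθk : θ ≤ 2 * k := by
    have h3 : θ < (k : ℝ) + 1 := Nat.lt_floor_add_one θ
    have h4 : (1 : ℝ) ≤ k := by exact_mod_cast hk1
    linarith
  have hqθ : (q : ℝ) * θ ≤ 4 * m := by
    calc (q : ℝ) * θ ≤ q * (2 * k) := by gcongr
      _ = 2 * (k * q) := by ring
      _ ≤ 2 * (2 * m) := by gcongr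
      _ = _ := by ring
  have hbq : (b : ℝ) * q ≤ 4 * (c * θ) := by
    have : (b : ℝ) * q * θ ≤ 4 * (c * θ) * θ := by
      calc (b : ℝ) * q * θ = b * (q * θ) := by ring
        _ ≤ b * (4 * m) := by gcongr
        _ = 4 * (m * b) := by ring
        _ = 4 * (θ ^ 2 * c) := by rw [hθ2]
        _ = _ := by ring
    exact le_of_mul_le_mul_right this (by linarith)
  set ρ : ℝ := √(b * c) with hρ
  have hρ0 : 0 ≤ ρ := Real.sqrt_nonneg _
  have hρ2 : ρ ^ 2 = b * c := Real.sq_sqrt (by positivity)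
  have hcθ : c * θ = s ^ 4 * ρ := by
    rw [← sq_eq_sq₀ (by positivity) (by positivity), mul_pow (c : ℝ) θ, mul_pow (s ^ 4) ρ, hρ2, ← pow_mul, hsm]
    calc (c : ℝ) ^ 2 * θ ^ 2 = c * (θ ^ 2 * c) := by ring
      _ = _ := by rw [hθ2]; ring
  have hkey : (a : ℝ) * (c * θ) ≤ s ^ 3 * (a * b * c + s ^ 4) := by
    rw [hcθ]
    -- For `s ≤ ρ` the first summand suffices. Otherwise `a ≤ b ≤ ρ ^ 2`, so the left side is at
    -- most `ρ ^ 3 * s ≤ s ^ 4`; only here is `a ≤ b` needed in full.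
    have : (a : ℝ) * ρ * s ≤ a * ρ ^ 2 + s ^ 4 := by
      by_cases hρs : s ≤ ρ
      · calc (a : ℝ) * ρ * s ≤ a * ρ * ρ := by gcongr
          _ ≤ a * ρ ^ 2 + s ^ 4 := by
            have : 0 ≤ s ^ 4 := by positivity
            linarith [sq ρ, mul_assoc (a : ℝ) ρ ρ, congrArg (fun t => (a : ℝ) * t) (sq ρ)]
      · have hρs := (not_le.1 hρs).le
        have haρ : (a : ℝ) ≤ ρ ^ 2 := by
          rw [hρ2]
          exact hab'.trans (le_mul_of_one_le_right (by positivity) hc1)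
        calc (a : ℝ) * ρ * s ≤ ρ ^ 2 * ρ * s := by gcongr
          _ ≤ s ^ 2 * s * s := by gcongr
          _ = s ^ 4 := by ring
          _ ≤ _ := by
            have : 0 ≤ a * ρ ^ 2 := by positivity
            linarith
    calc (a : ℝ) * (s ^ 4 * ρ) = s ^ 3 * (a * ρ * s) := by ring
      _ ≤ s ^ 3 * (a * ρ ^ 2 + s ^ 4) := by gcongr
      _ = _ := by rw [hρ2]; ring
  rw [splitShape, ← hq]
  push_cast
  calc (a : ℝ) * c * m * k * m + a * b * c * m * k * q + Y * m * q * m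
      = a * c * k * (m : ℝ) ^ 2 + a * b * c * m * (k * q) + Y * q * (m : ℝ) ^ 2 := by ring
    _ ≤ a * c * θ * (m : ℝ) ^ 2 + a * b * c * m * (2 * m) + a * b * q * (m : ℝ) ^ 2 := by gcongr
    _ = a * (c * θ) * (m : ℝ) ^ 2 + 2 * 1 * (a * b * c * (m : ℝ) ^ 2) +
        a * (b * q) * (m : ℝ) ^ 2 := by ring
    _ ≤ a * (c * θ) * (m : ℝ) ^ 2 + 2 * s ^ 3 * (a * b * c * (m : ℝ) ^ 2) +
        a * (4 * (c * θ)) * (m : ℝ) ^ 2 := by gcongr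
    _ = 5 * (a * (c * θ)) * (m : ℝ) ^ 2 + 2 * s ^ 3 * (a * b * c * (m : ℝ) ^ 2) := by ring
    _ ≤ 5 * (s ^ 3 * (a * b * c + s ^ 4)) * (m : ℝ) ^ 2 +
        2 * s ^ 3 * (a * b * c * (m : ℝ) ^ 2 + (m : ℝ) ^ 2 * s ^ 4) := by
        gcongr
        exact le_add_of_nonneg_right (by positivity)
    _ = _ := by ring

/-! ### Split costs for general data and for graphs -/

section Split

variable {VD ED : Type*} [DecidableEq VD] [DecidableEq ED] {D : DataNetwork VD ED}

theorem plainBoundary_union_subset (U V : Finset VD) :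
    D.plainBoundary (U ∪ V) ⊆ D.plainBoundary U ∪ D.plainBoundary V := by
  intro e he
  simp only [DataNetwork.plainBoundary, boundary, Finset.mem_sdiff, Finset.mem_filter,
    Finset.mem_biUnion, Finset.mem_union, not_or] at he ⊢
  obtain ⟨⟨⟨v, hv, hev⟩, hout⟩, hs⟩ := he
  rcases hv with hv | hv
  · exact .inl ⟨⟨⟨v, hv, hev⟩, hout.imp id fun ⟨w, hw, h⟩ => ⟨w, ⟨hw.1, hw.2.1⟩, h⟩⟩, hs⟩
  · exact .inr ⟨⟨⟨v, hv, hev⟩, hout.imp id fun ⟨w, hw, h⟩ => ⟨w, ⟨hw.1, hw.2.2⟩, h⟩⟩, hs⟩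

/-- In a graph, a dimension of both `U` and `V` is contracted with them. -/
theorem DataNetwork.IsGraph.plainBoundary_union_subset (hG : D.IsGraph) {U V : Finset VD}
    (hU : U ⊆ D.verts) (hV : V ⊆ D.verts) (hUV : Disjoint U V) :
    D.plainBoundary (U ∪ V) ⊆ (D.plainBoundary U \ D.plainBoundary V) ∪
      (D.plainBoundary V \ D.plainBoundary U) := by
  intro e he
  have h1 := _root_.plainBoundary_union_subset U V he
  by_contra hcon
  have hUm : e ∈ D.plainBoundary U ∧ e ∈ D.plainBoundary V := by
    simp only [Finset.mem_union, Finset.mem_sdiff] at h1 hcon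
    tauto
  simp only [DataNetwork.plainBoundary, boundary, Finset.mem_sdiff, Finset.mem_filter,
    Finset.mem_biUnion, Finset.mem_union, not_or] at he hUm
  obtain ⟨⟨⟨⟨u, hu, heu⟩, -⟩, -⟩, ⟨⟨v, hv, hev⟩, -⟩, -⟩ := hUm
  have huv : u ≠ v := fun h => Finset.disjoint_left.1 hUV hu (h ▸ hv)
  rcases he.1.2 with hd | ⟨w, ⟨hw, hwU, hwV⟩, hew⟩
  · have hdeg := (hG e).1 hd
    exact huv (Finset.card_le_one.1 hdeg u (by simp [hU hu, heu]) v (by simp [hV hv, hev]))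
  · have hsub : ({u, v, w} : Finset VD) ⊆ D.verts.filter fun v => e ∈ D.inc v := by
      intro x hx
      simp only [Finset.mem_insert, Finset.mem_singleton] at hx
      rcases hx with rfl | rfl | rfl
      · simp [hU hu, heu]
      · simp [hV hv, hev]
      · simp [hw, hew]
    have h3 : ({u, v, w} : Finset VD).card = 3 := by
      refine Finset.card_eq_three.2 ⟨u, v, w, huv, ?_, ?_, rfl⟩
      · rintro rfl; exact hwU hu
      · rintro rfl; exact hwV hv
    have hle := Finset.card_le_card hsub
    rw [h3] at hle
    have hdeg : D.degree e ≤ 2 := by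
      by_cases hd : e ∈ D.dangling
      · exact ((hG e).1 hd).trans one_le_two
      · exact (hG e).2 hd
    exact absurd (hle.trans hdeg) (by norm_num)

theorem splitCost_eq (m : ℕ) (U V : Finset VD) (k : ℕ) :
    splitCost D m U V k = splitShape m (∏ i ∈ D.plainBoundary U, D.size i) (plainCost D U V)
      (∏ i ∈ D.plainBoundary (U ∪ V), D.size i) k := rfl

theorem exists_splitCost_le_sqrt (hD : D.IsValid) {m : ℕ} (hm : 0 < m) (U V : Finset VD) :
    ∃ k ∈ Finset.Icc 1 m, (splitCost D m U V k : ℝ) ≤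
      7 * √(m : ℝ) * (plainCost D U V * (m : ℝ) ^ 2) := by
  simp only [splitCost_eq]
  exact exists_splitShape_le_sqrt hm
    (Finset.prod_le_prod_of_subset_of_one_le' Finset.subset_union_left fun i _ _ => hD.size_pos i)
    (Finset.prod_le_prod_of_subset_of_one_le' (plainBoundary_union_subset U V)
      fun i _ _ => hD.size_pos i)

/-- The numbers `a`, `b`, `c` of `exists_splitShape_le_of_le` are the products over the plain
dimensions of `U` only, of `V` only, and of both. The graph hypothesis removes `c` from the output,
and `GoesFirst` is `a ≤ b`. -/
theorem exists_splitCost_le_of_isGraph (hD : D.IsValid) (hG : D.IsGraph) {m : ℕ} (hm : 0 < m)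
    {U V : Finset VD} (hU : U ⊆ D.verts) (hV : V ⊆ D.verts) (hUV : Disjoint U V)
    (hle : GoesFirst D U V) {s : ℝ} (hs : 0 ≤ s) (hsm : s ^ 8 = m) :
    ∃ k ∈ Finset.Icc 1 m, (splitCost D m U V k : ℝ) ≤
      7 * s ^ 3 * (plainCost D U V * (m : ℝ) ^ 2 + (m : ℝ) ^ 2 * s ^ 4) := by
  simp only [splitCost_eq]
  set P := D.plainBoundary U
  set Q := D.plainBoundary V
  have hA : ∏ i ∈ P, D.size i = (∏ i ∈ P \ Q, D.size i) * ∏ i ∈ P ∩ Q, D.size i := by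
    rw [← Finset.prod_union (Finset.disjoint_sdiff_inter P Q), Finset.sdiff_union_inter]
  have hX : plainCost D U V =
      (∏ i ∈ P \ Q, D.size i) * (∏ i ∈ Q \ P, D.size i) * ∏ i ∈ P ∩ Q, D.size i := by
    rw [mul_right_comm, ← hA, ← Finset.prod_union Finset.disjoint_sdiff,
      Finset.union_sdiff_self_eq_union]
    rfl
  have hY : ∏ i ∈ D.plainBoundary (U ∪ V), D.size i ≤
      (∏ i ∈ P \ Q, D.size i) * ∏ i ∈ Q \ P, D.size i := by
    rw [← Finset.prod_union disjoint_sdiff_sdiff]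
    exact Finset.prod_le_prod_of_subset_of_one_le' (hG.plainBoundary_union_subset hU hV hUV)
      fun i _ _ => hD.size_pos i
  rw [hA, hX]
  exact exists_splitShape_le_of_le hm (Finset.prod_pos fun i _ => hD.size_pos i)
    (Finset.prod_pos fun i _ => hD.size_pos i) hle hY hs hsm

end Split

/-! ### Comparing the algorithm with an arbitrary feasible solution -/

section Final

variable {VD ED : Type*} [DecidableEq VD] [DecidableEq ED] {D : DataNetwork VD ED}

theorem isLocalTree_algEmbedding (ch : AlgChoices VD ED) (T₀ : ContractionTree VD) (m : ℕ) :
    IsLocalTree D (algEmbedding D ch T₀ m) ch T₀ {.out} where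
  names f hf := by
    rw [Finset.mem_singleton] at hf
    subst hf
    exact id
  inc_eq _ _ := rfl
  sketch_closed _ _ _ hy hyA := absurd (Finset.mem_toRight.1 hy) hyA
  edge_closed _ _ _ hy hyA := absurd (Finset.mem_toRight.1 hy) hyA

/-- The cost of the algorithm, in terms of the data. -/
theorem algCost_le (hD : D.IsValid) {T₀ : ContractionTree VD} (hT₀ : T₀.IsTreeOn D.verts) {m : ℕ}
    (hm : 0 < m) (hms : ∀ e ∈ D.sketch, m < D.size e) {ch : AlgChoices VD ED}
    (hch : ch.IsOptimal D T₀ m) :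
    algCost D ch T₀ m ≤ 2 * (∑ e ∈ D.sketch, placeCost D T₀ m e (ch.place e) +
      ∑ p ∈ T₀.contractions.toFinset.filter
        (fun p => ¬ ∃ e ∈ D.sketch, D.sketchOf (p.1 ∪ p.2) = {e}), stepCost D ch m p) := by
  have hpl : ∀ e ∈ D.sketch, D.sketchOf (ch.place e) = {e} := fun e he => (hch.place_mem e he).2
  have hmem : ∀ x ∈ (algEmbedding D ch T₀ m).verts, ∀ e,
      Sum.inl e ∈ (algEmbedding D ch T₀ m).inc x → e ∈ D.sketch := fun x _ e he =>
    (mem_sketchOf.1 ((mem_algInc (ch := ch) (t := T₀) (o := {.out}) he).2.1 e rfl)).2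
  have h := treeCost_algTree_le (S := algEmbedding D ch T₀ m) (ch := ch) (m := m) hD hmem rfl rfl hm
    (fun e he => (hms e he).le) hpl hT₀.1 hT₀.2.le hch.split_mem
    (isLocalTree_algEmbedding ch T₀ m) (by simpa [algEmbedding, algSize] using hm)
    (by rw [Finset.prod_singleton]; show m ≤ 2 * m; omega)
  refine h.trans (Nat.mul_le_mul_left _ ?_)
  rw [ContractionTree.sum_contractions hT₀.1, ← Finset.sum_filter_add_sum_filter_not _
    (fun p : Finset VD × Finset VD => ∃ e ∈ D.sketch, D.sketchOf (p.1 ∪ p.2) = {e})]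
  have hsub : ∑ e ∈ D.sketchOf T₀.verts,
      (∏ i ∈ D.plainBoundary (ch.place e), D.size i) * D.size e * m ≤
      ∑ e ∈ D.sketch, (∏ i ∈ D.plainBoundary (ch.place e), D.size i) * D.size e * m :=
    Finset.sum_le_sum_of_subset fun e he => (mem_sketchOf.1 he).2
  -- On a contraction with exactly one dimension to be sketched, `stepCost` equals the corresponding
  -- summand of `placeCost`. Together with the costs of applying the matrices, these contractions
  -- make up all placement costs.
  have hplace : ∑ e ∈ D.sketch, placeCost D T₀ m e (ch.place e) =
      ∑ p ∈ T₀.contractions.toFinset.filter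
        (fun p => ∃ e ∈ D.sketch, D.sketchOf (p.1 ∪ p.2) = {e}), stepCost D ch m p +
      ∑ e ∈ D.sketch, (∏ i ∈ D.plainBoundary (ch.place e), D.size i) * D.size e * m := by
    rw [← sum_sum_filter_eq_singleton _ _
      (fun p : Finset VD × Finset VD => D.sketchOf (p.1 ∪ p.2)), ← Finset.sum_add_distrib]
    refine Finset.sum_congr rfl fun e he => ?_
    rw [placeCost_eq hT₀.1]
    congr 1
    refine Finset.sum_congr rfl fun p hp => ?_
    obtain ⟨hp, hpe⟩ := Finset.mem_filter.1 hp
    replace hp := List.mem_toFinset.1 hp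
    have hpt := ContractionTree.union_subset_of_mem_contractions hp
    rw [hT₀.2] at hpt
    have hb : ¬ BothSketched D p.1 p.2 := by
      rintro ⟨⟨a, ha⟩, ⟨b, hb⟩⟩
      rw [sketchOf_union] at hpe
      have ha' := Finset.mem_singleton.1 (hpe ▸ Finset.mem_union_left _ ha)
      have hb' := Finset.mem_singleton.1 (hpe ▸ Finset.mem_union_right _ hb)
      exact Finset.disjoint_left.1 (disjoint_sketchOf hD (Finset.union_subset_left hpt)
        (Finset.union_subset_right hpt) (ContractionTree.disjoint_of_mem_contractions hT₀.1 hp))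
        (ha' ▸ ha) (hb' ▸ hb)
    have hst : stepCost D ch m p = plainCost D p.1 p.2 *
        (if p.1 ∪ p.2 ⊆ ch.place e then D.size e else m) := by
      rw [stepCost, if_neg (by rw [hpe]; exact Finset.singleton_ne_empty e), if_neg hb, hpe]
      simp
    rw [hst]
  omega

open Classical in
/-- The part of the cost of the algorithm outside the regions with one dimension to be sketched. -/
theorem sum_stepCost_le (hD : D.IsValid) {T₀ : ContractionTree VD} (hT₀ : T₀.IsTreeOn D.verts)
    {m : ℕ} (hm : 0 < m) {ch : AlgChoices VD ED} {κ Λ τ : ℝ} (hκ0 : 0 < κ) (hκ : κ ≤ 1)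
    (hΛ : 1 ≤ Λ) (hτ : 0 ≤ τ) (hpl : ∀ e ∈ D.sketch, D.sketchOf (ch.place e) = {e})
    (hboth : ∀ p ∈ T₀.contractions, BothSketched D p.1 p.2 →
      (stepCost D ch m p : ℝ) ≤ 7 * Λ * (plainCost D p.1 p.2 * (m : ℝ) ^ 2 + τ)) :
    ((∑ p ∈ T₀.contractions.toFinset.filter
        (fun p => ¬ ∃ e ∈ D.sketch, D.sketchOf (p.1 ∪ p.2) = {e}), stepCost D ch m p : ℕ) : ℝ) ≤
      7 * Λ / κ ^ 2 * ∑ p ∈ T₀.contractions.toFinset, plainCost D p.1 p.2 *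
        (if D.sketchOf (p.1 ∪ p.2) = ∅ then 1
          else if BothSketched D p.1 p.2 then (κ * m) ^ 2 else κ * m) +
      7 * Λ * ((D.sketch.card - 1 : ℕ) * τ) := by
  have hm1 : (1 : ℝ) ≤ m := by exact_mod_cast hm
  set b : Finset VD × Finset VD → ℝ := fun p => if D.sketchOf (p.1 ∪ p.2) = ∅ then 1
    else if BothSketched D p.1 p.2 then (κ * m) ^ 2 else κ * m with hb
  have hb0 : ∀ p, 0 ≤ b p := by
    intro p
    simp only [hb]
    split_ifs <;> positivity
  have h7 : 1 ≤ 7 * Λ / κ ^ 2 := by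
    rw [le_div_iff₀ (by positivity)]
    have : κ ^ 2 ≤ 1 := pow_le_one₀ hκ0.le hκ
    linarith
  have h7κ : 1 ≤ 7 * Λ / κ ^ 2 * κ := by
    have : 7 * Λ / κ ^ 2 * κ = 7 * Λ / κ := by field_simp
    rw [this, le_div_iff₀ hκ0]
    linarith
  have hterm : ∀ p ∈ T₀.contractions.toFinset.filter
      (fun p => ¬ ∃ e ∈ D.sketch, D.sketchOf (p.1 ∪ p.2) = {e}),
      (stepCost D ch m p : ℝ) ≤ 7 * Λ / κ ^ 2 * (plainCost D p.1 p.2 * b p) +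
        7 * Λ * (if BothSketched D p.1 p.2 then τ else 0) := by
    intro p hp
    obtain ⟨hp, hpe⟩ := Finset.mem_filter.1 hp
    replace hp := List.mem_toFinset.1 hp
    by_cases h0 : D.sketchOf (p.1 ∪ p.2) = ∅
    · have hnb : ¬ BothSketched D p.1 p.2 := by
        rintro ⟨h1, -⟩
        rw [sketchOf_union, Finset.union_eq_empty] at h0
        exact h1.ne_empty h0.1
      simp only [hb]
      rw [stepCost, if_pos h0, if_pos h0, if_neg hnb, mul_one, mul_zero, add_zero]
      exact le_mul_of_one_le_left (by positivity) h7
    · by_cases hbs : BothSketched D p.1 p.2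
      · simp only [hb]
        rw [if_neg h0, if_pos hbs, if_pos hbs]
        refine (hboth p hp hbs).trans (le_of_eq ?_)
        field_simp
      -- A sketched contraction below a placement has exactly one dimension to be sketched, and such
      -- contractions are filtered out. So the factor in `stepCost` is `m`.
      · have hnex : ¬ ∃ e ∈ D.sketchOf (p.1 ∪ p.2), p.1 ∪ p.2 ⊆ ch.place e := by
          rintro ⟨e, he, hsub⟩
          have hes := (mem_sketchOf.1 he).2
          exact hpe ⟨e, hes, Finset.Subset.antisymm (hpl e hes ▸ sketchOf_mono hsub)
            (Finset.singleton_subset_iff.2 he)⟩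
        simp only [hb]
        rw [stepCost, if_neg h0, if_neg hbs, if_neg hnex, if_neg h0, if_neg hbs, if_neg hbs,
          mul_zero, add_zero]
        push_cast
        calc (plainCost D p.1 p.2 : ℝ) * m ≤ 7 * Λ / κ ^ 2 * κ * (plainCost D p.1 p.2 * m) :=
              le_mul_of_one_le_left (by positivity) h7κ
          _ = _ := by ring
  have hcard : ((T₀.contractions.toFinset.filter fun p => BothSketched D p.1 p.2).card : ℝ) ≤
      (D.sketch.card - 1 : ℕ) := by
    have h1 := card_bothSketched_le hD hT₀.1 hT₀.2.le
    have h2 : (T₀.contractions.toFinset.filter fun p => BothSketched D p.1 p.2).card =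
        T₀.contractions.countP (fun p => BothSketched D p.1 p.2) := by
      rw [List.countP_eq_length_filter,
        ← List.toFinset_card_of_nodup ((ContractionTree.nodup_contractions hT₀.1).filter _),
        List.toFinset_filter]
      congr 1
      ext p
      simp
    have h3 : (D.sketchOf T₀.verts).card ≤ D.sketch.card :=
      Finset.card_le_card fun e he => (mem_sketchOf.1 he).2
    rw [h2]
    exact_mod_cast h1.trans (by omega)
  have hsumτ : ∑ p ∈ T₀.contractions.toFinset, (if BothSketched D p.1 p.2 then τ else 0) ≤
      (D.sketch.card - 1 : ℕ) * τ := by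
    rw [← Finset.sum_filter, Finset.sum_const, nsmul_eq_mul]
    gcongr
  rw [Nat.cast_sum]
  calc _ ≤ _ := Finset.sum_le_sum hterm
    _ ≤ ∑ p ∈ T₀.contractions.toFinset, (7 * Λ / κ ^ 2 * (plainCost D p.1 p.2 * b p) +
        7 * Λ * (if BothSketched D p.1 p.2 then τ else 0)) := by
        refine Finset.sum_le_sum_of_subset_of_nonneg (Finset.filter_subset _ _) fun p _ _ => ?_
        have := hb0 p
        have h0 : 0 ≤ (if BothSketched D p.1 p.2 then τ else 0) := by
          split_ifs
          · exact hτ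
          · exact le_rfl
        positivity
    _ = 7 * Λ / κ ^ 2 * ∑ p ∈ T₀.contractions.toFinset, plainCost D p.1 p.2 * b p +
        7 * Λ * ∑ p ∈ T₀.contractions.toFinset, (if BothSketched D p.1 p.2 then τ else 0) := by
        rw [Finset.sum_add_distrib, ← Finset.mul_sum, ← Finset.mul_sum]
    _ ≤ _ := by gcongr

theorem stepCost_le_of_bothSketched {T₀ : ContractionTree VD} {m : ℕ} {ch : AlgChoices VD ED}
    (hch : ch.IsOptimal D T₀ m) {p : Finset VD × Finset VD} (hp : p ∈ T₀.contractions)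
    (hb : BothSketched D p.1 p.2) {k : ℕ} (hk : k ∈ Finset.Icc 1 m) :
    stepCost D ch m p ≤
      if GoesFirst D p.1 p.2 then splitCost D m p.1 p.2 k else splitCost D m p.2 p.1 k := by
  have h0 : D.sketchOf (p.1 ∪ p.2) ≠ ∅ := by
    rw [sketchOf_union]
    exact (hb.1.mono Finset.subset_union_left).ne_empty
  have := hch.split_min p hp hb k hk
  rw [stepCost, if_neg h0, if_pos hb]
  split_ifs at this ⊢ <;> exact this

theorem stepCost_le_sqrt (hD : D.IsValid) {T₀ : ContractionTree VD} {m : ℕ} (hm : 0 < m)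
    {ch : AlgChoices VD ED} (hch : ch.IsOptimal D T₀ m) {p : Finset VD × Finset VD}
    (hp : p ∈ T₀.contractions) (hb : BothSketched D p.1 p.2) :
    (stepCost D ch m p : ℝ) ≤ 7 * √(m : ℝ) * (plainCost D p.1 p.2 * (m : ℝ) ^ 2 + 0) := by
  rw [add_zero]
  by_cases hg : GoesFirst D p.1 p.2
  · obtain ⟨k, hk, hle⟩ := exists_splitCost_le_sqrt hD hm p.1 p.2
    have := stepCost_le_of_bothSketched hch hp hb hk
    rw [if_pos hg] at this
    exact le_trans (by exact_mod_cast this) hle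
  · obtain ⟨k, hk, hle⟩ := exists_splitCost_le_sqrt hD hm p.2 p.1
    have := stepCost_le_of_bothSketched hch hp hb hk
    rw [if_neg hg] at this
    rw [plainCost_comm]
    exact le_trans (by exact_mod_cast this) hle

theorem stepCost_le_of_isGraph (hD : D.IsValid) (hG : D.IsGraph) {T₀ : ContractionTree VD}
    (hT₀ : T₀.IsTreeOn D.verts) {m : ℕ} (hm : 0 < m)
    {ch : AlgChoices VD ED} (hch : ch.IsOptimal D T₀ m) {s : ℝ} (hs : 0 ≤ s) (hsm : s ^ 8 = m)
    {p : Finset VD × Finset VD} (hp : p ∈ T₀.contractions) (hb : BothSketched D p.1 p.2) :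
    (stepCost D ch m p : ℝ) ≤
      7 * s ^ 3 * (plainCost D p.1 p.2 * (m : ℝ) ^ 2 + (m : ℝ) ^ 2 * s ^ 4) := by
  have hpt := ContractionTree.union_subset_of_mem_contractions hp
  rw [hT₀.2] at hpt
  have h1 := Finset.union_subset_left hpt
  have h2 := Finset.union_subset_right hpt
  have hd := ContractionTree.disjoint_of_mem_contractions hT₀.1 hp
  by_cases hg : GoesFirst D p.1 p.2
  · obtain ⟨k, hk, hle⟩ := exists_splitCost_le_of_isGraph hD hG hm h1 h2 hd hg hs hsm
    have := stepCost_le_of_bothSketched hch hp hb hk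
    rw [if_pos hg] at this
    exact le_trans (by exact_mod_cast this) hle
  · obtain ⟨k, hk, hle⟩ := exists_splitCost_le_of_isGraph hD hG hm h2 h1 hd.symm
      (not_le.1 hg).le hs hsm
    have := stepCost_le_of_bothSketched hch hp hb hk
    rw [if_neg hg] at this
    rw [plainCost_comm]
    exact le_trans (by exact_mod_cast this) hle

/-- Any feasible cost bounds the three parts of the cost of the algorithm. -/
theorem bounds_of_mem_feasibleCosts (hD : D.IsValid) {T₀ : ContractionTree VD}
    (hT₀ : T₀.IsTreeOn D.verts) {c₁ c₂ ε δ : ℝ} (hc₁ : 0 < c₁) (hc₂ : 0 < c₂)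
    (hu : 0 < sketchUnit ε δ) {m : ℕ} (hm : 0 < m)
    (hm1 : c₁ * D.sketch.card * sketchUnit ε δ ≤ m) (hm2 : m ≤ c₂ * D.sketch.card * sketchUnit ε δ)
    (hms : ∀ e ∈ D.sketch, m < D.size e) {ch : AlgChoices VD ED}
    (hch : ch.IsOptimal D T₀ m) {c : ℕ} (hc : c ∈ feasibleCosts D T₀ c₁ c₂ ε δ) {κ : ℝ}
    (hκ : κ = (c₁ / c₂) ^ 2) :
    κ ≤ 1 ∧ κ * (∑ e ∈ D.sketch, placeCost D T₀ m e (ch.place e) : ℕ) ≤ 3 * c ∧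
    (∀ b : Finset VD × Finset VD → ℝ, (∀ p ∈ T₀.contractions, b p ≤ 1 ∨
      ((D.sketchOf (p.1 ∪ p.2)).Nonempty ∧ b p ≤ κ * m) ∨
      (BothSketched D p.1 p.2 ∧ b p ≤ (κ * m) ^ 2)) →
      ∑ p ∈ T₀.contractions.toFinset, plainCost D p.1 p.2 * b p ≤ c) ∧
    (D.sketch.card - 1 : ℕ) * ((κ * m) ^ 2 * √(κ * m)) ≤ 5 * (c₂ / c₁) * c := by
  obtain ⟨S, T, hS, hSN, hT, hTc, rfl⟩ := hc
  have hm0 : (0 : ℝ) < m := by exact_mod_cast hm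
  have hNpos : 0 < D.sketch.card := Finset.card_pos.2 hD.sketch_nonempty
  have hN0 : (0 : ℝ) < D.sketch.card := by exact_mod_cast hNpos
  -- `m` lies between the two bounds, so the interval is nonempty.
  have hc12 : c₁ ≤ c₂ := by
    have h1 := hm1.trans hm2
    rw [mul_assoc, mul_assoc] at h1
    exact le_of_mul_le_mul_right h1 (by positivity)
  have hx0 : 0 < c₁ / c₂ := by positivity
  have hx1 : c₁ / c₂ ≤ 1 := (div_le_one hc₂).2 hc12
  have hκ0 : 0 < κ := hκ ▸ by positivity
  have hκ1 : κ ≤ 1 := hκ ▸ pow_le_one₀ hx0.le hx1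
  have hSne : S.verts.Nonempty := by
    obtain ⟨e, he⟩ := hD.sketch_nonempty
    obtain ⟨x, hx, -⟩ := Embedding.existsUnique_vert (hS.graph.data_degree e he)
    exact ⟨x, hx⟩
  obtain ⟨ord, hinj, hrow⟩ := hS.accurate
  set r : ℝ := c₁ * S.verts.card * sketchUnit ε δ with hr
  -- A factor `c₁ / c₂` is lost twice: from `m` to the sketch size of the competitor, through the
  -- requirement with `N`, and from that sketch size to its row sizes, through the number of its
  -- tensors. Hence the square in `κ`.
  have hr_ge : κ * m ≤ r := by
    have h1 : (c₁ / c₂) * S.sketchSize ≤ r := by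
      calc (c₁ / c₂) * S.sketchSize ≤ (c₁ / c₂) * (c₂ * S.verts.card * sketchUnit ε δ) := by
            gcongr; exact hS.sketchSize_le
        _ = r := by rw [hr]; field_simp
    have h2 : (c₁ / c₂) * m ≤ S.sketchSize := by
      calc (c₁ / c₂) * m ≤ (c₁ / c₂) * (c₂ * D.sketch.card * sketchUnit ε δ) := by gcongr
        _ = c₁ * D.sketch.card * sketchUnit ε δ := by field_simp
        _ ≤ _ := hSN
    calc κ * m = (c₁ / c₂) * ((c₁ / c₂) * m) := by rw [hκ]; ring
      _ ≤ (c₁ / c₂) * S.sketchSize := by gcongr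
      _ ≤ r := h1
  have hemb : ∀ x ∈ S.verts, κ * m ≤ S.rowSize ord x := fun x hx => hr_ge.trans (hrow x hx)
  have hdata : ∀ e ∈ D.sketch, κ * m ≤ D.size e := fun e he =>
    (mul_le_of_le_one_left hm0.le hκ1).trans (by exact_mod_cast (hms e he).le)
  obtain ⟨src, dst, hdir⟩ := exists_isDirecting hD hS.graph hinj
  refine ⟨hκ1, ?_, ?_, ?_⟩
  · exact hdir.sum_placeCost_le hD hSne hκ0.le hκ1 hms hemb hT₀ hT hTc hch.place_min
  · exact fun b hb => hdir.sum_plainCost_le (by positivity) hdata hemb hT₀ hT hTc b hb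
  · have hσ2 : √(κ * m) ^ 2 = κ * m := Real.sq_sqrt (by positivity)
    have hout : (S.sketchSize : ℝ) ≤ c₂ / c₁ * r := by
      refine hS.sketchSize_le.trans (le_of_eq ?_)
      rw [hr]; field_simp
    have := hdir.sketch_card_mul_le hD hSne (σ := √(κ * m)) (r := r) (K := c₂ / c₁)
      (Real.sqrt_pos.2 (by positivity)) ((one_le_div hc₁).2 hc12) (by rwa [hσ2]) hrow
      (by rwa [hσ2]) hout hT
    have h5 : √(κ * m) ^ 5 = (κ * m) ^ 2 * √(κ * m) := by
      calc √(κ * m) ^ 5 = (√(κ * m) ^ 2) ^ 2 * √(κ * m) := by ring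
        _ = _ := by rw [hσ2]
    rw [h5, ← mul_div_assoc, div_le_iff₀ (by positivity)] at this
    linarith

end Final

theorem theorem4p3 (c₁ c₂ : ℝ) (hc₁ : 0 < c₁) (hc₂ : 0 < c₂) :
    ∃ C : ℝ, 0 < C ∧
      ∀ (VD ED : Type*) [DecidableEq VD] [DecidableEq ED]
        (D : DataNetwork VD ED) (_ : D.IsValid)
        (T₀ : ContractionTree VD) (_ : T₀.IsTreeOn D.verts)
        (ε δ : ℝ) (_ : 0 < ε) (_ : 0 < δ) (_ : δ < 1)
        (m : ℕ) (_ : c₁ * D.sketch.card * sketchUnit ε δ ≤ m)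
        (_ : (m : ℝ) ≤ c₂ * D.sketch.card * sketchUnit ε δ)
        (_ : ∀ e ∈ D.sketch, m < D.size e)
        (ch : AlgChoices VD ED) (_ : ch.IsOptimal D T₀ m)
        (c_opt : ℕ) (_ : IsLeast (feasibleCosts D T₀ c₁ c₂ ε δ) c_opt),
        (algCost D ch T₀ m : ℝ) ≤ C * √(m : ℝ) * c_opt ∧
        (D.IsGraph → (algCost D ch T₀ m : ℝ) ≤ C * (m : ℝ) ^ (0.375 : ℝ) * c_opt) := by
  obtain ⟨κ, hκ⟩ : ∃ κ : ℝ, κ = (c₁ / c₂) ^ 2 := ⟨_, rfl⟩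
  have hκ0 : 0 < κ := hκ ▸ by positivity
  have hK0 : 0 < c₂ / c₁ := by positivity
  -- `3 / κ` pays for the placements, `7 / κ ^ 2` for the part of the steps proportional to the
  -- lower bound, and `35 = 7 * 5` for the additive excess through the count of heavy contractions.
  -- The outer `2` comes from rounding the split.
  refine ⟨2 * (3 / κ + (7 / κ ^ 2 + 35 * (c₂ / c₁) / κ ^ 3)), by positivity, ?_⟩
  rintro VD ED _ _ D hD T₀ hT₀ ε δ hε hδ hδ1 m hm1 hm2 hms ch hch c ⟨hc, -⟩
  have hu : 0 < sketchUnit ε δ :=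
    div_pos (Real.log_pos ((one_lt_div hδ).2 hδ1)) (by positivity)
  have hNpos : 0 < D.sketch.card := Finset.card_pos.2 hD.sketch_nonempty
  have hm : 0 < m := by
    have : (0 : ℝ) < m := lt_of_lt_of_le (by positivity) hm1
    exact_mod_cast this
  have hmR : (1 : ℝ) ≤ m := by exact_mod_cast hm
  obtain ⟨hκ1, hplace, hplain, hcount⟩ :=
    bounds_of_mem_feasibleCosts hD hT₀ hc₁ hc₂ hu hm hm1 hm2 hms hch hc hκ
  have hpl : ∀ e ∈ D.sketch, D.sketchOf (ch.place e) = {e} := fun e he => (hch.place_mem e he).2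
  have halg := algCost_le hD hT₀ hm hms hch
  -- Both claims follow from one estimate, where `Λ` is the loss at a contraction with two sketched
  -- sides and `τ` an additive excess. An excess up to `m ^ 2.5` is affordable, since there are at
  -- most `N - 1` such contractions and `hcount` bounds `N - 1` times that size.
  have hfin : ∀ Λ τ : ℝ, 1 ≤ Λ → 0 ≤ τ → τ ≤ (m : ℝ) ^ 2 * √(m : ℝ) →
      (∀ p ∈ T₀.contractions, BothSketched D p.1 p.2 →
        (stepCost D ch m p : ℝ) ≤ 7 * Λ * (plainCost D p.1 p.2 * (m : ℝ) ^ 2 + τ)) →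
      (algCost D ch T₀ m : ℝ) ≤
        2 * (3 / κ + (7 / κ ^ 2 + 35 * (c₂ / c₁) / κ ^ 3)) * Λ * c := by
    intro Λ τ hΛ hτ0 hτ hboth
    have hsum := sum_stepCost_le hD hT₀ hm hκ0 hκ1 hΛ hτ0 hpl hboth
    have h1 := hplain (fun p => if D.sketchOf (p.1 ∪ p.2) = ∅ then 1
      else if BothSketched D p.1 p.2 then (κ * m) ^ 2 else κ * m) (by
        intro p _
        split_ifs with h0 hb
        · exact .inl le_rfl
        · exact .inr (.inr ⟨hb, le_rfl⟩)
        · exact .inr (.inl ⟨Finset.nonempty_iff_ne_empty.2 h0, le_rfl⟩))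
    have h2 : ((D.sketch.card - 1 : ℕ) : ℝ) * τ ≤ 5 * (c₂ / c₁) / κ ^ 3 * c := by
      have hκs : κ ^ 3 * ((m : ℝ) ^ 2 * √(m : ℝ)) ≤ (κ * m) ^ 2 * √(κ * m) := by
        have : κ * √(m : ℝ) ≤ √(κ * m) := by
          rw [Real.sqrt_mul hκ0.le]
          gcongr
          exact Real.le_sqrt_of_sq_le (by nlinarith)
        calc κ ^ 3 * ((m : ℝ) ^ 2 * √(m : ℝ)) = (κ * m) ^ 2 * (κ * √(m : ℝ)) := by ring
          _ ≤ _ := by gcongr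
      have : κ ^ 3 * (((D.sketch.card - 1 : ℕ) : ℝ) * τ) ≤ 5 * (c₂ / c₁) * c := by
        calc κ ^ 3 * (((D.sketch.card - 1 : ℕ) : ℝ) * τ)
            ≤ κ ^ 3 * (((D.sketch.card - 1 : ℕ) : ℝ) * ((m : ℝ) ^ 2 * √(m : ℝ))) := by gcongr
          _ = ((D.sketch.card - 1 : ℕ) : ℝ) * (κ ^ 3 * ((m : ℝ) ^ 2 * √(m : ℝ))) := by ring
          _ ≤ ((D.sketch.card - 1 : ℕ) : ℝ) * ((κ * m) ^ 2 * √(κ * m)) := by gcongr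
          _ ≤ _ := hcount
      rw [div_mul_eq_mul_div, le_div_iff₀ (by positivity)]
      linarith
    have h3 : ((∑ e ∈ D.sketch, placeCost D T₀ m e (ch.place e) : ℕ) : ℝ) ≤ 3 / κ * c := by
      rw [div_mul_eq_mul_div, le_div_iff₀ hκ0]
      linarith
    have h4 : (algCost D ch T₀ m : ℝ) ≤
        2 * (((∑ e ∈ D.sketch, placeCost D T₀ m e (ch.place e) : ℕ) : ℝ) +
          ((∑ p ∈ T₀.contractions.toFinset.filter
            (fun p => ¬ ∃ e ∈ D.sketch, D.sketchOf (p.1 ∪ p.2) = {e}), stepCost D ch m p : ℕ) :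
              ℝ)) := by
      exact_mod_cast halg
    calc (algCost D ch T₀ m : ℝ) ≤ _ := h4
      _ ≤ 2 * (3 / κ * c + (7 * Λ / κ ^ 2 * c + 7 * Λ * (5 * (c₂ / c₁) / κ ^ 3 * c))) := by
          gcongr
          refine hsum.trans ?_
          gcongr
      _ = 2 * (3 / κ) * 1 * c + 2 * (7 / κ ^ 2 + 35 * (c₂ / c₁) / κ ^ 3) * Λ * c := by ring
      _ ≤ 2 * (3 / κ) * Λ * c + 2 * (7 / κ ^ 2 + 35 * (c₂ / c₁) / κ ^ 3) * Λ * c := by gcongr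
      _ = _ := by ring
  refine ⟨hfin _ 0 (Real.one_le_sqrt.2 hmR) le_rfl (by positivity)
    fun p hp hb => stepCost_le_sqrt hD hm hch hp hb, fun hG => ?_⟩
  -- With this choice the loss `s ^ 3` is `m ^ 0.375`, and the excess `m ^ 2 * s ^ 4` is exactly `m
  -- ^ 2.5`, the largest that `hfin` allows.
  set s : ℝ := (m : ℝ) ^ (1 / 8 : ℝ) with hs
  have hs0 : 0 ≤ s := by positivity
  have hs8 : s ^ 8 = m := by
    rw [hs, ← Real.rpow_natCast, ← Real.rpow_mul (by positivity)]
    norm_num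
  have hs3 : s ^ 3 = (m : ℝ) ^ (0.375 : ℝ) := by
    rw [hs, ← Real.rpow_natCast, ← Real.rpow_mul (by positivity)]
    norm_num
  have hs4 : s ^ 4 = √(m : ℝ) := by
    rw [← hs8, show s ^ 8 = (s ^ 4) ^ 2 by ring, Real.sqrt_sq (by positivity)]
  rw [← hs3]
  refine hfin _ ((m : ℝ) ^ 2 * s ^ 4) ?_ (by positivity) (by rw [hs4]) fun p hp hb =>
    stepCost_le_of_isGraph hD hG hT₀ hm hch hs0 hs8 hp hb
  exact one_le_pow₀ (Real.one_le_rpow hmR (by norm_num))
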